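/- Let $B$ be a compact connected Riemann surface, $\mathcal X$ a compact connected complex manifold of dimension $n+1$, and $\pi:\mathcal X\to B$ a surjective holomorphic map (for instance, the complex points of a flat proper morphism from a smooth complex projective variety to a smooth projective curve). An admissible $N$-th jet $\hat\sigma$ at $b\in B$ is the truncation modulo $\mathfrak m_{B,b}^{N+1}$ of a local holomorphic section of $\pi$ near $b$; its support is the value $x\in\mathcal X_b=\pi^{-1}(b)$ of that section at $b$. In local holomorphic coordinates on $\mathcal X$ at $x$ and a local coordinate $z$ on $B$ centred at $b$, it is given by a vector $\rho(z)$ of polynomials of degree at most $N$. A family $(\sigma_\xi)_{\xi\in K}$ of continuous sections of $\pi$, with $K$ compact Hausdorff and $(\xi,b)\mapsto \sigma_\xi(b)$ continuous, induces $\hat\sigma$ if $\sigma_\xi(b)=x$ for all $\xi$ and, in these coordinates, $\sigma_\xi(z)-\rho(z)=o(|z|^N)$ as $z\to0$, uniformly in $\xi$. For $\alpha\in H_2(\mathcal X,\mathbb Z)$ and a finite set $\Sigma$ of admissible jets, let $\mathrm{Sect}^{\mathrm{stop}}(\mathcal X/B,\alpha,\Sigma)$ be the set of continuous sections $\sigma$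 of $\pi$ with $\sigma_*[B]=\alpha$ that induce all the jets in $\Sigma$, with the finest topology for which every continuous family of such sections that is parametrized by a compact Hausdorff space $K$ and induces all the jets in $\Sigma$ is a continuous map from $K$. Let $b_0\in B$ be a point such that the fiber $\mathcal X_{b_0}$ is smooth, i.e., $\pi$ is a submersion at every point of $\mathcal X_{b_0}$. Let $\Sigma_0$ be a finite set of admissible jets (of arbitrary orders) over pairwise distinct points of $B\setminus\{b_0\}$, let $\hat\sigma_0,\hat\sigma_0'$ be admissible $0$-th jets over $b_0$ with distinct supports $x_0\neq x_0'$, and put $\Sigma=\{\hat\sigma_0\}\cup\Sigma_0$ and $\Sigma'=\{\hat\sigma_0'\}\cup\Sigma_0$. Let $f:\mathbb P^1\to\mathcal X_{b_0}$ be a holomorphic map with $f([1:0])=x_0$ and $f([0:1])=x_0'$, and let $\beta=f_*[\mathbb P^1]\in H_2(\mathcal X,\mathbb Z)$. Then, for every $\alpha\in H_2(\mathcal X,\mathbb Z)$, there is a homotopy equivalence $$\mathrm{Sect}^{\mathrm{stop}}(\mathcal X/B,\alpha,\Sigma)\sim\mathrm{Sect}^{\mathrm{stop}}(\mathcal X/B,\alpha+\beta,\Sigma).$$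 Moreover, there are an injective parametrization $w\mapsto \delta(w)$ of a closed disc in $B$ by $\{|w|\le1\}$, holomorphic at every point of $\{|w|\le 1\}$, with $\delta(0)=b_0$ and with no base point of a jet in $\Sigma_0$ in its image, a homeomorphism $\phi=(\phi_1,\phi_2)$ over the disc from the part of $\mathcal X$ over it to $\{|w|\le1\}\times\mathcal X_{b_0}$ with $\phi(x)=(0,x)$ for $x\in\mathcal X_{b_0}$, and homotopy equivalences, each a homotopy inverse of the other, $$\Phi:\mathrm{Sect}^{\mathrm{stop}}(\mathcal X/B,\alpha,\Sigma)\to\mathrm{Sect}^{\mathrm{stop}}(\mathcal X/B,\alpha+\beta,\Sigma'),\qquad \Psi:\mathrm{Sect}^{\mathrm{stop}}(\mathcal X/B,\alpha+\beta,\Sigma')\to\mathrm{Sect}^{\mathrm{stop}}(\mathcal X/B,\alpha,\Sigma)$$ which glue $f$, respectively the oppositely oriented sphere: both maps leave a section $\sigma$ unchanged outside the disc, replace $\sigma(\delta(w))$ by $\phi^{-1}\bigl(w,\phi_2(\sigma(\delta(\tfrac{2|w|-1}{|w|}w)))\bigr)$ for $\tfrac12\le|w|\le1$, and for $|w|<\tfrac12$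 replace it by $\phi^{-1}\bigl(w,f([\tan(\pi|w|)\,w:1])\bigr)$ in the case of $\Phi$, and by $\phi^{-1}\bigl(w,f([1:\tan(\pi|w|)\,\overline w])\bigr)$ in the case of $\Psi$. -/

import Mathlib

open Set Filter Topology CategoryTheory
open scoped Manifold ContDiff Simplicial ContinuousMap

/-! ## The complex projective line

`OnePoint ℂ` is the projective line, `w : ℂ` being the point `[w : 1]` and `∞` the point `[1 : 0]`. -/

/-- The inversion `[u : v] ↦ [v : u]` of the projective line. -/
noncomputable def sphereInv (p : OnePoint ℂ) : OnePoint ℂ :=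
  p.elim ((0 : ℂ) : OnePoint ℂ) fun w => open Classical in if w = 0 then OnePoint.infty else ((w⁻¹ : ℂ) : OnePoint ℂ)

theorem sphereInv_infty : sphereInv OnePoint.infty = ((0 : ℂ) : OnePoint ℂ) := rfl

theorem sphereInv_zero : sphereInv ((0 : ℂ) : OnePoint ℂ) = OnePoint.infty := by
  simp [sphereInv]

theorem sphereInv_coe {w : ℂ} (hw : w ≠ 0) :
    sphereInv (w : OnePoint ℂ) = ((w⁻¹ : ℂ) : OnePoint ℂ) := by
  simp [sphereInv, hw]

theorem sphereInv_sphereInv (p : OnePoint ℂ) : sphereInv (sphereInv p) = p := by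
  induction p using OnePoint.rec with
  | infty => rw [sphereInv_infty, sphereInv_zero]
  | coe w =>
    by_cases hw : w = 0
    · rw [hw, sphereInv_zero, sphereInv_infty]
    · rw [sphereInv_coe hw, sphereInv_coe (inv_ne_zero hw), inv_inv]

theorem continuous_sphereInv : Continuous sphereInv := by
  rw [continuous_iff_continuousAt]
  intro p
  induction p using OnePoint.rec with
  | infty =>
    rw [OnePoint.continuousAt_infty']
    rw [sphereInv_infty, OnePoint.nhds_coe_eq, coclosedCompact_eq_cocompact,
      ← Metric.cobounded_eq_cocompact]
    have h1 : Tendsto (fun w : ℂ => ((w⁻¹ : ℂ) : OnePoint ℂ)) (Bornology.cobounded ℂ)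
        (map (↑) (𝓝 (0 : ℂ))) :=
      tendsto_map.comp tendsto_inv₀_cobounded
    refine h1.congr' ?_
    filter_upwards [(Bornology.isBounded_singleton (x := (0 : ℂ)) : {(0 : ℂ)}ᶜ ∈ Bornology.cobounded ℂ)] with w hw
    exact (sphereInv_coe hw).symm
  | coe w =>
    rw [OnePoint.continuousAt_coe]
    by_cases hw : w = 0
    · subst hw
      rw [ContinuousAt, Function.comp_apply, sphereInv_zero]
      rw [← pure_sup_nhdsNE, tendsto_sup]
      refine ⟨?_, ?_⟩
      · rw [tendsto_pure_left]
        intro s hs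
        simpa [sphereInv_zero] using mem_of_mem_nhds hs
      · have h1 : Tendsto (fun w : ℂ => ((w⁻¹ : ℂ) : OnePoint ℂ)) (𝓝[≠] 0) (𝓝 OnePoint.infty) := by
          refine OnePoint.tendsto_coe_infty.comp ?_
          rw [coclosedCompact_eq_cocompact, ← Metric.cobounded_eq_cocompact]
          exact tendsto_inv₀_nhdsNE_zero
        refine h1.congr' ?_
        filter_upwards [self_mem_nhdsWithin] with w hw
        exact (sphereInv_coe hw).symm
    · have h1 : ContinuousAt (fun w : ℂ => ((w⁻¹ : ℂ) : OnePoint ℂ)) w :=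
        OnePoint.continuous_coe.continuousAt.comp (continuousAt_inv₀ hw)
      refine h1.congr ?_
      filter_upwards [isOpen_ne.mem_nhds hw] with v hv
      exact (sphereInv_coe hv).symm

/-- The inversion as a homeomorphism. -/
noncomputable def sphereInvHomeomorph : OnePoint ℂ ≃ₜ OnePoint ℂ where
  toFun := sphereInv
  invFun := sphereInv
  left_inv := sphereInv_sphereInv
  right_inv := sphereInv_sphereInv
  continuous_toFun := continuous_sphereInv
  continuous_invFun := continuous_sphereInv

/-- The affine chart `[w : 1] ↦ w`. -/
noncomputable def sphereChartZero : OpenPartialHomeomorph (OnePoint ℂ) ℂ :=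
  (OnePoint.isOpenEmbedding_coe.toOpenPartialHomeomorph ((↑) : ℂ → OnePoint ℂ)).symm

/-- The affine chart `[1 : w] ↦ w`. -/
noncomputable def sphereChartInfty : OpenPartialHomeomorph (OnePoint ℂ) ℂ :=
  sphereInvHomeomorph.toOpenPartialHomeomorph.trans sphereChartZero

/-- The complex structure of the projective line, given by the two affine charts. -/
noncomputable instance sphereChartedSpace : ChartedSpace ℂ (OnePoint ℂ) where
  atlas := {sphereChartZero, sphereChartInfty}
  chartAt p := p.elim sphereChartInfty fun _ => sphereChartZero
  mem_chart_source p := by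
    induction p using OnePoint.rec with
    | infty => simp [sphereChartInfty, sphereChartZero, sphereInvHomeomorph, sphereInv_infty]
    | coe w => simp [sphereChartZero]
  chart_mem_atlas p := by
    induction p using OnePoint.rec with
    | infty => simp
    | coe w => simp

theorem sphereChartZero_coe (w : ℂ) : sphereChartZero (w : OnePoint ℂ) = w :=
  (OnePoint.isOpenEmbedding_coe.toOpenPartialHomeomorph
    ((↑) : ℂ → OnePoint ℂ)).left_inv (x := w) (by simp)

theorem sphereChart_transition (w : ℂ) : sphereChartZero (sphereInv (w : OnePoint ℂ)) = w⁻¹ ∨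
    sphereInv (w : OnePoint ℂ) = OnePoint.infty := by
  by_cases hw : w = 0
  · right; rw [hw, sphereInv_zero]
  · left; rw [sphereInv_coe hw, sphereChartZero_coe]

instance sphereIsManifold : IsManifold 𝓘(ℂ) ω (OnePoint ℂ) := by
  have key : ∀ s : Set ℂ, (∀ w ∈ s, sphereInv (w : OnePoint ℂ) ≠ OnePoint.infty) →
      ContDiffOn ℂ ω (fun w : ℂ => sphereChartZero (sphereInv (w : OnePoint ℂ))) s := by
    intro s hs
    have h0 : ∀ w ∈ s, w ≠ 0 := fun w hw h => hs w hw (by rw [h, sphereInv_zero])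
    have : ContDiffOn ℂ ω (fun w : ℂ => w⁻¹) s := fun w hw =>
      (contDiffAt_inv ℂ (h0 w hw)).contDiffWithinAt
    exact this.congr fun w hw => (sphereChart_transition w).resolve_right (hs w hw)
  have hsrc : ∀ p : OnePoint ℂ, p ∈ sphereChartZero.source → p ≠ OnePoint.infty := by
    rintro p ⟨w, -, rfl⟩
    simp
  refine isManifold_of_contDiffOn _ _ _ ?_
  rintro e e' (rfl | rfl) (rfl | rfl)
  · refine contDiffOn_id.congr ?_
    intro w _
    exact sphereChartZero_coe w
  · refine key _ ?_
    intro w hw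
    exact hsrc _ hw.1.2.2
  · refine key _ ?_
    intro w hw
    exact hsrc _ hw.1.2
  · refine contDiffOn_id.congr ?_
    intro w _
    change sphereChartZero (sphereInv (sphereInv (w : OnePoint ℂ))) = w
    rw [sphereInv_sphereInv]
    exact sphereChartZero_coe w

/-! ## Singular homology and fundamental classes -/

/-- The singular chain complex of `Y` with integral coefficients. -/
noncomputable abbrev singularChains (Y : Type) [TopologicalSpace Y] :
    ChainComplex (ModuleCat ℤ) ℕ :=
  ((AlgebraicTopology.singularChainComplexFunctor (ModuleCat ℤ)).obj (ModuleCat.of ℤ ℤ)).obj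
    (TopCat.of Y)

/-- The map on singular chains induced by a continuous map. -/
noncomputable abbrev singularChainsMap {Y Z : Type} [TopologicalSpace Y] [TopologicalSpace Z]
    (g : C(Y, Z)) : singularChains Y ⟶ singularChains Z :=
  ((AlgebraicTopology.singularChainComplexFunctor (ModuleCat ℤ)).obj (ModuleCat.of ℤ ℤ)).map
    (TopCat.ofHom g)

/-- The second integral singular homology group `H₂(Y, ℤ)`. -/
noncomputable abbrev H₂ (Y : Type) [TopologicalSpace Y] : ModuleCat ℤ :=
  ((AlgebraicTopology.singularHomologyFunctor (ModuleCat ℤ) 2).obj (ModuleCat.of ℤ ℤ)).obj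
    (TopCat.of Y)

/-- The pushforward `g_* : H₂(Y, ℤ) → H₂(Z, ℤ)`. -/
noncomputable abbrev H₂Map {Y Z : Type} [TopologicalSpace Y] [TopologicalSpace Z]
    (g : C(Y, Z)) : H₂ Y ⟶ H₂ Z :=
  ((AlgebraicTopology.singularHomologyFunctor (ModuleCat ℤ) 2).obj (ModuleCat.of ℤ ℤ)).map
    (TopCat.ofHom g)

/-- A singular 2-simplex, as a singular chain. -/
noncomputable def simplexChain {Y : Type} [TopologicalSpace Y]
    (τ : C(stdSimplex ℝ (Fin 3), Y)) : (singularChains Y).X 2 :=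
  (SSet.ιChainComplex (R := ModuleCat.of ℤ ℤ) (TopCat.toSSet.obj (TopCat.of Y)) (n := 2)
    ((TopCat.toSSetObjEquiv (TopCat.of Y) (Opposite.op ⦋2⦌)).symm τ)) (1 : ℤ)

/-- `τ` is, in the preferred holomorphic chart at `b`, the affine triangle with vertices
`c + r`, `c + r ω`, `c + r ω²`, where `c` is the coordinate of `b` and `ω = exp (2πi/3)`: a positively
oriented triangle around `b`. -/
def IsPositiveTriangle {B : Type} [TopologicalSpace B] [ChartedSpace ℂ B] (b : B) (r : ℝ)
    (τ : C(stdSimplex ℝ (Fin 3), B)) : Prop :=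
  ∀ t : stdSimplex ℝ (Fin 3), τ t ∈ (chartAt ℂ b).source ∧
    chartAt ℂ b (τ t) = chartAt ℂ b b +
      r * ∑ k : Fin 3, ((t.1 k : ℝ) : ℂ) *
        Complex.exp (2 * Real.pi * Complex.I / 3) ^ (k : ℕ)

/-- `μ` is the fundamental class of the closed Riemann surface `B`, with its complex orientation:
at every point `b`, the image of `μ` in `H₂(B, B ∖ {b})` is the class of a positively
oriented triangle around `b`, that is, `μ` is represented by a cycle which is the sum of such a
triangle and of a chain in `B ∖ {b}`. -/
def IsFundamentalClass {B : Type} [TopologicalSpace B] [ChartedSpace ℂ B] (μ : H₂ B) : Prop :=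
  ∀ b : B, ∃ (r : ℝ) (τ : C(stdSimplex ℝ (Fin 3), B)) (z : (singularChains B).cycles 2)
    (c : (singularChains ({b}ᶜ : Set B)).X 2),
    0 < r ∧ IsPositiveTriangle b r τ ∧
    (singularChains B).homologyπ 2 z = μ ∧
    (singularChains B).iCycles 2 z =
      simplexChain τ + (singularChainsMap (⟨Subtype.val, continuous_subtype_val⟩ :
        C(({b}ᶜ : Set B), B))).f 2 c

/-- The continuous map `g` has class `α`: `g_* [B] = α`. -/
def HasClass {B X : Type} [TopologicalSpace B] [ChartedSpace ℂ B] [TopologicalSpace X]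
    (g : C(B, X)) (α : H₂ X) : Prop :=
  ∃ μ : H₂ B, IsFundamentalClass μ ∧ H₂Map g μ = α

/-! ## Jets and spaces of sections

`B` is a Riemann surface, `X` a complex manifold of dimension `n + 1`, and `π : X → B`. -/

section Sections

variable {B X : Type} [TopologicalSpace B] [ChartedSpace ℂ B]
  [TopologicalSpace X]

/-- `s` is, near `b`, a holomorphic section of `π`. -/
def IsLocalSection (n : ℕ) [ChartedSpace (EuclideanSpace ℂ (Fin (n + 1))) X]
    (π : X → B) (b : B) (s : B → X) : Prop :=
  ContMDiffAt 𝓘(ℂ) 𝓘(ℂ, EuclideanSpace ℂ (Fin (n + 1))) ω s b ∧ ∀ᶠ b' in 𝓝 b, π (s b') = b'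

/-- The `k`-th Taylor coefficient at `b` of `s`, read in the preferred charts at `b` and `s b`. -/
noncomputable def taylorCoeff (n : ℕ) [ChartedSpace (EuclideanSpace ℂ (Fin (n + 1))) X]
    (s : B → X) (b : B) (k : ℕ) :
    EuclideanSpace ℂ (Fin (n + 1)) :=
  ((k.factorial : ℂ))⁻¹ • iteratedDeriv k
    (fun w : ℂ => chartAt (EuclideanSpace ℂ (Fin (n + 1))) (s b) (s ((chartAt ℂ b).symm w)))
    (chartAt ℂ b b)

/-- An admissible jet of order `N` of `π` at a point of `B`: the truncation modulo `𝔪 ^ (N + 1)` of a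
local holomorphic section. It is recorded by its support in `X` and by the coefficients of
degree at most `N` of its coordinates. -/
structure AdmissibleJet (n : ℕ) [ChartedSpace (EuclideanSpace ℂ (Fin (n + 1))) X]
    (π : X → B) where
  base : B
  order : ℕ
  support : X
  coeff : Fin (order + 1) → EuclideanSpace ℂ (Fin (n + 1))
  exists_section : ∃ s : B → X, IsLocalSection n π base s ∧ s base = support ∧
    ∀ k : Fin (order + 1), taylorCoeff n s base k = coeff k

/-- The polynomials `ρ` of degree at most `N` representing the jet, in the coordinate
`z = chartAt ℂ j.base · - chartAt ℂ j.base j.base` on `B`. -/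
noncomputable def AdmissibleJet.poly {n : ℕ}
    [ChartedSpace (EuclideanSpace ℂ (Fin (n + 1))) X] {π : X → B} (j : AdmissibleJet n π) (z : ℂ) :
    EuclideanSpace ℂ (Fin (n + 1)) :=
  ∑ k : Fin (j.order + 1), z ^ (k : ℕ) • j.coeff k

/-- The family `F` of maps `B → X` parametrized by `K` induces the jet `j`: all members pass through
the support, and in local coordinates `F ξ - ρ = o(|z| ^ N)` as `z → 0`, uniformly in `ξ : K`. -/
def Induces {n : ℕ} [ChartedSpace (EuclideanSpace ℂ (Fin (n + 1))) X]
    {π : X → B} {K : Type} (F : K → B → X) (j : AdmissibleJet n π) : Prop :=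
  (∀ ξ, F ξ j.base = j.support) ∧
  ∀ ε : ℝ, 0 < ε → ∀ᶠ b in 𝓝 j.base, ∀ ξ,
    ‖chartAt (EuclideanSpace ℂ (Fin (n + 1))) j.support (F ξ b) -
        j.poly (chartAt ℂ j.base b - chartAt ℂ j.base j.base)‖ ≤
      ε * ‖chartAt ℂ j.base b - chartAt ℂ j.base j.base‖ ^ j.order

/-- The semi-topological model `Sect^stop(X/B, α, S)`: continuous sections of `π` of class `α` which
induce the jets in `S`. -/
def SectStop {n : ℕ} [ChartedSpace (EuclideanSpace ℂ (Fin (n + 1))) X]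
    (π : X → B) (α : H₂ X) (S : Set (AdmissibleJet n π)) : Type :=
  {σ : C(B, X) // (∀ b, π (σ b) = b) ∧ HasClass σ α ∧ ∀ j ∈ S, Induces (fun _ : Unit => σ) j}

/-- `F` is a continuous family of elements of `Sect^stop(X/B, α, S)` parametrized by `K`. -/
def IsContinuousFamily {n : ℕ} [ChartedSpace (EuclideanSpace ℂ (Fin (n + 1))) X]
    {π : X → B} {α : H₂ X} {S : Set (AdmissibleJet n π)} {K : Type}
    [TopologicalSpace K] (F : K → SectStop π α S) : Prop :=
  Continuous (fun p : K × B => (F p.1).1 p.2) ∧ ∀ j ∈ S, Induces (fun ξ => (F ξ).1) j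

/-- The compactly generated topology on `Sect^stop(X/B, α, S)`: the finest topology for which
all continuous families parametrized by compact Hausdorff spaces are continuous. -/
instance SectStop.topologicalSpace {n : ℕ}
    [ChartedSpace (EuclideanSpace ℂ (Fin (n + 1))) X] (π : X → B) (α : H₂ X) (S : Set (AdmissibleJet n π)) :
    TopologicalSpace (SectStop π α S) :=
  ⨆ (K : CompHaus.{0}) (F : K → SectStop π α S) (_ : IsContinuousFamily F),
    TopologicalSpace.coinduced F inferInstance

/-! ## Gluing a sphere -/

/-- A trivialization of `π` over a closed holomorphic disc around `b₀`: the parametrized disc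
`disc : {|w| ≤ 1} → B`, and a homeomorphism `φ` from the part of `X` over it
to `{|w| ≤ 1} × π⁻¹(b₀)` over the disc, which is `x ↦ (0, x)` on `π⁻¹(b₀)`. Here `retr` is the second
component of `φ` and `lift` is the inverse of `φ`. -/
structure DiscTrivialization (π : X → B) (b₀ : B) where
  disc : ℂ → B
  disc_zero : disc 0 = b₀
  disc_holomorphic : ∀ w ∈ Metric.closedBall (0 : ℂ) 1, ContMDiffAt 𝓘(ℂ) 𝓘(ℂ) ω disc w
  disc_injOn : InjOn disc (Metric.closedBall 0 1)
  retr : X → X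
  lift : ℂ → X → X
  retr_continuousOn : ContinuousOn retr (π ⁻¹' (disc '' Metric.closedBall 0 1))
  lift_continuousOn : ContinuousOn (fun q : ℂ × X => lift q.1 q.2)
    (Metric.closedBall 0 1 ×ˢ (π ⁻¹' {b₀}))
  retr_mem : ∀ x, π x ∈ disc '' Metric.closedBall 0 1 → π (retr x) = b₀
  lift_mem : ∀ w ∈ Metric.closedBall (0 : ℂ) 1, ∀ y, π y = b₀ → π (lift w y) = disc w
  retr_lift : ∀ w ∈ Metric.closedBall (0 : ℂ) 1, ∀ y, π y = b₀ → retr (lift w y) = y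
  lift_retr : ∀ w ∈ Metric.closedBall (0 : ℂ) 1, ∀ x, π x = disc w → lift w (retr x) = x
  lift_zero : ∀ y, π y = b₀ → lift 0 y = y

/-- `σ'` is obtained from `σ` by gluing the vertical disc `g`: outside the disc nothing changes, on the
annulus `1/2 ≤ |w| ≤ 1` the restriction of `σ` to the whole disc is inserted radially,
and on `|w| < 1/2` the section is replaced by `g`. -/
def DiscTrivialization.IsGluing {π : X → B} {b₀ : B} (T : DiscTrivialization π b₀) (g : ℂ → X)
    (σ σ' : B → X) : Prop :=
  (∀ b, b ∉ T.disc '' Metric.closedBall 0 1 → σ' b = σ b) ∧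
  (∀ w : ℂ, 1 / 2 ≤ ‖w‖ → ‖w‖ ≤ 1 →
    σ' (T.disc w) = T.lift w (T.retr (σ (T.disc (((2 * ‖w‖ - 1) / ‖w‖ : ℝ) * w))))) ∧
  (∀ w : ℂ, ‖w‖ < 1 / 2 → σ' (T.disc w) = T.lift w (g w))

end Sections

/-- The disc `|w| < 1/2` wrapped around the sphere `f`, from `f(0)` at the centre to `f(∞)` at the
boundary: `w ↦ f([tan(π|w|) w : 1])`. -/
noncomputable def sphereDisc {X : Type} (f : OnePoint ℂ → X) (w : ℂ) : X :=
  f (((Real.tan (Real.pi * ‖w‖) : ℝ) * w : ℂ) : OnePoint ℂ)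

/-- The disc `|w| < 1/2` wrapped around the oppositely oriented sphere, from `f(∞)` at the centre
to `f(0)` at the boundary: `w ↦ f([1 : tan(π|w|) conj(w)])`. -/
noncomputable def sphereDiscOpp {X : Type} (f : OnePoint ℂ → X) (w : ℂ) : X :=
  f (sphereInv (((Real.tan (Real.pi * ‖w‖) : ℝ) * (starRingEnd ℂ) w : ℂ) : OnePoint ℂ))

/-! Over a small disc around `b₀` the family is a product with the fibre
(`exists_discTrivialization`, a form of Ehresmann's theorem). A section over the disc then has a
fibre component, and this can be changed radially: `modify` rescales the radius by a profile `a`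
and, where `a` vanishes, inserts a sphere `h` of the fibre with radial parameter `q`. Gluing `f` is
one such modification. It alters nothing outside the disc, so the jets of `S₀` survive uniformly in
families, and over `b₀` only a value is prescribed.

Gluing a sphere and then its reverse makes the fibre component run along each meridian from the top
of the sphere to the bottom and back. Cutting this excursion short and then undoing the rescaling is
a path of profiles which keeps the value over `b₀` fixed (`isProfile_unglue`). It therefore gives a
homotopy inside the space of sections with prescribed jets (`glueSect_homotopic_id`), and the two
gluings are mutually inverse up to homotopy (`exists_glue_equiv`).

It remains to see that gluing `f` adds the class of `f` (`H₂Map_modify_sphere`). A fundamental class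
is represented by a small triangle around a point plus a chain avoiding a neighbourhood of that
point. If two maps differ only very near the point, the chain contributes equally to both, and the
difference of the push-forwards is the image of the class of two triangles glued along their edges
(`IsFundamentalClass.exists_triangle`). This is applied once to the section with and without a tiny
sphere, and once to `f`, reparametrized so as to be constant away from `0`, against a constant map.
Both times the map from the double triangle deforms to a bubble, that is the sphere on one triangle
and a constant on the other; two bubbles differ by a radial reparametrization only and are homotopic
(`glue_bubble_homotopic`).

For the equivalence with the same `Σ` on both sides, the path of constant loops along a meridian of
`f` is glued instead of a sphere. This moves the support from `x₀` to `x₀'` and leaves the class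
unchanged, so its inverse can be composed with the gluing of `f`. -/

/-! ### Singular homology: local comparison of push-forwards of a fundamental class. -/

theorem H₂Map_eq_of_homotopic {Y Z : Type} [TopologicalSpace Y] [TopologicalSpace Z]
    {g g' : C(Y, Z)} (h : g.Homotopic g') : H₂Map g = H₂Map g' := by
  obtain ⟨H⟩ := h
  exact TopCat.Homotopy.congr_homologyMap_singularChainComplexFunctor
    (f := TopCat.ofHom g) (g := TopCat.ofHom g') H (ModuleCat.of ℤ ℤ) 2

theorem H₂Map_comp_apply {Y Z W : Type} [TopologicalSpace Y] [TopologicalSpace Z]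
    [TopologicalSpace W] (g : C(Z, W)) (g' : C(Y, Z)) (μ : H₂ Y) :
    H₂Map (g.comp g') μ = H₂Map g (H₂Map g' μ) := by
  have : H₂Map (g.comp g') = H₂Map g' ≫ H₂Map g := by
    rw [← Functor.map_comp]; rfl
  rw [this]; rfl

/-- A constant map factors through a point, whose second homology vanishes. Constant maps thus serve
as the reference against which the class of a sphere is measured. -/
theorem H₂Map_const_apply {Y Z : Type} [TopologicalSpace Y] [TopologicalSpace Z]
    (z : Z) (μ : H₂ Y) : H₂Map (ContinuousMap.const Y z) μ = 0 := by
  have h : ContinuousMap.const Y z =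
      (ContinuousMap.const PUnit.{1} z).comp (ContinuousMap.const Y PUnit.unit) := rfl
  rw [h, H₂Map_comp_apply]
  have h0 : Limits.IsZero (H₂ PUnit.{1}) :=
    AlgebraicTopology.isZero_singularHomologyFunctor_of_totallyDisconnectedSpace _ 2 _
      (TopCat.of PUnit.{1}) two_ne_zero
  have : H₂Map (ContinuousMap.const PUnit.{1} z) = 0 := h0.eq_zero_of_src _
  rw [this]; rfl

theorem singularChainsMap_simplexChain {Y Z : Type} [TopologicalSpace Y] [TopologicalSpace Z]
    (g : C(Y, Z)) (τ : C(stdSimplex ℝ (Fin 3), Y)) :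
    (singularChainsMap g).f 2 (simplexChain τ) = simplexChain (g.comp τ) := by
  have := SSet.ι_chainComplexMap_f _ _ (f := TopCat.toSSet.map (TopCat.ofHom g)) (R := ModuleCat.of ℤ ℤ)
    ((TopCat.toSSetObjEquiv (TopCat.of Y) (Opposite.op ⦋2⦌)).symm τ)
  exact congrArg (fun φ => φ.hom (1 : ℤ)) this

/-- The faces of a singular 2-simplex are its restrictions to the edges. -/
theorem simplexChain_d_eq {Y : Type} [TopologicalSpace Y] {τ τ' : C(stdSimplex ℝ (Fin 3), Y)}
    (h : ∀ t : stdSimplex ℝ (Fin 3), (∃ i, t.1 i = 0) → τ t = τ' t) :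
    (singularChains Y).d 2 1 (simplexChain τ) = (singularChains Y).d 2 1 (simplexChain τ') := by
  set e := TopCat.toSSetObjEquiv (TopCat.of Y) (Opposite.op ⦋2⦌)
  have key : ∀ i : Fin 3, (TopCat.toSSet.obj (TopCat.of Y)).δ i (e.symm τ) =
      (TopCat.toSSet.obj (TopCat.of Y)).δ i (e.symm τ') := by
    intro i
    apply (TopCat.toSSetObjEquiv (TopCat.of Y) (Opposite.op ⦋1⦌)).injective
    ext t
    refine h (stdSimplex.map (SimplexCategory.δ i) t) ⟨i, ?_⟩
    -- The `i`-th coordinate of a point of the `i`-th face is a sum over the preimage of `i` under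
    -- the coface map, which omits `i`.
    change FunOnFinite.linearMap ℝ ℝ (SimplexCategory.δ i) t.1 i = 0
    rw [FunOnFinite.linearMap_apply_apply, Finset.filter_eq_empty_iff.2, Finset.sum_empty]
    exact fun k _ => Fin.succAbove_ne i k
  have h1 := SSet.ιChainComplex_d (TopCat.toSSet.obj (TopCat.of Y)) (ModuleCat.of ℤ ℤ) (e.symm τ)
  have h2 := SSet.ιChainComplex_d (TopCat.toSSet.obj (TopCat.of Y)) (ModuleCat.of ℤ ℤ) (e.symm τ')
  simp only [key] at h1
  exact congrArg (fun φ => φ.hom (1 : ℤ)) (h1.trans h2.symm)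

/-- The chain module is a coproduct of copies of `ℤ` indexed by simplices, so the quotient map by
`N` vanishes as soon as it kills every simplex. -/
theorem chain_induction {Y : Type} [TopologicalSpace Y] (N : AddSubgroup ((singularChains Y).X 2))
    (h : ∀ τ, simplexChain τ ∈ N) (c : (singularChains Y).X 2) : c ∈ N := by
  let q : (singularChains Y).X 2 →ₗ[ℤ] ((singularChains Y).X 2 ⧸ N) :=
    { toFun := QuotientAddGroup.mk' N
      map_add' := map_add _
      map_smul' := fun m x => by
        have := map_zsmul (QuotientAddGroup.mk' N) m x
        rw [RingHom.id_apply, ← this]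
        congr 1
        exact int_smul_eq_zsmul _ m x }
  have h0 : ModuleCat.ofHom q = 0 := by
    apply SSet.chainComplex_hom_ext
    intro x
    obtain ⟨τ, rfl⟩ := (TopCat.toSSetObjEquiv (TopCat.of Y) (Opposite.op ⦋2⦌)).symm.surjective x
    ext
    exact (QuotientAddGroup.eq_zero_iff _).2 (h τ)
  exact (QuotientAddGroup.eq_zero_iff _).1 (congrArg (fun φ => φ.hom c) h0)

/-- Two copies of the standard triangle glued along their boundaries. -/
abbrev DoubleTriangle : Type :=
  {p : stdSimplex ℝ (Fin 3) × ℝ // |p.2| = p.1.1 0 * p.1.1 1 * p.1.1 2}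

namespace DoubleTriangle

theorem prod_nonneg (t : stdSimplex ℝ (Fin 3)) : 0 ≤ t.1 0 * t.1 1 * t.1 2 :=
  mul_nonneg (mul_nonneg (t.2.1 0) (t.2.1 1)) (t.2.1 2)

theorem continuous_prod :
    Continuous fun t : stdSimplex ℝ (Fin 3) => t.1 0 * t.1 1 * t.1 2 := by
  have h (i : Fin 3) : Continuous fun t : stdSimplex ℝ (Fin 3) => t.1 i :=
    (continuous_apply i).comp continuous_subtype_val
  exact ((h 0).mul (h 1)).mul (h 2)

/-- The first copy of the triangle. -/
noncomputable def upper : C(stdSimplex ℝ (Fin 3), DoubleTriangle) where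
  toFun t := ⟨(t, t.1 0 * t.1 1 * t.1 2), abs_of_nonneg (prod_nonneg t)⟩
  continuous_toFun := (continuous_id.prodMk continuous_prod).subtype_mk _

/-- The second copy of the triangle. -/
noncomputable def lower : C(stdSimplex ℝ (Fin 3), DoubleTriangle) where
  toFun t := ⟨(t, -(t.1 0 * t.1 1 * t.1 2)), by
    rw [abs_neg]; exact abs_of_nonneg (prod_nonneg t)⟩
  continuous_toFun := Continuous.subtype_mk (p := fun p : stdSimplex ℝ (Fin 3) × ℝ =>
    |p.2| = p.1.1 0 * p.1.1 1 * p.1.1 2) (continuous_id.prodMk (continuous_neg.comp continuous_prod)) fun t => by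
      change |-(t.1 0 * t.1 1 * t.1 2)| = _
      rw [abs_neg]; exact abs_of_nonneg (prod_nonneg t)

/-- The product of the barycentric coordinates vanishes exactly on the edges. Hence its graph and
the graph of its negative meet precisely along the edges, which realizes the gluing without a
quotient space. -/
theorem prod_eq_zero_iff (t : stdSimplex ℝ (Fin 3)) :
    t.1 0 * t.1 1 * t.1 2 = 0 ↔ ∃ i, t.1 i = 0 := by
  simp [Fin.exists_fin_succ, or_assoc]

theorem upper_eq_lower {t : stdSimplex ℝ (Fin 3)} (h : ∃ i, t.1 i = 0) : upper t = lower t := by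
  have := (prod_eq_zero_iff t).2 h
  simp [upper, lower, this]

/-- The boundary of a simplex depends only on its restriction to the edges, where the two copies
coincide, so the two boundaries cancel. -/
theorem exists_cycle : ∃ z : (singularChains DoubleTriangle).cycles 2,
    (singularChains DoubleTriangle).iCycles 2 z = simplexChain upper - simplexChain lower := by
  let e := TopCat.toSSetObjEquiv (TopCat.of DoubleTriangle) (Opposite.op ⦋2⦌)
  let S := TopCat.toSSet.obj (TopCat.of DoubleTriangle)
  let k : ModuleCat.of ℤ ℤ ⟶ (singularChains DoubleTriangle).X 2 :=
    SSet.ιChainComplex S (e.symm upper) - SSet.ιChainComplex S (e.symm lower)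
  have hk : k ≫ (singularChains DoubleTriangle).d 2 1 = 0 := by
    ext
    have h := simplexChain_d_eq (τ := upper) (τ' := lower) fun t ht => upper_eq_lower ht
    change (singularChains DoubleTriangle).d 2 1 (simplexChain upper - simplexChain lower) = 0
    rw [map_sub, h, sub_self]
  refine ⟨(singularChains DoubleTriangle).liftCycles k 1 (by simp) hk (1 : ℤ), ?_⟩
  have := (singularChains DoubleTriangle).liftCycles_i k 1 (by simp) hk
  exact congrArg (fun φ => φ.hom (1 : ℤ)) this

/-- The difference of the two copies of the triangle, as a homology class. -/
noncomputable def fundClass : H₂ DoubleTriangle :=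
  (singularChains DoubleTriangle).homologyπ 2 exists_cycle.choose

variable {X : Type} [TopologicalSpace X]

/-- The two formulas meet where the height is zero, which is over the edges. The parameter space
allows the same statement to produce single maps and homotopies. -/
theorem continuous_glue {K : Type} [TopologicalSpace K] {a b : K → stdSimplex ℝ (Fin 3) → X}
    (ha : Continuous fun p : K × stdSimplex ℝ (Fin 3) => a p.1 p.2)
    (hb : Continuous fun p : K × stdSimplex ℝ (Fin 3) => b p.1 p.2)
    (hab : ∀ k (t : stdSimplex ℝ (Fin 3)), (∃ i, t.1 i = 0) → a k t = b k t) :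
    Continuous fun p : K × DoubleTriangle =>
      if 0 ≤ p.2.1.2 then a p.1 p.2.1.1 else b p.1 p.2.1.1 := by
  refine Continuous.if_le (f := fun _ => (0 : ℝ)) (g := fun p : K × DoubleTriangle => p.2.1.2)
    (ha.comp (by fun_prop : Continuous fun p : K × DoubleTriangle => (p.1, p.2.1.1)))
    (hb.comp (by fun_prop : Continuous fun p : K × DoubleTriangle => (p.1, p.2.1.1)))
    (by fun_prop) (by fun_prop) ?_
  rintro ⟨k, ⟨⟨t, y⟩, hy⟩⟩ h
  refine hab k t ((prod_eq_zero_iff t).1 ?_)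
  simp only at h hy
  rw [← hy, ← h, abs_zero]

/-- The map from the double triangle which is `a` on the first copy and `b` on the second. -/
noncomputable def glue (a b : C(stdSimplex ℝ (Fin 3), X))
    (hab : ∀ t : stdSimplex ℝ (Fin 3), (∃ i, t.1 i = 0) → a t = b t) : C(DoubleTriangle, X) where
  toFun p := if 0 ≤ p.1.2 then a p.1.1 else b p.1.1
  continuous_toFun := (continuous_glue (K := Unit) (a := fun _ => a) (b := fun _ => b)
    (by fun_prop) (by fun_prop) fun _ => hab).comp
      (by fun_prop : Continuous fun p : DoubleTriangle => (Unit.unit, p))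

theorem glue_upper (a b : C(stdSimplex ℝ (Fin 3), X))
    (hab : ∀ t : stdSimplex ℝ (Fin 3), (∃ i, t.1 i = 0) → a t = b t) :
    (glue a b hab).comp upper = a := by
  ext t
  exact if_pos (prod_nonneg t)

theorem glue_lower (a b : C(stdSimplex ℝ (Fin 3), X))
    (hab : ∀ t : stdSimplex ℝ (Fin 3), (∃ i, t.1 i = 0) → a t = b t) :
    (glue a b hab).comp lower = b := by
  ext t
  change (if 0 ≤ -(t.1 0 * t.1 1 * t.1 2) then a t else b t) = b t
  split_ifs with h
  · exact hab t ((prod_eq_zero_iff t).1 (le_antisymm (by linarith) (prod_nonneg t)))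
  · rfl

/-- The edges may move during the homotopy; it is enough that the two halves agree on them at each
time. -/
theorem glue_homotopic {a b : unitInterval → stdSimplex ℝ (Fin 3) → X}
    (ha : Continuous fun p : unitInterval × stdSimplex ℝ (Fin 3) => a p.1 p.2)
    (hb : Continuous fun p : unitInterval × stdSimplex ℝ (Fin 3) => b p.1 p.2)
    (hab : ∀ k (t : stdSimplex ℝ (Fin 3)), (∃ i, t.1 i = 0) → a k t = b k t)
    {a₀ b₀ a₁ b₁ : C(stdSimplex ℝ (Fin 3), X)}
    (h₀ : ∀ t : stdSimplex ℝ (Fin 3), (∃ i, t.1 i = 0) → a₀ t = b₀ t)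
    (h₁ : ∀ t : stdSimplex ℝ (Fin 3), (∃ i, t.1 i = 0) → a₁ t = b₁ t)
    (ha₀ : ∀ t, a 0 t = a₀ t) (hb₀ : ∀ t, b 0 t = b₀ t)
    (ha₁ : ∀ t, a 1 t = a₁ t) (hb₁ : ∀ t, b 1 t = b₁ t) :
    (glue a₀ b₀ h₀).Homotopic (glue a₁ b₁ h₁) :=
  ⟨{ toFun := fun p => if 0 ≤ p.2.1.2 then a p.1 p.2.1.1 else b p.1 p.2.1.1
     continuous_toFun := continuous_glue ha hb hab
     map_zero_left := fun p => by simp only [ha₀, hb₀]; rfl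
     map_one_left := fun p => by simp only [ha₁, hb₁]; rfl }⟩

end DoubleTriangle

theorem H₂Map_homologyπ {Y Z : Type} [TopologicalSpace Y] [TopologicalSpace Z] (g : C(Y, Z))
    (z : (singularChains Y).cycles 2) :
    H₂Map g ((singularChains Y).homologyπ 2 z) =
      (singularChains Z).homologyπ 2 (HomologicalComplex.cyclesMap (singularChainsMap g) 2 z) :=
  (congrArg (fun φ => φ.hom z)
    (HomologicalComplex.homologyπ_naturality (singularChainsMap g) 2)).symm ▸ rfl

theorem iCycles_cyclesMap {Y Z : Type} [TopologicalSpace Y] [TopologicalSpace Z] (g : C(Y, Z))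
    (z : (singularChains Y).cycles 2) :
    (singularChains Z).iCycles 2 (HomologicalComplex.cyclesMap (singularChainsMap g) 2 z) =
      (singularChainsMap g).f 2 ((singularChains Y).iCycles 2 z) :=
  congrArg (fun φ => φ.hom z) (HomologicalComplex.cyclesMap_i (singularChainsMap g) 2)

/-- A singular chain in the complement of `b` avoids a neighbourhood of `b`. -/
theorem exists_nhds_chain_avoids {B : Type} [TopologicalSpace B] [T2Space B] (b : B)
    (c : (singularChains ({b}ᶜ : Set B)).X 2) :
    ∃ U ∈ 𝓝 b, ∀ (X : Type) [TopologicalSpace X] (g₁ g₂ : C(B, X)),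
      (∀ x ∉ U, g₁ x = g₂ x) →
      (singularChainsMap g₁).f 2 ((singularChainsMap (⟨Subtype.val, continuous_subtype_val⟩ :
        C(({b}ᶜ : Set B), B))).f 2 c) =
      (singularChainsMap g₂).f 2 ((singularChainsMap (⟨Subtype.val, continuous_subtype_val⟩ :
        C(({b}ᶜ : Set B), B))).f 2 c) := by
  -- The chains admitting such a neighbourhood form a subgroup, because neighbourhoods can be
  -- intersected. This reduces the claim to one simplex, whose image is compact, hence closed, and
  -- misses `b`.
  let N : AddSubgroup ((singularChains ({b}ᶜ : Set B)).X 2) :=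
    { carrier := {c | ∃ U ∈ 𝓝 b, ∀ (X : Type) [TopologicalSpace X] (g₁ g₂ : C(B, X)),
        (∀ x ∉ U, g₁ x = g₂ x) →
        (singularChainsMap g₁).f 2 ((singularChainsMap (⟨Subtype.val, continuous_subtype_val⟩ :
          C(({b}ᶜ : Set B), B))).f 2 c) =
        (singularChainsMap g₂).f 2 ((singularChainsMap (⟨Subtype.val, continuous_subtype_val⟩ :
          C(({b}ᶜ : Set B), B))).f 2 c)}
      zero_mem' := ⟨univ, univ_mem, fun X _ g₁ g₂ _ => by simp only [map_zero]⟩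
      add_mem' := by
        rintro c c' ⟨U, hU, h⟩ ⟨U', hU', h'⟩
        refine ⟨U ∩ U', inter_mem hU hU', fun X _ g₁ g₂ hg => ?_⟩
        simp only [map_add]
        rw [h X g₁ g₂ fun x hx => hg x fun hx' => hx hx'.1,
          h' X g₁ g₂ fun x hx => hg x fun hx' => hx hx'.2]
      neg_mem' := by
        rintro c ⟨U, hU, h⟩
        refine ⟨U, hU, fun X _ g₁ g₂ hg => ?_⟩
        simp only [map_neg]
        rw [h X g₁ g₂ hg] }
  refine chain_induction N (fun τ => ?_) c
  have hK : IsCompact (range fun t => (τ t : B)) :=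
    isCompact_range (continuous_subtype_val.comp τ.continuous)
  refine ⟨(range fun t => (τ t : B))ᶜ, hK.isClosed.isOpen_compl.mem_nhds ?_, ?_⟩
  · rintro ⟨t, ht⟩
    exact (τ t).2 ht
  · intro X _ g₁ g₂ hg
    simp only [singularChainsMap_simplexChain]
    congr 1
    ext t
    exact hg _ fun h => h ⟨t, rfl⟩

/-- Two maps which differ only near `b` have push-forwards of a fundamental class which differ by
the class of the double triangle. -/
theorem IsFundamentalClass.exists_triangle {B : Type} [TopologicalSpace B] [T2Space B]
    [ChartedSpace ℂ B] {μ : H₂ B} (hμ : IsFundamentalClass μ) (b : B) :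
    ∃ (r : ℝ) (τ : C(stdSimplex ℝ (Fin 3), B)), 0 < r ∧ IsPositiveTriangle b r τ ∧
      ∃ U ∈ 𝓝 b, ∀ (X : Type) [TopologicalSpace X] (g₁ g₂ : C(B, X)),
      (∀ x ∉ U, g₁ x = g₂ x) →
      ∀ h : ∀ t : stdSimplex ℝ (Fin 3), (∃ i, t.1 i = 0) → g₁.comp τ t = g₂.comp τ t,
      H₂Map g₁ μ - H₂Map g₂ μ =
        H₂Map (DoubleTriangle.glue (g₁.comp τ) (g₂.comp τ) h) DoubleTriangle.fundClass := by
  obtain ⟨r, τ, z, c, hr, hτ, rfl, hz⟩ := hμ b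
  obtain ⟨U, hU, hc⟩ := exists_nhds_chain_avoids b c
  refine ⟨r, τ, hr, hτ, U, hU, fun X _ g₁ g₂ hg h => ?_⟩
  rw [DoubleTriangle.fundClass, H₂Map_homologyπ, H₂Map_homologyπ, H₂Map_homologyπ]
  refine (map_sub ((singularChains X).homologyπ 2).hom _ _).symm.trans
    (congrArg ((singularChains X).homologyπ 2).hom ?_)
  -- Equality of cycles can be tested on chains, where the contributions of `c` cancel and only the
  -- two images of the triangle are left.
  have hmono : Function.Injective ((singularChains X).iCycles 2) :=
    (ModuleCat.mono_iff_injective _).1 inferInstance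
  apply hmono
  rw [map_sub, iCycles_cyclesMap, iCycles_cyclesMap, iCycles_cyclesMap,
    DoubleTriangle.exists_cycle.choose_spec, hz, map_add, map_add, map_sub, hc X g₁ g₂ hg,
    add_sub_add_right_eq_sub]
  simp only [singularChainsMap_simplexChain, DoubleTriangle.glue_upper, DoubleTriangle.glue_lower]

/-! ### Polar coordinates on the closed unit disc. -/

section UnitInterval

open unitInterval

/-- The point `s * u` of the closed unit disc with polar coordinates `s` and `u`. -/
noncomputable def polarPoint (p : I × Circle) : ℂ := (p.1 : ℝ) * (p.2 : ℂ)

theorem continuous_polarPoint : Continuous polarPoint := by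
  unfold polarPoint; fun_prop

theorem norm_polarPoint (p : I × Circle) : ‖polarPoint p‖ = p.1 := by
  simp [polarPoint, abs_of_nonneg p.1.2.1, Circle.norm_coe]

theorem polarPoint_mem (p : I × Circle) : polarPoint p ∈ Metric.closedBall (0 : ℂ) 1 := by
  rw [mem_closedBall_zero_iff, norm_polarPoint]; exact p.1.2.2

theorem polarPoint_zero (u : Circle) : polarPoint (0, u) = 0 := by simp [polarPoint]

theorem exists_circle_mul (w : ℂ) : ∃ u : Circle, w = (‖w‖ : ℂ) * (u : ℂ) := by
  by_cases hw : w = 0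
  · exact ⟨1, by simp [hw]⟩
  · refine ⟨⟨w / ‖w‖, by simp [Submonoid.unitSphere, hw]⟩, ?_⟩
    have : (‖w‖ : ℂ) ≠ 0 := by simpa using hw
    exact (mul_div_cancel₀ w this).symm

theorem exists_polarPoint {w : ℂ} (hw : w ∈ Metric.closedBall (0 : ℂ) 1) :
    ∃ p : I × Circle, polarPoint p = w := by
  obtain ⟨u, hu⟩ := exists_circle_mul w
  exact ⟨(⟨‖w‖, norm_nonneg w, mem_closedBall_zero_iff.1 hw⟩, u), hu.symm⟩

theorem polarPoint_eq {p p' : I × Circle} (h : polarPoint p = polarPoint p') :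
    p.1 = p'.1 ∧ (p.1 = 0 ∨ p = p') := by
  have h1 : p.1 = p'.1 := by
    have := congrArg norm h
    rw [norm_polarPoint, norm_polarPoint] at this
    exact Subtype.ext this
  refine ⟨h1, or_iff_not_imp_left.2 fun h0 => Prod.ext h1 ?_⟩
  have h0' : ((p.1 : ℝ) : ℂ) ≠ 0 := by
    rw [Complex.ofReal_ne_zero]
    exact fun h => h0 (Subtype.ext h)
  unfold polarPoint at h
  rw [← h1] at h
  exact Circle.ext (mul_left_cancel₀ h0' h)

/-! ### Modification of sections over a disc along radial profiles. -/

section Modify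

variable {B X : Type} [TopologicalSpace X]

/-- A family of loops in the fibre of `π` over `b₀`, parametrized by the unit interval, which starts
and ends with constant loops. -/
structure FiberSphere (π : X → B) (b₀ : B) where
  map : C(I × Circle, X)
  bot : X
  top : X
  map_mem : ∀ p, π (map p) = b₀
  map_zero : ∀ u, map (0, u) = bot
  map_one : ∀ u, map (1, u) = top

/-- The reversed family. -/
noncomputable def FiberSphere.reverse {π : X → B} {b₀ : B} (h : FiberSphere π b₀) :
    FiberSphere π b₀ where
  map := h.map.comp ⟨fun p => (σ p.1, p.2), by fun_prop⟩
  bot := h.top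
  top := h.bot
  map_mem p := h.map_mem _
  map_zero u := by simp [h.map_one]
  map_one u := by simp [h.map_zero]

theorem FiberSphere.reverse_map {π : X → B} {b₀ : B} (h : FiberSphere π b₀) (s : I) (u : Circle) :
    h.reverse.map (s, u) = h.map (σ s, u) := rfl

theorem FiberSphere.reverse_reverse {π : X → B} {b₀ : B} (h : FiberSphere π b₀) :
    h.reverse.reverse = h := by
  cases h
  simp only [reverse, mk.injEq, and_true]
  ext p
  simp

/-- Radial profiles along which a section can be modified: the section is rescaled by `a`, and
where `a` vanishes it is replaced by `h` with parameter `q`. -/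
structure FiberSphere.IsProfile {π : X → B} {b₀ : B} (h : FiberSphere π b₀) (a q : I → I) :
    Prop where
  zero : a 0 = 0
  one : a 1 = 1
  zero_or_one : ∀ r, a r = 0 ∨ q r = 1
  center : ∀ u u', h.map (q 0, u) = h.map (q 0, u')

namespace DiscTrivialization

variable [TopologicalSpace B] [ChartedSpace ℂ B] {π : X → B} {b₀ : B}
  (T : DiscTrivialization π b₀) (h : FiberSphere π b₀)

theorem retr_fiber {y : X} (hy : π y = b₀) : T.retr y = y := by
  have h0 : (0 : ℂ) ∈ Metric.closedBall (0 : ℂ) 1 := by simp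
  have := T.retr_lift 0 h0 y hy
  rwa [T.lift_zero y hy] at this

theorem disc_continuousOn : ContinuousOn T.disc (Metric.closedBall 0 1) :=
  fun w hw => (T.disc_holomorphic w hw).continuousAt.continuousWithinAt

theorem continuous_disc_polarPoint : Continuous fun p : I × Circle => T.disc (polarPoint p) :=
  T.disc_continuousOn.comp_continuous continuous_polarPoint polarPoint_mem

/-- The fibre component of the modified section. -/
noncomputable def modifyFiber (a q : I → I) (s : B → X) (p : I × Circle) : X :=
  open Classical in
  if a p.1 = 0 then h.map (q p.1, p.2) else T.retr (s (T.disc (polarPoint (a p.1, p.2))))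

/-- The modification of a section over the disc, along the radial profiles `a` and `q`. -/
noncomputable def modify (a q : I → I) (s : B → X) (b : B) : X :=
  open Classical in
  if hb : ∃ p : I × Circle, T.disc (polarPoint p) = b then
    T.lift (polarPoint hb.choose) (T.modifyFiber h a q s hb.choose) else s b

variable {h} {a q : I → I}

theorem modify_of_notMem (s : B → X) {b : B} (hb : b ∉ T.disc '' Metric.closedBall 0 1) :
    T.modify h a q s b = s b := by
  rw [modify, dif_neg]
  rintro ⟨p, rfl⟩
  exact hb ⟨_, polarPoint_mem p, rfl⟩

/-- The choice of polar coordinates in `modify` is harmless: they are ambiguous only at the origin,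
where `a` vanishes and the inserted value does not depend on the angle. -/
theorem modify_disc (ha : h.IsProfile a q) (s : B → X) (p : I × Circle) :
    T.modify h a q s (T.disc (polarPoint p)) =
      T.lift (polarPoint p) (T.modifyFiber h a q s p) := by
  have hb : ∃ p' : I × Circle, T.disc (polarPoint p') = T.disc (polarPoint p) := ⟨p, rfl⟩
  rw [modify, dif_pos hb]
  have h1 := T.disc_injOn (polarPoint_mem _) (polarPoint_mem _) hb.choose_spec
  rw [h1]
  obtain ⟨h2, h3⟩ := polarPoint_eq h1
  rcases h3 with h3 | h3
  · congr 1
    rw [modifyFiber, modifyFiber, ← h2, h3, if_pos ha.zero, if_pos ha.zero]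
    exact ha.center _ _
  · rw [h3]

theorem modifyFiber_mem {s : B → X} (hs : ∀ b, π (s b) = b) (p : I × Circle) :
    π (T.modifyFiber h a q s p) = b₀ := by
  rw [modifyFiber]
  split_ifs
  · exact h.map_mem _
  · refine T.retr_mem _ ?_
    rw [hs]
    exact ⟨_, polarPoint_mem _, rfl⟩

/-- Where `q` equals `1` the two branches of the definition agree: if `a` vanishes as well, the
section is evaluated at `b₀`, and its value there is the top of `h`. -/
theorem modifyFiber_of_eq_one {s : B → X} (hs : ∀ b, π (s b) = b) (hs₀ : s b₀ = h.top)
    {p : I × Circle} (hq : q p.1 = 1) :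
    T.modifyFiber h a q s p = T.retr (s (T.disc (polarPoint (a p.1, p.2)))) := by
  rw [modifyFiber]
  split_ifs with h0
  · rw [hq, h.map_one, h0, polarPoint_zero, T.disc_zero, T.retr_fiber (hs b₀), hs₀]
  · rfl

theorem modify_section {s : B → X} (ha : h.IsProfile a q) (hs : ∀ b, π (s b) = b) (b : B) :
    π (T.modify h a q s b) = b := by
  by_cases hb : b ∈ T.disc '' Metric.closedBall 0 1
  · obtain ⟨w, hw, rfl⟩ := hb
    obtain ⟨p, rfl⟩ := exists_polarPoint hw
    rw [T.modify_disc ha]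
    exact T.lift_mem _ hw _ (T.modifyFiber_mem hs p)
  · rw [T.modify_of_notMem s hb, hs]

theorem modify_center (ha : h.IsProfile a q) (s : B → X) (u : Circle) :
    T.modify h a q s b₀ = h.map (q 0, u) := by
  have := T.modify_disc ha s (0, u)
  rw [polarPoint_zero, T.disc_zero] at this
  rw [this, modifyFiber, if_pos ha.zero, T.lift_zero _ (h.map_mem _)]

theorem retr_modify_disc (ha : h.IsProfile a q) {s : B → X} (hs : ∀ b, π (s b) = b)
    (p : I × Circle) :
    T.retr (T.modify h a q s (T.disc (polarPoint p))) = T.modifyFiber h a q s p := by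
  rw [T.modify_disc ha, T.retr_lift _ (polarPoint_mem p) _ (T.modifyFiber_mem hs p)]

/-- Since `a 1 = 1`, nothing changes on the rim, so the modified part fits continuously with the
unmodified one. -/
theorem modify_of_norm_one (ha : h.IsProfile a q) {s : B → X} (hs : ∀ b, π (s b) = b)
    {p : I × Circle} (hp : p.1 = 1) :
    T.modify h a q s (T.disc (polarPoint p)) = s (T.disc (polarPoint p)) := by
  obtain ⟨r, u⟩ := p
  subst hp
  rw [T.modify_disc ha, modifyFiber, if_neg (by simp [ha.one]), ha.one]
  exact T.lift_retr _ (polarPoint_mem _) _ (hs _)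

theorem modify_id {s : B → X} (hs : ∀ b, π (s b) = b) (hs₀ : s b₀ = h.top) :
    h.IsProfile (fun r => r) (fun _ => 1) ∧ T.modify h (fun r => r) (fun _ => 1) s = s := by
  have ha : h.IsProfile (fun r => r) (fun _ => 1) :=
    ⟨rfl, rfl, fun _ => Or.inr rfl, fun _ _ => by rw [h.map_one, h.map_one]⟩
  refine ⟨ha, funext fun b => ?_⟩
  by_cases hb : b ∈ T.disc '' Metric.closedBall 0 1
  · obtain ⟨w, hw, rfl⟩ := hb
    obtain ⟨p, rfl⟩ := exists_polarPoint hw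
    rw [T.modify_disc ha, T.modifyFiber_of_eq_one hs hs₀ rfl]
    exact T.lift_retr _ hw _ (hs _)
  · rw [T.modify_of_notMem s hb]

/-- The closed sets `a = 0` and `q = 1` cover everything, and on each of them one of the two
branches gives a continuous formula. -/
theorem continuous_modifyFiber {K : Type} [TopologicalSpace K] {a q : K → I → I} {F : K → B → X}
    (ha : Continuous fun p : K × I => a p.1 p.2) (hq : Continuous fun p : K × I => q p.1 p.2)
    (haq : ∀ ξ r, a ξ r = 0 ∨ q ξ r = 1)
    (hF : Continuous fun p : K × B => F p.1 p.2) (hs : ∀ ξ b, π (F ξ b) = b)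
    (hs₀ : ∀ ξ, F ξ b₀ = h.top) :
    Continuous fun p : K × (I × Circle) => T.modifyFiber h (a p.1) (q p.1) (F p.1) p.2 := by
  have ha' : Continuous fun p : K × (I × Circle) => a p.1 p.2.1 :=
    ha.comp (by fun_prop : Continuous fun p : K × (I × Circle) => (p.1, p.2.1))
  have hq' : Continuous fun p : K × (I × Circle) => q p.1 p.2.1 :=
    hq.comp (by fun_prop : Continuous fun p : K × (I × Circle) => (p.1, p.2.1))
  rw [← continuousOn_univ]
  have hcover : (univ : Set (K × (I × Circle))) =
      {p | a p.1 p.2.1 = 0} ∪ {p | q p.1 p.2.1 = 1} := by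
    ext p
    simpa using haq p.1 p.2.1
  rw [hcover]
  refine ContinuousOn.union_of_isClosed ?_ ?_ (isClosed_eq ha' continuous_const)
    (isClosed_eq hq' continuous_const)
  · have : Continuous fun p : K × (I × Circle) => h.map (q p.1 p.2.1, p.2.2) :=
      h.map.continuous.comp (hq'.prodMk (by fun_prop))
    exact this.continuousOn.congr fun p hp => if_pos hp
  · have hd : Continuous fun p : K × (I × Circle) => T.disc (polarPoint (a p.1 p.2.1, p.2.2)) :=
      T.continuous_disc_polarPoint.comp (ha'.prodMk (by fun_prop))
    have hr : Continuous fun p : K × (I × Circle) =>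
        T.retr (F p.1 (T.disc (polarPoint (a p.1 p.2.1, p.2.2)))) := by
      refine T.retr_continuousOn.comp_continuous (hF.comp (continuous_fst.prodMk hd)) fun p => ?_
      rw [mem_preimage, hs]
      exact ⟨_, polarPoint_mem _, rfl⟩
    exact hr.continuousOn.congr fun p hp => T.modifyFiber_of_eq_one (hs p.1) (hs₀ p.1) hp

/-- The space is covered by two closed sets: the points over the closed disc and those off the open
disc. On the first, polar coordinates form a proper map, even after multiplication with `K`, so
continuity can be tested upstairs. -/
theorem continuous_modify [T2Space B] (hT : IsOpen (T.disc '' Metric.ball 0 1))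
    {K : Type} [TopologicalSpace K] {a q : K → I → I} {F : K → B → X}
    (ha : Continuous fun p : K × I => a p.1 p.2) (hq : Continuous fun p : K × I => q p.1 p.2)
    (haq : ∀ ξ, h.IsProfile (a ξ) (q ξ))
    (hF : Continuous fun p : K × B => F p.1 p.2) (hs : ∀ ξ b, π (F ξ b) = b)
    (hs₀ : ∀ ξ, F ξ b₀ = h.top) :
    Continuous fun p : K × B => T.modify h (a p.1) (q p.1) (F p.1) p.2 := by
  have hQ : IsProperMap fun p : K × (I × Circle) => (p.1, T.disc (polarPoint p.2)) :=
    IsProperMap.prodMap (isProperMap_id (X := K)) T.continuous_disc_polarPoint.isProperMap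
  rw [← continuousOn_univ]
  have hcover : (univ : Set (K × B)) =
      range (fun p : K × (I × Circle) => (p.1, T.disc (polarPoint p.2))) ∪
        {p | p.2 ∈ (T.disc '' Metric.ball 0 1)ᶜ} := by
    refine (eq_univ_of_forall fun p => ?_).symm
    by_cases hp : p.2 ∈ T.disc '' Metric.ball 0 1
    · obtain ⟨w, hw, hwp⟩ := hp
      obtain ⟨p', rfl⟩ := exists_polarPoint (Metric.ball_subset_closedBall hw)
      exact Or.inl ⟨(p.1, p'), Prod.ext rfl hwp⟩
    · exact Or.inr hp
  rw [hcover]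
  refine ContinuousOn.union_of_isClosed ?_ ?_ hQ.isClosedMap.isClosed_range
    (hT.isClosed_compl.preimage continuous_snd)
  · have hg : Continuous fun p : K × (I × Circle) =>
        T.modify h (a p.1) (q p.1) (F p.1) (T.disc (polarPoint p.2)) := by
      have h1 := T.continuous_modifyFiber ha hq (fun ξ => (haq ξ).zero_or_one) hF hs hs₀
      have h2 : Continuous fun p : K × (I × Circle) =>
          T.lift (polarPoint p.2) (T.modifyFiber h (a p.1) (q p.1) (F p.1) p.2) :=
        T.lift_continuousOn.comp_continuous
          ((continuous_polarPoint.comp continuous_snd).prodMk h1)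
          fun p => ⟨polarPoint_mem _, T.modifyFiber_mem (hs p.1) _⟩
      exact h2.congr fun p => (T.modify_disc (haq p.1) _ _).symm
    -- The preimage of a closed set is the image of its preimage in polar coordinates under a closed
    -- map.
    rw [continuousOn_iff_isClosed]
    intro C hC
    refine ⟨_, hQ.isClosedMap _ (hC.preimage hg), ?_⟩
    ext p
    constructor
    · rintro ⟨hp, p', rfl⟩
      exact ⟨⟨p', hp, rfl⟩, p', rfl⟩
    · rintro ⟨⟨p', hp, rfl⟩, _⟩
      exact ⟨hp, p', rfl⟩
  · refine hF.continuousOn.congr fun p hp => ?_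
    by_cases hb : p.2 ∈ T.disc '' Metric.closedBall 0 1
    · obtain ⟨w, hw, hwp⟩ := hb
      obtain ⟨p', rfl⟩ := exists_polarPoint hw
      simp only
      rw [← hwp]
      refine T.modify_of_norm_one (haq p.1) (hs p.1) (le_antisymm p'.1.2.2 ?_)
      by_contra hlt
      refine hp ⟨_, ?_, hwp⟩
      rw [mem_ball_zero_iff, norm_polarPoint]
      exact not_le.1 hlt
    · exact T.modify_of_notMem _ hb

/-- The modification of a continuous section as a continuous map. -/
noncomputable def modifyMap [T2Space B] (hT : IsOpen (T.disc '' Metric.ball 0 1))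
    {a q : I → I} (ha : Continuous a) (hq : Continuous q) (haq : h.IsProfile a q)
    (s : C(B, X)) (hs : ∀ b, π (s b) = b) (hs₀ : s b₀ = h.top) : C(B, X) where
  toFun := T.modify h a q s
  continuous_toFun := (T.continuous_modify (K := Unit) hT (a := fun _ => a) (q := fun _ => q)
    (F := fun _ => s) (by fun_prop) (by fun_prop) (fun _ => haq) (by fun_prop) (fun _ => hs)
    (fun _ => hs₀)).comp (by fun_prop : Continuous fun b : B => (Unit.unit, b))

/-- Modifications along profiles which are joined by a path of profiles are homotopic. -/
theorem modify_homotopic [T2Space B] (hT : IsOpen (T.disc '' Metric.ball 0 1))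
    {a q : I → I → I} (ha : Continuous fun p : I × I => a p.1 p.2)
    (hq : Continuous fun p : I × I => q p.1 p.2) (haq : ∀ t, h.IsProfile (a t) (q t))
    {s s₀ s₁ : C(B, X)} (hs : ∀ b, π (s b) = b) (hs₀ : s b₀ = h.top)
    (h₀ : ∀ b, s₀ b = T.modify h (a 0) (q 0) s b) (h₁ : ∀ b, s₁ b = T.modify h (a 1) (q 1) s b) :
    s₀.Homotopic s₁ :=
  ⟨{ toFun := fun p => T.modify h (a p.1) (q p.1) s p.2
     continuous_toFun := T.continuous_modify hT ha hq haq (F := fun _ => s) (by fun_prop)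
      (fun _ => hs) (fun _ => hs₀)
     map_zero_left := fun b => (h₀ b).symm
     map_one_left := fun b => (h₁ b).symm }⟩

end DiscTrivialization

end Modify

/-! ### The compactly generated topology on spaces of sections, and jets in families. -/

section SectStopTopology

variable {B X : Type} [TopologicalSpace B] [ChartedSpace ℂ B] [TopologicalSpace X] {n : ℕ}
  [ChartedSpace (EuclideanSpace ℂ (Fin (n + 1))) X] {π : X → B}

theorem IsContinuousFamily.continuous {α : H₂ X} {S : Set (AdmissibleJet n π)} {K : Type}
    [TopologicalSpace K] [CompactSpace K] [T2Space K] {F : K → SectStop π α S}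
    (hF : IsContinuousFamily F) : Continuous F := by
  rw [continuous_iff_coinduced_le]
  exact le_iSup_of_le (CompHaus.of K) (le_iSup_of_le F (le_iSup_of_le hF le_rfl))

theorem SectStop.continuous_of_family {α : H₂ X} {S : Set (AdmissibleJet n π)} {Y : Type*}
    [TopologicalSpace Y] {g : SectStop π α S → Y}
    (hg : ∀ (K : CompHaus.{0}) (F : K → SectStop π α S), IsContinuousFamily F →
      Continuous (g ∘ F)) : Continuous g := by
  refine continuous_iSup_dom.2 fun K => continuous_iSup_dom.2 fun F => continuous_iSup_dom.2 fun hF =>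
    continuous_coinduced_dom.2 (hg K F hF)

/-- Continuity on the product `I × SectStop` cannot be tested on families directly, since the
product need not carry the final topology. The homotopy is curried to a map into `C(I, SectStop)`,
for which families suffice, and evaluated back, which is continuous because `I` is locally compact.
-/
theorem SectStop.homotopic_of_family {α α' : H₂ X} {S S' : Set (AdmissibleJet n π)}
    (H : I → SectStop π α S → SectStop π α' S')
    (hH : ∀ (K : CompHaus.{0}) (F : K → SectStop π α S), IsContinuousFamily F →
      IsContinuousFamily fun p : I × K => H p.1 (F p.2))
    {g₀ g₁ : C(SectStop π α S, SectStop π α' S')} (h₀ : ∀ s, H 0 s = g₀ s)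
    (h₁ : ∀ s, H 1 s = g₁ s) : g₀.Homotopic g₁ := by
  have hpt : ∀ s, Continuous fun t => H t s := by
    intro s
    -- A single section is a family over a point.
    have hc : IsContinuousFamily fun _ : CompHaus.of PUnit.{1} => s :=
      ⟨s.1.continuous.comp continuous_snd, fun j hj => ⟨fun _ => (s.2.2.2 j hj).1 (), fun ε hε =>
        ((s.2.2.2 j hj).2 ε hε).mono fun b hb _ => hb ()⟩⟩
    exact (hH (CompHaus.of PUnit.{1}) (fun _ => s) hc).continuous.comp
      (by fun_prop : Continuous fun t : I => (t, PUnit.unit))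
  have hcurry : Continuous fun s => (⟨fun t => H t s, hpt s⟩ : C(I, SectStop π α' S')) := by
    refine SectStop.continuous_of_family fun K F hF => ?_
    refine ContinuousMap.continuous_of_continuous_uncurry _ ?_
    exact (hH K F hF).continuous.comp
      (by fun_prop : Continuous fun p : K × I => (p.2, p.1))
  have hjoint : Continuous fun p : I × SectStop π α S => H p.1 p.2 := by
    have h1 : Continuous fun p : I × SectStop π α S =>
        (⟨fun t => H t p.2, hpt p.2⟩ : C(I, SectStop π α' S')) := hcurry.comp continuous_snd
    exact h1.eval continuous_fst
  exact ⟨{ toFun := fun p => H p.1 p.2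
           continuous_toFun := hjoint
           map_zero_left := h₀
           map_one_left := h₁ }⟩

theorem Induces.congr {j : AdmissibleJet n π} {K : Type} {F G : K → B → X} (hF : Induces F j)
    (h : ∀ᶠ b in 𝓝 j.base, ∀ ξ, G ξ b = F ξ b) : Induces G j :=
  ⟨fun ξ => (h.self_of_nhds ξ).trans (hF.1 ξ), fun ε hε => by
    filter_upwards [h, hF.2 ε hε] with b hb hb' ξ
    rw [hb ξ]
    exact hb' ξ⟩

theorem AdmissibleJet.poly_of_order_zero (j : AdmissibleJet n π) (hj : j.order = 0) (z : ℂ) :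
    j.poly z = chartAt (EuclideanSpace ℂ (Fin (n + 1))) j.support j.support := by
  obtain ⟨s, -, hs, hc⟩ := j.exists_section
  rw [AdmissibleJet.poly]
  simp only [← hc]
  -- The sum over `Fin (j.order + 1)` becomes a sum over a range so that the order can be replaced
  -- by zero without a dependent-type obstruction.
  rw [Fin.sum_univ_eq_sum_range (fun k => z ^ k • taylorCoeff n s j.base k) (j.order + 1), hj]
  simp [taylorCoeff, hs]

/-- A continuous family through the support of a jet of order zero induces it. -/
theorem induces_of_order_zero {j : AdmissibleJet n π} (hj : j.order = 0) {K : Type}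
    [TopologicalSpace K] [CompactSpace K] {F : K → B → X}
    (hF : Continuous fun p : K × B => F p.1 p.2) (hs : ∀ ξ, F ξ j.base = j.support) :
    Induces F j := by
  refine ⟨hs, fun ε hε => ?_⟩
  -- Uniformity in `ξ` comes from the compactness of `K`: joint continuity gives the estimate near
  -- each `(j.base, ξ)`.
  have key : ∀ ξ ∈ (univ : Set K), ∀ᶠ p : B × K in 𝓝 (j.base, ξ),
      ‖chartAt (EuclideanSpace ℂ (Fin (n + 1))) j.support (F p.2 p.1) -
        chartAt (EuclideanSpace ℂ (Fin (n + 1))) j.support j.support‖ < ε := by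
    intro ξ _
    have h1 : ContinuousAt (chartAt (EuclideanSpace ℂ (Fin (n + 1))) j.support) (F ξ j.base) := by
      rw [hs]
      exact (chartAt _ j.support).continuousAt (mem_chart_source _ _)
    have h2 : ContinuousAt (fun p : B × K => F p.2 p.1) (j.base, ξ) :=
      (hF.comp continuous_swap).continuousAt
    have h3 := ContinuousAt.comp (f := fun p : B × K => F p.2 p.1) (x := (j.base, ξ)) h1 h2
    have h4 := (Metric.continuousAt_iff'.1 h3) ε hε
    simpa [dist_eq_norm, hs] using h4
  have := isCompact_univ.eventually_forall_of_forall_eventually (K := (univ : Set K))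
    (P := fun b ξ => ‖chartAt (EuclideanSpace ℂ (Fin (n + 1))) j.support (F ξ b) -
        chartAt (EuclideanSpace ℂ (Fin (n + 1))) j.support j.support‖ < ε) key
  filter_upwards [this] with b hb ξ
  rw [j.poly_of_order_zero hj, hj, pow_zero, mul_one]
  exact (hb ξ (mem_univ ξ)).le

/-- A jet of `S₀` lies off the closed disc, hence has a neighbourhood where nothing changes. The jet
over `b₀` has order zero, so only the value at the centre matters. -/
theorem induces_modify [T2Space B] {b₀ : B} {T : DiscTrivialization π b₀}
    (hT : IsOpen (T.disc '' Metric.ball 0 1)) {h : FiberSphere π b₀}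
    {K : Type} [TopologicalSpace K] [CompactSpace K] {a q : K → I → I} {F : K → B → X}
    (ha : Continuous fun p : K × I => a p.1 p.2) (hq : Continuous fun p : K × I => q p.1 p.2)
    (haq : ∀ ξ, h.IsProfile (a ξ) (q ξ))
    (hF : Continuous fun p : K × B => F p.1 p.2) (hs : ∀ ξ b, π (F ξ b) = b)
    (hs₀ : ∀ ξ, F ξ b₀ = h.top) {S₀ : Set (AdmissibleJet n π)}
    (hS₀ : ∀ j ∈ S₀, j.base ∉ T.disc '' Metric.closedBall 0 1) (hFS : ∀ j ∈ S₀, Induces F j)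
    {j' : AdmissibleJet n π} (hj' : j'.base = b₀) (hj'₀ : j'.order = 0)
    (hj's : ∀ ξ, h.map (q ξ 0, 1) = j'.support) :
    ∀ j ∈ insert j' S₀, Induces (fun ξ => T.modify h (a ξ) (q ξ) (F ξ)) j := by
  rintro j (rfl | hj)
  · refine induces_of_order_zero hj'₀ (T.continuous_modify hT ha hq haq hF hs hs₀) fun ξ => ?_
    rw [hj', T.modify_center (haq ξ) _ 1, hj's]
  · refine (hFS j hj).congr ?_
    have hcl : IsClosed (T.disc '' Metric.closedBall 0 1) :=
      ((isCompact_closedBall _ _).image_of_continuousOn T.disc_continuousOn).isClosed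
    filter_upwards [hcl.isOpen_compl.mem_nhds (hS₀ j hj)] with b hb ξ
    exact T.modify_of_notMem _ hb

theorem HasClass.of_homotopic {g g' : C(B, X)} {α : H₂ X} (h : HasClass g α)
    (hg : g.Homotopic g') : HasClass g' α := by
  obtain ⟨μ, hμ, hα⟩ := h
  exact ⟨μ, hμ, by rw [← H₂Map_eq_of_homotopic hg, hα]⟩

end SectStopTopology

/-! ### Gluing a sphere is a homotopy equivalence. -/

section GluingEquivalence

/-- The radial scaling `r ↦ max 0 (2 r - 1)`. -/
noncomputable def glueScale (r : I) : I :=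
  ⟨max 0 (2 * (r : ℝ) - 1), le_max_left _ _, max_le zero_le_one (by linarith [r.2.2])⟩

theorem continuous_glueScale : Continuous glueScale := by
  unfold glueScale
  fun_prop

theorem glueScale_eq_zero {r : I} (hr : (r : ℝ) ≤ 1 / 2) : glueScale r = 0 :=
  Subtype.ext (max_eq_left (by linarith))

theorem coe_glueScale {r : I} (hr : 1 / 2 ≤ (r : ℝ)) : (glueScale r : ℝ) = 2 * r - 1 :=
  max_eq_right (by linarith)

theorem half_lt_of_glueScale_ne_zero {r : I} (hr : glueScale r ≠ 0) : 1 / 2 < (r : ℝ) := by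
  by_contra h
  exact hr (glueScale_eq_zero (not_lt.1 h))

theorem glueScale_zero : glueScale 0 = 0 := glueScale_eq_zero (by norm_num)

theorem glueScale_one : glueScale 1 = 1 := by
  refine Subtype.ext ?_
  rw [coe_glueScale (by norm_num)]
  norm_num

/-- Convex combinations in the unit interval. -/
noncomputable def mixI (c x y : I) : I :=
  ⟨(1 - c) * x + c * y, by
    have := c.2; have := x.2; have := y.2
    exact add_nonneg (mul_nonneg (by linarith [c.2.2]) x.2.1) (mul_nonneg c.2.1 y.2.1), by
    nlinarith [c.2.1, c.2.2, x.2.1, x.2.2, y.2.1, y.2.2]⟩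

theorem continuous_mixI {K : Type*} [TopologicalSpace K] {c x y : K → I} (hc : Continuous c)
    (hx : Continuous x) (hy : Continuous y) : Continuous fun k => mixI (c k) (x k) (y k) := by
  unfold mixI
  fun_prop

theorem mixI_zero (x y : I) : mixI 0 x y = x := by simp [mixI]

theorem mixI_one (x y : I) : mixI 1 x y = y := by simp [mixI]

theorem mixI_self (c x : I) : mixI c x x = x := Subtype.ext (by simp [mixI]; ring)

/-- Profiles of the gluing of a sphere: continuous functions which increase from `0` to `1` on
`[0, 1/2]`. -/
structure IsGlueProfile (q : I → I) : Prop where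
  continuous : Continuous q
  zero : q 0 = 0
  one : ∀ r : I, 1 / 2 ≤ (r : ℝ) → q r = 1

variable {B X : Type} [TopologicalSpace X] {π : X → B} {b₀ : B}

theorem IsGlueProfile.isProfile {q : I → I} (hq : IsGlueProfile q) (h : FiberSphere π b₀) :
    h.IsProfile glueScale q where
  zero := glueScale_zero
  one := glueScale_one
  zero_or_one r := by
    rcases le_total (r : ℝ) (1 / 2) with hr | hr
    · exact Or.inl (glueScale_eq_zero hr)
    · exact Or.inr (hq.one r hr)
  center u u' := by rw [hq.zero, h.map_zero, h.map_zero]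

/-- The path of scalings from the twofold gluing to the identity. -/
noncomputable def unglueScale (t r : I) : I := mixI (glueScale t) (glueScale (glueScale r)) r

/-- The path of profiles from the twofold gluing to the identity. -/
noncomputable def unglueProfile (q : I → I) (t r : I) : I :=
  max (max (σ (q r)) (q (glueScale r))) (σ (glueScale (σ t)))

theorem continuous_unglueScale : Continuous fun p : I × I => unglueScale p.1 p.2 :=
  continuous_mixI (continuous_glueScale.comp continuous_fst)
    ((continuous_glueScale.comp continuous_glueScale).comp continuous_snd) continuous_snd

theorem continuous_unglueProfile {q : I → I} (hq : Continuous q) :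
    Continuous fun p : I × I => unglueProfile q p.1 p.2 := by
  have := continuous_glueScale
  unfold unglueProfile
  fun_prop

theorem unglueProfile_zero {q : I → I} (hq : IsGlueProfile q) (t : I) :
    unglueProfile q t 0 = 1 := by
  rw [unglueProfile, hq.zero, symm_zero]
  exact le_antisymm le_one' (le_max_of_le_left (le_max_left _ _))

/-- The path has two halves. For `t ≤ 1/2` the scaling stays that of the twofold gluing and the
lower bound `min 1 (2t)` on the profile rises to `1`, which shortens the excursion along the sphere
until it is constant. Afterwards the profile is identically `1`, and the scaling moves linearly to
the identity. At the centre the profile is always `1`, so the value over `b₀` never moves. -/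
theorem IsGlueProfile.isProfile_unglue {q : I → I} (hq : IsGlueProfile q) (h : FiberSphere π b₀)
    (t : I) : h.IsProfile (unglueScale t) (unglueProfile q t) where
  zero := by rw [unglueScale, glueScale_zero, glueScale_zero, mixI_self]
  one := by rw [unglueScale, glueScale_one, glueScale_one, mixI_self]
  zero_or_one r := by
    by_cases ht : glueScale t = 0
    · rw [unglueScale, ht, mixI_zero, or_iff_not_imp_left]
      intro h0
      rw [unglueProfile, hq.one _ (half_lt_of_glueScale_ne_zero h0).le]
      exact le_antisymm le_one' (le_max_of_le_left (le_max_right _ _))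
    · right
      have h1 : glueScale (σ t) = 0 := by
        refine glueScale_eq_zero ?_
        rw [coe_symm_eq]
        linarith [half_lt_of_glueScale_ne_zero ht]
      rw [unglueProfile, h1, symm_zero]
      exact le_antisymm le_one' (le_max_right _ _)
  center u u' := by rw [unglueProfile_zero hq, h.map_one, h.map_one]

variable [TopologicalSpace B] [ChartedSpace ℂ B] (T : DiscTrivialization π b₀)
  {h : FiberSphere π b₀}

/-- Gluing a sphere and then its reverse is a modification along a path of profiles which leads
to the identity. -/
theorem DiscTrivialization.modify_reverse_modify {q : I → I} (hq : IsGlueProfile q) {s : B → X}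
    (hs : ∀ b, π (s b) = b) :
    T.modify h.reverse glueScale q (T.modify h glueScale q s) =
      T.modify h (unglueScale 0) (unglueProfile q 0) s := by
  have hs' := T.modify_section (hq.isProfile h) hs
  funext b
  by_cases hb : b ∈ T.disc '' Metric.closedBall 0 1
  · obtain ⟨w, hw, rfl⟩ := hb
    obtain ⟨⟨r, u⟩, rfl⟩ := exists_polarPoint hw
    rw [T.modify_disc (hq.isProfile h.reverse), T.modify_disc (hq.isProfile_unglue h 0)]
    congr 1
    have h2 : unglueScale 0 r = glueScale (glueScale r) := by
      rw [unglueScale, glueScale_zero, mixI_zero]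
    have h3 : unglueProfile q 0 r = max (σ (q r)) (q (glueScale r)) := by
      rw [unglueProfile, symm_zero, glueScale_one, symm_one]
      exact max_eq_left nonneg'
    rw [modifyFiber, modifyFiber, T.retr_modify_disc (hq.isProfile h) hs, modifyFiber]
    simp only [h2, h3]
    -- Where the scaling vanishes the outer gluing shows the reversed sphere. Elsewhere `r` exceeds
    -- `1/2`, and it shows the first modification at radius `glueScale r`.
    by_cases h0 : glueScale r = 0
    · rw [if_pos h0, if_pos (by rw [h0, glueScale_zero]), FiberSphere.reverse_map, h0, hq.zero,
        max_eq_left nonneg']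
    · rw [if_neg h0, hq.one r (half_lt_of_glueScale_ne_zero h0).le, symm_one,
        max_eq_right nonneg']
  · rw [T.modify_of_notMem _ hb, T.modify_of_notMem _ hb, T.modify_of_notMem _ hb]

theorem DiscTrivialization.modify_unglue_one {q : I → I} {s : B → X}
    (hs : ∀ b, π (s b) = b) (hs₀ : s b₀ = h.top) :
    T.modify h (unglueScale 1) (unglueProfile q 1) s = s := by
  have h1 : unglueScale 1 = fun r => r := by
    funext r
    rw [unglueScale, glueScale_one, mixI_one]
  have h2 : unglueProfile q 1 = fun _ => 1 := by
    funext r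
    rw [unglueProfile, symm_one, glueScale_zero, symm_zero]
    exact le_antisymm le_one' (le_max_right _ _)
  rw [h1, h2]
  exact (T.modify_id hs hs₀).2

variable {T}

/-- Gluing a sphere and then its reverse gives a homotopic section. -/
theorem DiscTrivialization.homotopic_of_modify_reverse_modify [T2Space B]
    (hT : IsOpen (T.disc '' Metric.ball 0 1)) {q : I → I} (hq : IsGlueProfile q)
    {s s' s'' : C(B, X)} (hs : ∀ b, π (s b) = b) (hs₀ : s b₀ = h.top)
    (hs' : ⇑s' = T.modify h glueScale q s) (hs'' : ⇑s'' = T.modify h.reverse glueScale q s') :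
    s''.Homotopic s := by
  refine T.modify_homotopic hT continuous_unglueScale (continuous_unglueProfile hq.continuous)
    (hq.isProfile_unglue h) hs hs₀ (fun b => ?_) fun b => ?_
  · rw [hs'', hs', T.modify_reverse_modify hq hs]
  · rw [T.modify_unglue_one hs hs₀]

variable {n : ℕ} [ChartedSpace (EuclideanSpace ℂ (Fin (n + 1))) X]

/-- Gluing a sphere, as a map between spaces of sections with prescribed jets. -/
noncomputable def glueSect [T2Space B] (hT : IsOpen (T.disc '' Metric.ball 0 1)) {q : I → I}
    (hq : IsGlueProfile q) {S₀ : Set (AdmissibleJet n π)}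
    (hS₀ : ∀ j ∈ S₀, j.base ∉ T.disc '' Metric.closedBall 0 1) {j j' : AdmissibleJet n π}
    (hj : j.base = b₀) (hjs : j.support = h.top) (hj' : j'.base = b₀) (hj'₀ : j'.order = 0)
    (hj's : j'.support = h.bot) {α α' : H₂ X}
    (hα : ∀ s s' : C(B, X), (∀ b, π (s b) = b) → s b₀ = h.top →
      ⇑s' = T.modify h glueScale q s → HasClass s α → HasClass s' α') :
    C(SectStop π α (insert j S₀), SectStop π α' (insert j' S₀)) :=
  have hs₀ : ∀ s : SectStop π α (insert j S₀), s.1 b₀ = h.top := fun s =>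
    (congrArg s.1 hj.symm).trans (((s.2.2.2 j (mem_insert _ _)).1 ()).trans hjs)
  { toFun := fun s =>
      ⟨T.modifyMap hT continuous_glueScale hq.continuous (hq.isProfile h) s.1 s.2.1 (hs₀ s),
        T.modify_section (hq.isProfile h) s.2.1, hα s.1 _ s.2.1 (hs₀ s) rfl s.2.2.1,
        induces_modify (K := Unit) (a := fun _ => glueScale) (q := fun _ => q) (F := fun _ => s.1)
          hT (continuous_glueScale.comp continuous_snd) (hq.continuous.comp continuous_snd)
          (fun _ => hq.isProfile h) (s.1.continuous.comp continuous_snd) (fun _ => s.2.1)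
          (fun _ => hs₀ s) hS₀ (fun j hj => s.2.2.2 j (mem_insert_of_mem _ hj)) hj' hj'₀
          (fun _ => by rw [hq.zero, h.map_zero, hj's])⟩
    continuous_toFun := by
      refine SectStop.continuous_of_family fun K F hF => IsContinuousFamily.continuous ⟨?_, ?_⟩
      · exact T.continuous_modify (a := fun _ => glueScale) (q := fun _ => q)
          (F := fun ξ => (F ξ).1) hT (continuous_glueScale.comp continuous_snd)
          (hq.continuous.comp continuous_snd) (fun _ => hq.isProfile h) hF.1
          (fun ξ => (F ξ).2.1) (fun ξ => hs₀ (F ξ))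
      · exact induces_modify (a := fun _ => glueScale) (q := fun _ => q) (F := fun ξ => (F ξ).1) hT
          (continuous_glueScale.comp continuous_snd)
          (hq.continuous.comp continuous_snd) (fun _ => hq.isProfile h) hF.1
          (fun ξ => (F ξ).2.1) (fun ξ => hs₀ (F ξ)) hS₀
          (fun j hj => hF.2 j (mem_insert_of_mem _ hj)) hj' hj'₀
          (fun _ => by rw [hq.zero, h.map_zero, hj's]) }

/-- The path of profiles from the twofold gluing to the identity acts on all sections at once. Each
intermediate section must be seen to have the same jets and the same class. -/
theorem glueSect_homotopic_id [T2Space B] (hT : IsOpen (T.disc '' Metric.ball 0 1)) {q : I → I}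
    (hq : IsGlueProfile q) {S₀ : Set (AdmissibleJet n π)}
    (hS₀ : ∀ j ∈ S₀, j.base ∉ T.disc '' Metric.closedBall 0 1) {j : AdmissibleJet n π}
    (hj : j.base = b₀) (hj₀ : j.order = 0) (hjs : j.support = h.top) {α : H₂ X}
    (g : C(SectStop π α (insert j S₀), SectStop π α (insert j S₀)))
    (hg : ∀ s, ⇑(g s).1 = T.modify h.reverse glueScale q (T.modify h glueScale q s.1)) :
    g.Homotopic (ContinuousMap.id _) := by
  have hs₀ : ∀ s : SectStop π α (insert j S₀), s.1 b₀ = h.top := fun s =>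
    (congrArg s.1 hj.symm).trans (((s.2.2.2 j (mem_insert _ _)).1 ()).trans hjs)
  have hsupp : ∀ t, h.map (unglueProfile q t 0, 1) = j.support := fun t => by
    rw [unglueProfile_zero hq, h.map_one, hjs]
  have hqt : ∀ t, Continuous (unglueProfile q t) := fun t =>
    (continuous_unglueProfile hq.continuous).comp (by fun_prop : Continuous fun r : I => (t, r))
  have hat : ∀ t, Continuous (unglueScale t) := fun t =>
    continuous_unglueScale.comp (by fun_prop : Continuous fun r : I => (t, r))
  have hcl : ∀ (t : I) (s : SectStop π α (insert j S₀)),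
      HasClass (T.modifyMap hT (hat t) (hqt t) (hq.isProfile_unglue h t) s.1 s.2.1 (hs₀ s)) α := by
    intro t s
    refine s.2.2.1.of_homotopic (ContinuousMap.Homotopic.symm ?_)
    -- The rest of the path, from time `t` to time `1`, joins the intermediate section to `s`; hence
    -- its class is that of `s`.
    let c : I → I := fun x => mixI x t 1
    have hc : Continuous c := continuous_mixI continuous_id continuous_const continuous_const
    refine T.modify_homotopic hT (a := fun x => unglueScale (c x))
      (q := fun x => unglueProfile q (c x))
      (continuous_unglueScale.comp (by fun_prop : Continuous fun p : I × I => (c p.1, p.2)))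
      ((continuous_unglueProfile hq.continuous).comp
        (by fun_prop : Continuous fun p : I × I => (c p.1, p.2)))
      (fun x => hq.isProfile_unglue h (c x)) s.2.1 (hs₀ s) (fun b => ?_) fun b => ?_
    · simp only [c, mixI_zero]; rfl
    · simp only [c, mixI_one]
      rw [T.modify_unglue_one s.2.1 (hs₀ s)]
  let H : I → SectStop π α (insert j S₀) → SectStop π α (insert j S₀) := fun t s =>
    ⟨T.modifyMap hT (hat t) (hqt t) (hq.isProfile_unglue h t) s.1 s.2.1 (hs₀ s),
      T.modify_section (hq.isProfile_unglue h t) s.2.1, hcl t s,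
      induces_modify (K := Unit) (a := fun _ => unglueScale t) (q := fun _ => unglueProfile q t)
        (F := fun _ => s.1) hT ((hat t).comp continuous_snd) ((hqt t).comp continuous_snd)
        (fun _ => hq.isProfile_unglue h t) (s.1.continuous.comp continuous_snd) (fun _ => s.2.1)
        (fun _ => hs₀ s) hS₀ (fun j hj => s.2.2.2 j (mem_insert_of_mem _ hj)) hj hj₀
        (fun _ => hsupp t)⟩
  refine SectStop.homotopic_of_family H (fun K F hF => ?_) (fun s => ?_) fun s => ?_
  · have ha : Continuous fun p : (I × K) × I => unglueScale p.1.1 p.2 :=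
      continuous_unglueScale.comp
        (by fun_prop : Continuous fun p : (I × K) × I => (p.1.1, p.2))
    have hq' : Continuous fun p : (I × K) × I => unglueProfile q p.1.1 p.2 :=
      (continuous_unglueProfile hq.continuous).comp
        (by fun_prop : Continuous fun p : (I × K) × I => (p.1.1, p.2))
    have hF' : Continuous fun p : (I × K) × B => (F p.1.2).1 p.2 :=
      hF.1.comp (by fun_prop : Continuous fun p : (I × K) × B => (p.1.2, p.2))
    refine ⟨?_, ?_⟩
    · exact T.continuous_modify (K := I × K) (a := fun ξ => unglueScale ξ.1)
        (q := fun ξ => unglueProfile q ξ.1) (F := fun ξ => (F ξ.2).1) hT ha hq'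
        (fun ξ => hq.isProfile_unglue h ξ.1) hF' (fun ξ => (F ξ.2).2.1) (fun ξ => hs₀ (F ξ.2))
    · refine induces_modify (K := I × K) (a := fun ξ => unglueScale ξ.1)
        (q := fun ξ => unglueProfile q ξ.1) (F := fun ξ => (F ξ.2).1) hT ha hq'
        (fun ξ => hq.isProfile_unglue h ξ.1) hF' (fun ξ => (F ξ.2).2.1) (fun ξ => hs₀ (F ξ.2)) hS₀
        (fun j hj => ?_) hj hj₀ (fun ξ => hsupp ξ.1)
      have := hF.2 j (mem_insert_of_mem _ hj)
      exact ⟨fun ξ => this.1 ξ.2, fun ε hε => (this.2 ε hε).mono fun b hb ξ => hb ξ.2⟩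
  · refine Subtype.ext (DFunLike.coe_injective ?_)
    rw [hg, T.modify_reverse_modify hq s.2.1]
    rfl
  · refine Subtype.ext (DFunLike.coe_injective ?_)
    exact T.modify_unglue_one s.2.1 (hs₀ s)

/-- If gluing a sphere adds `γ` to the classes of sections, then it is a homotopy equivalence, with
inverse the gluing of the reversed sphere. -/
theorem exists_glue_equiv [T2Space B] (hT : IsOpen (T.disc '' Metric.ball 0 1)) {q : I → I}
    (hq : IsGlueProfile q) {S₀ : Set (AdmissibleJet n π)}
    (hS₀ : ∀ j ∈ S₀, j.base ∉ T.disc '' Metric.closedBall 0 1) {j j' : AdmissibleJet n π}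
    (hj : j.base = b₀) (hj₀ : j.order = 0) (hjs : j.support = h.top) (hj' : j'.base = b₀)
    (hj'₀ : j'.order = 0) (hj's : j'.support = h.bot) {α α' γ : H₂ X} (hα' : α' = α + γ)
    (hγ : ∀ s s' : C(B, X), (∀ b, π (s b) = b) → s b₀ = h.top →
      ⇑s' = T.modify h glueScale q s → ∀ μ, IsFundamentalClass μ →
        H₂Map s' μ = H₂Map s μ + γ) :
    ∃ Φ : SectStop π α (insert j S₀) ≃ₕ SectStop π α' (insert j' S₀),
      (∀ s, ⇑(Φ.toFun s).1 = T.modify h glueScale q s.1) ∧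
      (∀ s, ⇑(Φ.invFun s).1 = T.modify h.reverse glueScale q s.1) := by
  let g : C(SectStop π α (insert j S₀), SectStop π α' (insert j' S₀)) :=
    glueSect (h := h) hT hq hS₀ hj hjs hj' hj'₀ hj's (by
      rintro s s' hs hs₀ hss ⟨μ, hμ, rfl⟩
      exact ⟨μ, hμ, by rw [hγ s s' hs hs₀ hss μ hμ, hα']⟩)
  let g' : C(SectStop π α' (insert j' S₀), SectStop π α (insert j S₀)) :=
    glueSect (h := h.reverse) hT hq hS₀ hj' hj's hj hj₀ hjs (by
      rintro s s' hs hs₀ hss ⟨μ, hμ, hsμ⟩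
      refine ⟨μ, hμ, ?_⟩
      have hs' : ∀ b, π (s' b) = b := by
        rw [hss]; exact T.modify_section (hq.isProfile _) hs
      have hs'₀ : s' b₀ = h.top := by
        rw [hss, T.modify_center (hq.isProfile _) _ 1, hq.zero]
        exact h.reverse.map_zero 1
      -- The effect of the reversed sphere on classes needs no computation: gluing `h` back adds `γ`
      -- and returns a section homotopic to `s`.
      let s'' := T.modifyMap hT continuous_glueScale hq.continuous (hq.isProfile h) s' hs' hs'₀
      have h1 := hγ s' s'' hs' hs'₀ rfl μ hμ
      have h2 : s''.Homotopic s := DiscTrivialization.homotopic_of_modify_reverse_modify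
        (h := h.reverse) hT hq hs hs₀ hss (by rw [h.reverse_reverse]; rfl)
      rw [H₂Map_eq_of_homotopic h2, hsμ, hα'] at h1
      exact (add_right_cancel h1).symm)
  refine ⟨⟨g, g', ?_, ?_⟩, fun s => rfl, fun s => rfl⟩
  · exact glueSect_homotopic_id (h := h) hT hq hS₀ hj hj₀ hjs _ fun s => rfl
  · exact glueSect_homotopic_id (h := h.reverse) hT hq hS₀ hj' hj'₀ hj's _ fun s => by
      rw [h.reverse_reverse]; rfl

end GluingEquivalence

/-! ### Polar coordinates and radial self-maps of the projective line. -/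

section SphereCoordinates

/-- A function of polar coordinates which does not depend on the angle at the origin is continuous
on the disc. -/
theorem continuous_of_polar {K X : Type} [TopologicalSpace K] [TopologicalSpace X]
    {G : K → Metric.closedBall (0 : ℂ) 1 → X}
    (hG : Continuous fun p : K × (I × Circle) => G p.1 ⟨polarPoint p.2, polarPoint_mem p.2⟩) :
    Continuous fun p : K × Metric.closedBall (0 : ℂ) 1 => G p.1 p.2 := by
  have h1 : Continuous fun p : I × Circle =>
      (⟨polarPoint p, polarPoint_mem p⟩ : Metric.closedBall (0 : ℂ) 1) :=
    continuous_polarPoint.subtype_mk _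
  have hQ := IsProperMap.prodMap (isProperMap_id (X := K)) h1.isProperMap
  have hs : Function.Surjective (Prod.map (id : K → K) fun p : I × Circle =>
      (⟨polarPoint p, polarPoint_mem p⟩ : Metric.closedBall (0 : ℂ) 1)) := by
    rintro ⟨k, w, hw⟩
    obtain ⟨p, rfl⟩ := exists_polarPoint hw
    exact ⟨(k, p), rfl⟩
  exact (hQ.isClosedMap.isQuotientMap hQ.continuous hs).continuous_iff.2 hG

/-- The point `[s u : 1 - s]` of the projective line. -/
noncomputable def sphereParamFun (p : I × Circle) : OnePoint ℂ :=
  open Classical in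
  if p.1 = 1 then OnePoint.infty
  else (((((p.1 : ℝ) / (1 - (p.1 : ℝ)) : ℝ) : ℂ) * (p.2 : ℂ) : ℂ) : OnePoint ℂ)

/-- In the chart at infinity the formula needs no case distinction at `s = 1`, which makes
continuity there visible. -/
theorem sphereParamFun_eq_inv {p : I × Circle} (hp : p.1 ≠ 0) :
    sphereParamFun p =
      sphereInv (((((1 - (p.1 : ℝ)) / (p.1 : ℝ) : ℝ) : ℂ) * ((p.2 : ℂ)⁻¹) : ℂ) : OnePoint ℂ) := by
  by_cases h1 : p.1 = 1
  · rw [sphereParamFun, if_pos h1, h1]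
    simp [sphereInv_zero]
  · have hp' : ((p.1 : ℝ) : ℂ) ≠ 0 := by
      rw [Complex.ofReal_ne_zero]; exact fun h => hp (Subtype.ext h)
    have h1' : (1 - (p.1 : ℝ) : ℂ) ≠ 0 := by
      intro h
      refine h1 (Subtype.ext ?_)
      have : ((p.1 : ℝ) : ℂ) = ((1 : ℝ) : ℂ) := by
        rw [Complex.ofReal_one]; exact (sub_eq_zero.1 h).symm
      exact Complex.ofReal_injective this
    rw [sphereParamFun, if_neg h1, sphereInv_coe]
    · congr 1
      push_cast
      have := Circle.coe_ne_zero p.2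
      field_simp
    · push_cast
      exact mul_ne_zero (div_ne_zero h1' hp') (inv_ne_zero (Circle.coe_ne_zero p.2))

theorem continuous_sphereParamFun : Continuous sphereParamFun := by
  rw [continuous_iff_continuousAt]
  intro p
  by_cases hp : p.1 = 1
  · have hp0 : p.1 ≠ 0 := by rw [hp]; exact one_ne_zero
    have h0 : (p.1 : ℝ) ≠ 0 := fun h => hp0 (Subtype.ext h)
    have hc : ContinuousAt (fun p : I × Circle => sphereInv
        (((((1 - (p.1 : ℝ)) / (p.1 : ℝ) : ℝ) : ℂ) * ((p.2 : ℂ)⁻¹) : ℂ) : OnePoint ℂ)) p := by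
      refine (continuous_sphereInv.comp OnePoint.continuous_coe).continuousAt.comp ?_
      refine ContinuousAt.mul (Complex.continuous_ofReal.continuousAt.comp ?_) ?_
      · exact ContinuousAt.div (by fun_prop) (by fun_prop) h0
      · exact ContinuousAt.inv₀ (by fun_prop) (Circle.coe_ne_zero _)
    refine hc.congr ?_
    have : ∀ᶠ p' : I × Circle in 𝓝 p, p'.1 ≠ 0 :=
      continuous_fst.continuousAt.eventually_ne hp0
    filter_upwards [this] with p' hp'
    exact (sphereParamFun_eq_inv hp').symm
  · have h0 : (1 - p.1 : ℝ) ≠ 0 := fun h => hp (Subtype.ext (sub_eq_zero.1 h).symm)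
    have hc : ContinuousAt (fun p : I × Circle =>
        (((((p.1 : ℝ) / (1 - (p.1 : ℝ)) : ℝ) : ℂ) * (p.2 : ℂ) : ℂ) : OnePoint ℂ)) p := by
      refine OnePoint.continuous_coe.continuousAt.comp ?_
      refine ContinuousAt.mul (Complex.continuous_ofReal.continuousAt.comp ?_) (by fun_prop)
      exact ContinuousAt.div (by fun_prop) (by fun_prop) h0
    refine hc.congr ?_
    have : ∀ᶠ p' : I × Circle in 𝓝 p, p'.1 ≠ 1 :=
      continuous_fst.continuousAt.eventually_ne hp
    filter_upwards [this] with p' hp'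
    exact (if_neg hp').symm

/-- Polar coordinates on the projective line: `(s, u) ↦ [s u : 1 - s]`. -/
noncomputable def sphereParam : C(I × Circle, OnePoint ℂ) :=
  ⟨sphereParamFun, continuous_sphereParamFun⟩

theorem sphereParam_one (u : Circle) : sphereParam (1, u) = OnePoint.infty := if_pos rfl

theorem sphereParam_of_ne_one {s : I} (hs : s ≠ 1) (u : Circle) : sphereParam (s, u) =
    (((((s : ℝ) / (1 - (s : ℝ)) : ℝ) : ℂ) * (u : ℂ) : ℂ) : OnePoint ℂ) := if_neg hs

theorem sphereParam_zero (u : Circle) : sphereParam (0, u) = ((0 : ℂ) : OnePoint ℂ) := by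
  rw [sphereParam_of_ne_one zero_ne_one]
  simp

/-- The radial coordinate `|w| / (1 + |w|)`. -/
noncomputable def sphereRadius (x : ℝ) (hx : 0 ≤ x) : I :=
  ⟨x / (1 + x), by positivity, (div_le_one (by positivity)).2 (by linarith)⟩

theorem sphereParam_sphereRadius {x : ℝ} (hx : 0 ≤ x) (u : Circle) :
    sphereParam (sphereRadius x hx, u) = (((x : ℂ) * (u : ℂ) : ℂ) : OnePoint ℂ) := by
  have h1 : (1 + x) ≠ 0 := by positivity
  rw [sphereParam_of_ne_one]
  · congr 3
    simp only [sphereRadius]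
    field_simp
    ring
  · intro h
    have := congrArg Subtype.val h
    simp only [sphereRadius, Icc.coe_one] at this
    rw [div_eq_one_iff_eq h1] at this
    linarith

theorem surjective_sphereParam : Function.Surjective sphereParam := by
  intro v
  induction v using OnePoint.rec with
  | infty => exact ⟨(1, 1), sphereParam_one 1⟩
  | coe w =>
    obtain ⟨u, hu⟩ := exists_circle_mul w
    exact ⟨_, (sphereParam_sphereRadius (norm_nonneg w) u).trans (by rw [← hu])⟩

theorem sphereParam_eq {p p' : I × Circle} (h : sphereParam p = sphereParam p') :
    p.1 = p'.1 ∧ (p.1 = 0 ∨ p.1 = 1 ∨ p = p') := by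
  obtain ⟨s, u⟩ := p
  obtain ⟨s', u'⟩ := p'
  by_cases hs : s = 1
  · subst hs
    by_cases hs' : s' = 1
    · exact ⟨hs'.symm, Or.inr (Or.inl rfl)⟩
    · rw [sphereParam_one, sphereParam_of_ne_one hs'] at h
      exact absurd h (OnePoint.infty_ne_coe _)
  · by_cases hs' : s' = 1
    · subst hs'
      rw [sphereParam_one, sphereParam_of_ne_one hs] at h
      exact absurd h (OnePoint.coe_ne_infty _)
    · rw [sphereParam_of_ne_one hs, sphereParam_of_ne_one hs', OnePoint.coe_eq_coe] at h
      have h1 : 0 < 1 - (s : ℝ) :=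
        sub_pos.2 (lt_of_le_of_ne s.2.2 fun h => hs (Subtype.ext h))
      have h1' : 0 < 1 - (s' : ℝ) :=
        sub_pos.2 (lt_of_le_of_ne s'.2.2 fun h => hs' (Subtype.ext h))
      have hn := congrArg norm h
      rw [norm_mul, norm_mul, Circle.norm_coe, Circle.norm_coe, Complex.norm_real,
        Complex.norm_real, mul_one, mul_one, Real.norm_of_nonneg (div_nonneg s.2.1 h1.le),
        Real.norm_of_nonneg (div_nonneg s'.2.1 h1'.le), div_eq_div_iff h1.ne' h1'.ne'] at hn
      have hss : s = s' := Subtype.ext (by linarith)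
      subst hss
      refine ⟨rfl, or_iff_not_imp_left.2 fun h0 => Or.inr ?_⟩
      have h0' : (((s : ℝ) / (1 - (s : ℝ)) : ℝ) : ℂ) ≠ 0 := by
        rw [Complex.ofReal_ne_zero]
        exact div_ne_zero (fun h => h0 (Subtype.ext h)) h1.ne'
      exact Prod.ext rfl (Circle.ext (mul_left_cancel₀ h0' h))

/-- The radial self-map of the projective line with radial profile `q`. -/
noncomputable def sphereRadial (q : I → I) (v : OnePoint ℂ) : OnePoint ℂ :=
  sphereParam (q (surjective_sphereParam v).choose.1, (surjective_sphereParam v).choose.2)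

/-- The angle is ambiguous only at the two poles, and `q` fixes both of them. -/
theorem sphereRadial_sphereParam {q : I → I} (h0 : q 0 = 0) (h1 : q 1 = 1) (p : I × Circle) :
    sphereRadial q (sphereParam p) = sphereParam (q p.1, p.2) := by
  rw [sphereRadial]
  obtain ⟨h2, h3⟩ := sphereParam_eq (surjective_sphereParam (sphereParam p)).choose_spec
  rcases h3 with h3 | h3 | h3
  · rw [← h2, h3, h0, sphereParam_zero, sphereParam_zero]
  · rw [← h2, h3, h1, sphereParam_one, sphereParam_one]
  · rw [h3]

/-- Polar coordinates are a proper surjection onto the sphere, hence still a quotient map after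
multiplication with `K`. -/
theorem continuous_sphereRadial {K : Type} [TopologicalSpace K] {q : K → I → I}
    (hq : Continuous fun p : K × I => q p.1 p.2) (h0 : ∀ k, q k 0 = 0) (h1 : ∀ k, q k 1 = 1) :
    Continuous fun p : K × OnePoint ℂ => sphereRadial (q p.1) p.2 := by
  have hQ := IsProperMap.prodMap (isProperMap_id (X := K)) sphereParam.continuous.isProperMap
  have hs : Function.Surjective (Prod.map (id : K → K) sphereParam) :=
    Function.surjective_id.prodMap surjective_sphereParam
  refine (hQ.isClosedMap.isQuotientMap hQ.continuous hs).continuous_iff.2 ?_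
  have : Continuous fun p : K × (I × Circle) => sphereParam (q p.1 p.2.1, p.2.2) :=
    sphereParam.continuous.comp
      ((hq.comp (by fun_prop : Continuous fun p : K × (I × Circle) => (p.1, p.2.1))).prodMk
        (by fun_prop))
  exact this.congr fun p => (sphereRadial_sphereParam (h0 p.1) (h1 p.1) p.2).symm

/-- Radial self-maps of the projective line are homotopic to the identity. -/
theorem sphereRadial_homotopic_id {q : I → I} (hq : Continuous q) (h0 : q 0 = 0) (h1 : q 1 = 1)
    (g : C(OnePoint ℂ, OnePoint ℂ)) (hg : ⇑g = sphereRadial q) :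
    g.Homotopic (ContinuousMap.id _) := by
  refine ⟨{ toFun := fun p => sphereRadial (fun r => mixI p.1 (q r) r) p.2
            continuous_toFun := continuous_sphereRadial (q := fun t r => mixI t (q r) r)
              (continuous_mixI continuous_fst (hq.comp continuous_snd) continuous_snd)
              (fun t => by rw [h0, mixI_self]) (fun t => by rw [h1, mixI_self])
            map_zero_left := fun v => ?_
            map_one_left := fun v => ?_ }⟩
  · simp only [mixI_zero, hg]
  · simp only [mixI_one]
    obtain ⟨p, rfl⟩ := surjective_sphereParam v
    exact sphereRadial_sphereParam rfl rfl p

end SphereCoordinates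

/-! ### The triangle spanned by the cube roots of unity. -/

section Triangle

/-- The point with barycentric coordinates `t` in the triangle spanned by the cube roots of unity. -/
noncomputable def trianglePoint (t : stdSimplex ℝ (Fin 3)) : ℂ :=
  ∑ k : Fin 3, ((t.1 k : ℝ) : ℂ) * Complex.exp (2 * Real.pi * Complex.I / 3) ^ (k : ℕ)

theorem continuous_trianglePoint : Continuous trianglePoint := by
  have h (i : Fin 3) : Continuous fun t : stdSimplex ℝ (Fin 3) => t.1 i :=
    (continuous_apply i).comp continuous_subtype_val
  unfold trianglePoint
  exact continuous_finsetSum _ fun i _ =>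
    (Complex.continuous_ofReal.comp (h i)).mul continuous_const

theorem exp_two_pi_I_div_three : Complex.exp (2 * Real.pi * Complex.I / 3) =
    ⟨-1 / 2, √3 / 2⟩ := by
  have h : (2 * Real.pi * Complex.I / 3 : ℂ) = ((Real.pi - Real.pi / 3 : ℝ) : ℂ) * Complex.I := by
    push_cast; ring
  rw [h]
  apply Complex.ext
  · rw [Complex.exp_ofReal_mul_I_re, Real.cos_pi_sub, Real.cos_pi_div_three]; norm_num
  · rw [Complex.exp_ofReal_mul_I_im, Real.sin_pi_sub, Real.sin_pi_div_three]

/-- Distinct cube roots of unity have inner product `-1/2`, so the squared norm is the sum of the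
squares of the coordinates minus their pairwise products; the square of the sum of the coordinates
is `1`. -/
theorem norm_trianglePoint_sq (t : stdSimplex ℝ (Fin 3)) :
    ‖trianglePoint t‖ ^ 2 = 1 - 3 * (t.1 0 * t.1 1 + t.1 1 * t.1 2 + t.1 2 * t.1 0) := by
  have hsum : t.1 0 + t.1 1 + t.1 2 = 1 := by
    have := t.2.2
    rwa [Fin.sum_univ_three] at this
  have h3 : √3 * √3 = 3 := Real.mul_self_sqrt (by norm_num)
  rw [← Complex.normSq_eq_norm_sq, Complex.normSq_apply, trianglePoint, Fin.sum_univ_three,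
    exp_two_pi_I_div_three]
  simp [pow_two]
  have h0 : t.1 0 = 1 - t.1 1 - t.1 2 := by linarith
  rw [h0]
  ring_nf
  have h3' : √3 ^ 2 = 3 := by rw [pow_two, h3]
  have h34 : √3 ^ 4 = 9 := by rw [show √3 ^ 4 = (√3 ^ 2) ^ 2 by ring, h3']; norm_num
  simp only [h3', h34]
  ring

theorem norm_trianglePoint_le (t : stdSimplex ℝ (Fin 3)) : ‖trianglePoint t‖ ≤ 1 := by
  rw [← abs_norm, ← sq_le_one_iff_abs_le_one, norm_trianglePoint_sq]
  have h0 := t.2.1 0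
  have h1 := t.2.1 1
  have h2 := t.2.1 2
  have : 0 ≤ t.1 0 * t.1 1 + t.1 1 * t.1 2 + t.1 2 * t.1 0 := by positivity
  linarith

/-- On an edge one pairwise product survives, and it is at most `1/4`. The inradius `1/2` is also
the radius from which a glue profile equals `1`, so bubbles are constant along the edges. -/
theorem half_le_norm_trianglePoint {t : stdSimplex ℝ (Fin 3)} (ht : ∃ i, t.1 i = 0) :
    1 / 2 ≤ ‖trianglePoint t‖ := by
  refine le_of_sq_le_sq ?_ (norm_nonneg _)
  rw [norm_trianglePoint_sq]
  have hsum : t.1 0 + t.1 1 + t.1 2 = 1 := by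
    have := t.2.2
    rwa [Fin.sum_univ_three] at this
  obtain ⟨i, hi⟩ := ht
  fin_cases i <;> simp only [Fin.zero_eta, Fin.mk_one, Fin.reduceFinMk] at hi <;> rw [hi] at hsum ⊢
  · nlinarith [sq_nonneg (t.1 1 - t.1 2)]
  · nlinarith [sq_nonneg (t.1 0 - t.1 2)]
  · nlinarith [sq_nonneg (t.1 0 - t.1 1)]

/-- The contraction of the triangle towards its barycentre. -/
noncomputable def triangleShrink (c : I) (t : stdSimplex ℝ (Fin 3)) : stdSimplex ℝ (Fin 3) :=
  ⟨fun i => c * t.1 i + (1 - c) / 3, fun i =>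
    add_nonneg (mul_nonneg c.2.1 (t.2.1 i)) (div_nonneg (by linarith [c.2.2]) (by norm_num)), by
    have := t.2.2
    rw [Fin.sum_univ_three] at this ⊢
    linear_combination (c : ℝ) * this⟩

theorem continuous_triangleShrink :
    Continuous fun p : I × stdSimplex ℝ (Fin 3) => triangleShrink p.1 p.2 := by
  have h (i : Fin 3) : Continuous fun t : stdSimplex ℝ (Fin 3) => t.1 i :=
    (continuous_apply i).comp continuous_subtype_val
  refine Continuous.subtype_mk (continuous_pi fun i => ?_) _
  have := (h i).comp (continuous_snd : Continuous fun p : I × stdSimplex ℝ (Fin 3) => p.2)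
  exact ((continuous_subtype_val.comp continuous_fst).mul this).add (by fun_prop)

theorem triangleShrink_one (t : stdSimplex ℝ (Fin 3)) : triangleShrink 1 t = t := by
  refine Subtype.ext (funext fun i => ?_)
  simp [triangleShrink]

/-- The barycentre is the origin, because the cube roots of unity sum to zero. -/
theorem trianglePoint_shrink (c : I) (t : stdSimplex ℝ (Fin 3)) :
    trianglePoint (triangleShrink c t) = (c : ℝ) * trianglePoint t := by
  rw [trianglePoint, trianglePoint, Fin.sum_univ_three, Fin.sum_univ_three, exp_two_pi_I_div_three]
  simp only [triangleShrink]
  apply Complex.ext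
  · have h3 : √3 * √3 = 3 := Real.mul_self_sqrt (by norm_num)
    simp [pow_two]
    -- The real part of the square of the root is `1/4 - √3 * √3 / 4`, and it enters with the
    -- additional weight `(1 - c) / 3`.
    linear_combination ((c : ℝ) - 1) / 12 * h3
  · simp [pow_two]; ring

end Triangle

/-! ### Profiles concentrated near the centre of the disc. -/

section SmallProfiles

/-- The scaling which is the identity for `ε ≤ r` and vanishes for `r ≤ ε / 2`. -/
noncomputable def smallScale (ε : ℝ) (r : I) : I :=
  projIcc 0 1 zero_le_one (min (r : ℝ) (2 * r - ε))

/-- The profile `q` rescaled to the disc of radius `ε`. -/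
noncomputable def smallProfile (q : I → I) (ε : ℝ) (r : I) : I :=
  q (projIcc 0 1 zero_le_one (r / ε))

theorem smallScale_eq_zero {ε : ℝ} {r : I} (h : (r : ℝ) ≤ ε / 2) : smallScale ε r = 0 :=
  projIcc_of_le_left _ ((min_le_right _ _).trans (by linarith))

theorem IsGlueProfile.one_of_projIcc {q : I → I} (hq : IsGlueProfile q) {x : ℝ} (hx : 1 / 2 ≤ x) :
    q (projIcc 0 1 zero_le_one x) = 1 := by
  refine hq.one _ ?_
  rw [coe_projIcc]
  exact le_max_of_le_right (le_min (by norm_num) hx)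

theorem smallProfile_eq_one {q : I → I} (hq : IsGlueProfile q) {ε : ℝ} (hε : 0 < ε) {r : I}
    (h : ε / 2 ≤ r) : smallProfile q ε r = 1 :=
  hq.one_of_projIcc ((le_div_iff₀ hε).2 (by linarith))

theorem smallScale_zero_or_one {q : I → I} (hq : IsGlueProfile q) {ε : ℝ} (hε : 0 < ε) (r : I) :
    smallScale ε r = 0 ∨ smallProfile q ε r = 1 := by
  rcases le_total (r : ℝ) (ε / 2) with h | h
  · exact Or.inl (smallScale_eq_zero h)
  · exact Or.inr (smallProfile_eq_one hq hε h)

theorem smallScale_zero {ε : ℝ} (hε : 0 < ε) : smallScale ε 0 = 0 :=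
  smallScale_eq_zero (by simp; linarith)

theorem smallScale_one {ε : ℝ} (hε : ε ≤ 1) : smallScale ε 1 = 1 := by
  refine projIcc_of_right_le _ (le_min le_rfl ?_)
  simp; linarith

theorem smallProfile_zero {q : I → I} (hq : IsGlueProfile q) (ε : ℝ) : smallProfile q ε 0 = 0 := by
  rw [smallProfile, Icc.coe_zero, zero_div, projIcc_left]
  exact hq.zero

/-- At `ε = 1` the small modification is the gluing itself, so varying `ε` deforms one into the
other. -/
theorem smallScale_at_one (r : I) : smallScale 1 r = glueScale r := by
  refine Subtype.ext ?_
  rw [smallScale, coe_projIcc, glueScale, min_eq_right (by linarith [r.2.2] : 2 * (r : ℝ) - 1 ≤ r),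
    min_eq_right (by linarith [r.2.2])]

theorem smallProfile_at_one (q : I → I) (r : I) : smallProfile q 1 r = q r := by
  rw [smallProfile, div_one, projIcc_val]

variable {B X : Type} [TopologicalSpace X] {π : X → B} {b₀ : B}

theorem IsGlueProfile.isProfile_small {q : I → I} (hq : IsGlueProfile q) (h : FiberSphere π b₀)
    {ε : ℝ} (hε : 0 < ε) (hε' : ε ≤ 1) : h.IsProfile (smallScale ε) (smallProfile q ε) where
  zero := smallScale_zero hε
  one := smallScale_one hε'
  zero_or_one := smallScale_zero_or_one hq hε
  center u u' := by rw [smallProfile_zero hq, h.map_zero, h.map_zero]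

theorem FiberSphere.isProfile_one (h : FiberSphere π b₀) {a : I → I} (h0 : a 0 = 0)
    (h1 : a 1 = 1) : h.IsProfile a fun _ => 1 :=
  ⟨h0, h1, fun _ => Or.inr rfl, fun u u' => by rw [h.map_one, h.map_one]⟩

theorem continuous_smallScale {K : Type*} [TopologicalSpace K] {ε : K → ℝ} {r : K → I}
    (hε : Continuous ε) (hr : Continuous r) : Continuous fun k => smallScale (ε k) (r k) := by
  unfold smallScale
  exact continuous_projIcc.comp (by fun_prop)

theorem continuous_smallProfile {q : I → I} (hq : Continuous q) {K : Type*} [TopologicalSpace K]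
    {ε : K → ℝ} {r : K → I} (hε : Continuous ε) (hε0 : ∀ k, ε k ≠ 0) (hr : Continuous r) :
    Continuous fun k => smallProfile q (ε k) (r k) := by
  unfold smallProfile
  exact hq.comp (continuous_projIcc.comp
    ((continuous_subtype_val.comp hr).div hε hε0))

end SmallProfiles

/-! ### Bubbles: maps of the double triangle which wrap one half around a sphere. -/

section GluingClass

/-- Polar coordinates on the closed unit disc. -/
noncomputable def discPolarCoord (w : Metric.closedBall (0 : ℂ) 1) : I × Circle :=
  (exists_polarPoint w.2).choose

theorem polarPoint_discPolarCoord (w : Metric.closedBall (0 : ℂ) 1) :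
    polarPoint (discPolarCoord w) = w := (exists_polarPoint w.2).choose_spec

/-- The chosen polar coordinates are not assumed continuous; a function of them is continuous as
soon as it forgets the angle at the origin. -/
theorem continuous_polar {K X : Type} [TopologicalSpace K] [TopologicalSpace X]
    {E : K → I × Circle → X} (hE : Continuous fun p : K × (I × Circle) => E p.1 p.2)
    (h0 : ∀ k u u', E k (0, u) = E k (0, u')) :
    Continuous fun p : K × Metric.closedBall (0 : ℂ) 1 => E p.1 (discPolarCoord p.2) := by
  refine continuous_of_polar (G := fun k w => E k (discPolarCoord w)) (hE.congr fun p => ?_)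
  obtain ⟨h1, h2⟩ := polarPoint_eq (polarPoint_discPolarCoord ⟨polarPoint p.2, polarPoint_mem p.2⟩)
  rcases h2 with h2 | h2
  · have e1 : p.2 = (0, p.2.2) := Prod.ext (h1.symm.trans h2) rfl
    have e2 : discPolarCoord ⟨polarPoint p.2, polarPoint_mem p.2⟩ =
      (0, (discPolarCoord ⟨polarPoint p.2, polarPoint_mem p.2⟩).2) := Prod.ext h2 rfl
    rw [e2, e1]
    exact h0 _ _ _
  · rw [h2]

/-- Polar coordinates of the points of the triangle. -/
noncomputable def trianglePolar (t : stdSimplex ℝ (Fin 3)) : I × Circle :=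
  discPolarCoord ⟨trianglePoint t, mem_closedBall_zero_iff.2 (norm_trianglePoint_le t)⟩

theorem polarPoint_trianglePolar (t : stdSimplex ℝ (Fin 3)) :
    polarPoint (trianglePolar t) = trianglePoint t := polarPoint_discPolarCoord _

theorem half_le_trianglePolar {t : stdSimplex ℝ (Fin 3)} (ht : ∃ i, t.1 i = 0) :
    1 / 2 ≤ ((trianglePolar t).1 : ℝ) := by
  rw [← norm_polarPoint, polarPoint_trianglePolar]
  exact half_le_norm_trianglePoint ht

theorem continuous_trianglePolar {K X : Type} [TopologicalSpace K] [TopologicalSpace X]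
    {E : K → I × Circle → X} (hE : Continuous fun p : K × (I × Circle) => E p.1 p.2)
    (h0 : ∀ k u u', E k (0, u) = E k (0, u')) :
    Continuous fun p : K × stdSimplex ℝ (Fin 3) => E p.1 (trianglePolar p.2) :=
  (continuous_polar hE h0).comp (continuous_fst.prodMk
    ((continuous_trianglePoint.comp continuous_snd).subtype_mk _))

theorem continuous_trianglePolar_const {X : Type} [TopologicalSpace X] {E : I × Circle → X}
    (hE : Continuous E) (h0 : ∀ u u', E (0, u) = E (0, u')) :
    Continuous fun t : stdSimplex ℝ (Fin 3) => E (trianglePolar t) := by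
  have h2 := continuous_trianglePolar (K := Unit) (E := fun _ => E) (hE.comp continuous_snd)
    fun _ => h0
  have h3 : Continuous fun t : stdSimplex ℝ (Fin 3) => ((), t) := by fun_prop
  exact h2.comp h3

/-- The edges of the triangle lie at radius at least `1/2`, so agreement of the two halves there is
all that gluing requires. -/
theorem DoubleTriangle.glue_homotopic_polar {X : Type} [TopologicalSpace X]
    {E E' : I → I × Circle → X} (hE : Continuous fun p : I × (I × Circle) => E p.1 p.2)
    (hE' : Continuous fun p : I × (I × Circle) => E' p.1 p.2)
    (h0 : ∀ k u u', E k (0, u) = E k (0, u')) (h0' : ∀ k u u', E' k (0, u) = E' k (0, u'))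
    (hEE' : ∀ k p, 1 / 2 ≤ (p.1 : ℝ) → E k p = E' k p)
    {a₀ b₀ a₁ b₁ : C(stdSimplex ℝ (Fin 3), X)}
    (h₀ : ∀ t : stdSimplex ℝ (Fin 3), (∃ i, t.1 i = 0) → a₀ t = b₀ t)
    (h₁ : ∀ t : stdSimplex ℝ (Fin 3), (∃ i, t.1 i = 0) → a₁ t = b₁ t)
    (ha₀ : ∀ t, E 0 (trianglePolar t) = a₀ t) (hb₀ : ∀ t, E' 0 (trianglePolar t) = b₀ t)
    (ha₁ : ∀ t, E 1 (trianglePolar t) = a₁ t) (hb₁ : ∀ t, E' 1 (trianglePolar t) = b₁ t) :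
    (glue a₀ b₀ h₀).Homotopic (glue a₁ b₁ h₁) :=
  glue_homotopic (a := fun k t => E k (trianglePolar t)) (b := fun k t => E' k (trianglePolar t))
    (continuous_trianglePolar hE h0) (continuous_trianglePolar hE' h0')
    (fun k _ ht => hEE' k _ (half_le_trianglePolar ht)) h₀ h₁ ha₀ hb₀ ha₁ hb₁

variable {B X : Type} [TopologicalSpace X] {π : X → B} {b₀ : B}

/-- The triangle mapped onto the sphere `h` with radial profile `r ↦ q (φ r)`. -/
noncomputable def bubble (h : FiberSphere π b₀) (q : I → I) (φ : ℝ → ℝ) (p : I × Circle) : X :=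
  h.map (q (projIcc 0 1 zero_le_one (φ p.1)), p.2)

theorem continuous_bubble {h : FiberSphere π b₀} {q : I → I} (hq : IsGlueProfile q)
    {K : Type} [TopologicalSpace K] {φ : K → ℝ → ℝ}
    (hφ : Continuous fun p : K × I => φ p.1 p.2) :
    Continuous fun p : K × (I × Circle) => bubble h q (φ p.1) p.2 := by
  refine h.map.continuous.comp (Continuous.prodMk ?_ (by fun_prop))
  exact hq.continuous.comp (continuous_projIcc.comp
    (hφ.comp (by fun_prop : Continuous fun p : K × (I × Circle) => (p.1, p.2.1))))

theorem bubble_zero {h : FiberSphere π b₀} {q : I → I} (hq : IsGlueProfile q) {φ : ℝ → ℝ}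
    (hφ : φ 0 = 0) (u : Circle) : bubble h q φ (0, u) = h.bot := by
  rw [bubble]
  simp only [Icc.coe_zero, hφ, projIcc_left]
  exact (congrArg (fun x => h.map (x, u)) hq.zero).trans (h.map_zero u)

theorem continuous_bubble_trianglePolar {h : FiberSphere π b₀} {q : I → I}
    (hq : IsGlueProfile q) {φ : ℝ → ℝ}
    (hφc : Continuous φ) (hφ0 : φ 0 = 0) :
    Continuous fun t => bubble h q φ (trianglePolar t) := by
  have h1 : Continuous (bubble h q φ) := (continuous_bubble (K := Unit) (φ := fun _ => φ) hq
    (hφc.comp (continuous_subtype_val.comp continuous_snd))).comp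
      (by fun_prop : Continuous fun p : I × Circle => ((), p))
  exact continuous_trianglePolar_const h1
    fun u u' => (bubble_zero hq hφ0 u).trans (bubble_zero hq hφ0 u').symm

theorem bubble_top {h : FiberSphere π b₀} {q : I → I} (hq : IsGlueProfile q) {φ : ℝ → ℝ}
    {p : I × Circle} (hφ : 1 / 2 ≤ φ p.1) : bubble h q φ p = h.top := by
  rw [bubble, hq.one_of_projIcc hφ, h.map_one]

/-- The image of the class of the double triangle under a bubble does not depend on the radial
parametrization. -/
theorem glue_bubble_homotopic {h : FiberSphere π b₀} {q : I → I} (hq : IsGlueProfile q)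
    {φ₀ φ₁ : ℝ → ℝ} (hc₀ : Continuous fun x : I => φ₀ x) (hc₁ : Continuous fun x : I => φ₁ x)
    (hz₀ : φ₀ 0 = 0) (hz₁ : φ₁ 0 = 0) (ht₀ : ∀ x, 1 / 2 ≤ x → 1 / 2 ≤ φ₀ x)
    (ht₁ : ∀ x, 1 / 2 ≤ x → 1 / 2 ≤ φ₁ x) {a₀ b a₁ : C(stdSimplex ℝ (Fin 3), X)}
    (h₀ : ∀ t : stdSimplex ℝ (Fin 3), (∃ i, t.1 i = 0) → a₀ t = b t)
    (h₁ : ∀ t : stdSimplex ℝ (Fin 3), (∃ i, t.1 i = 0) → a₁ t = b t)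
    (ha₀ : ∀ t, bubble h q φ₀ (trianglePolar t) = a₀ t)
    (ha₁ : ∀ t, bubble h q φ₁ (trianglePolar t) = a₁ t) (hb : ∀ t, b t = h.top) :
    (DoubleTriangle.glue a₀ b h₀).Homotopic (DoubleTriangle.glue a₁ b h₁) := by
  refine DoubleTriangle.glue_homotopic_polar
    -- The conditions on the radial functions, namely `0` at `0` and at least `1/2` from `1/2` on,
    -- are convex, so linear interpolation preserves them.
    (E := fun k => bubble h q fun x => (1 - k) * φ₀ x + k * φ₁ x) (E' := fun _ _ => h.top)
    (continuous_bubble hq (φ := fun (k : I) x => (1 - k) * φ₀ x + k * φ₁ x) ?_)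
    continuous_const (fun k u u' => ?_) (fun _ _ _ => rfl) (fun k p hp => ?_) h₀ h₁
    (fun t => ?_) (fun t => (hb t).symm) (fun t => ?_) (fun t => (hb t).symm)
  · have e0 := hc₀.comp (continuous_snd : Continuous fun p : I × I => p.2)
    have e1 := hc₁.comp (continuous_snd : Continuous fun p : I × I => p.2)
    exact ((continuous_const.sub (continuous_subtype_val.comp continuous_fst)).mul e0).add
      ((continuous_subtype_val.comp continuous_fst).mul e1)
  · rw [bubble_zero hq (by simp [hz₀, hz₁]), bubble_zero hq (by simp [hz₀, hz₁])]
  · refine bubble_top hq ?_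
    have e0 := ht₀ _ hp
    have e1 := ht₁ _ hp
    have k0 := k.2.1
    have k1 := k.2.2
    nlinarith
  · simp only [Icc.coe_zero, sub_zero, one_mul, zero_mul, add_zero]
    exact ha₀ t
  · simp only [Icc.coe_one, sub_self, one_mul, zero_mul, zero_add]
    exact ha₁ t

/-- The sphere in the fibre given by a map from the projective line. -/
noncomputable def FiberSphere.ofMap (f : C(OnePoint ℂ, X)) (hf : ∀ p, π (f p) = b₀) :
    FiberSphere π b₀ where
  map := f.comp sphereParam
  bot := f ((0 : ℂ) : OnePoint ℂ)
  top := f OnePoint.infty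
  map_mem p := hf _
  map_zero u := by rw [ContinuousMap.comp_apply, sphereParam_zero]
  map_one u := by rw [ContinuousMap.comp_apply, sphereParam_one]

/-- The class of a sphere as a bubble. -/
theorem exists_bubble_of_sphere (f : C(OnePoint ℂ, X)) (hf : ∀ p, π (f p) = b₀)
    {μ : H₂ (OnePoint ℂ)} (hμ : IsFundamentalClass μ) {q : I → I} (hq : IsGlueProfile q) :
    ∃ φ : ℝ → ℝ, (Continuous fun x : I => φ x) ∧ φ 0 = 0 ∧ (∀ x, 1 / 2 ≤ x → 1 / 2 ≤ φ x) ∧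
    ∃ (a b : C(stdSimplex ℝ (Fin 3), X))
      (hab : ∀ t : stdSimplex ℝ (Fin 3), (∃ i, t.1 i = 0) → a t = b t),
      (∀ t, bubble (FiberSphere.ofMap f hf) q φ (trianglePolar t) = a t) ∧
      (∀ t, b t = (FiberSphere.ofMap f hf).top) ∧
      H₂Map f μ = H₂Map (DoubleTriangle.glue a b hab) DoubleTriangle.fundClass := by
  obtain ⟨r, τ, hr, hτ, U, hU, hdiff⟩ := hμ.exists_triangle ((0 : ℂ) : OnePoint ℂ)
  rw [OnePoint.nhds_coe_eq, mem_map, Metric.mem_nhds_iff] at hU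
  obtain ⟨δ, hδ, hδU⟩ := hU
  -- The two summands serve two purposes. With `κ ≥ (1 + δ) / δ` the profile `Q` equals `1` where
  -- the affine coordinate has norm at least `δ`, in particular off `U`; with `κ ≥ (2 + r) / r` it
  -- equals `1` on the edges of the triangle.
  set κ : ℝ := (1 + δ) / δ + (2 + r) / r with hκ
  have hκ1 : (1 + δ) / δ ≤ κ := le_add_of_nonneg_right (by positivity)
  have hκ2 : (2 + r) / r ≤ κ := le_add_of_nonneg_left (by positivity)
  have hκ0 : 1 ≤ κ := le_trans ((one_le_div hδ).2 (by linarith)) hκ1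
  -- The point of the triangle at polar radius `x` has affine coordinate of norm `r * x`, hence
  -- radial coordinate `r * x / (1 + r * x)` on the sphere.
  let φ : ℝ → ℝ := fun x => κ * (r * x / (1 + r * x))
  let Q : I → I := fun s => q (projIcc 0 1 zero_le_one (κ * s))
  have hQc : Continuous Q := hq.continuous.comp (continuous_projIcc.comp (by fun_prop))
  have hQ0 : Q 0 = 0 := by
    simp only [Q, Icc.coe_zero, mul_zero, projIcc_left]
    exact hq.zero
  have hQ1 : Q 1 = 1 := hq.one_of_projIcc (by simp; linarith)
  -- The map `p` is homotopic to the identity and collapses the complement of `U` to `∞`, so that `f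
  -- ∘ p` differs from a constant map only near `0`.
  let p : C(OnePoint ℂ, OnePoint ℂ) := ⟨sphereRadial Q,
    (continuous_sphereRadial (K := Unit) (q := fun _ => Q) (hQc.comp continuous_snd)
      (fun _ => hQ0) fun _ => hQ1).comp (by fun_prop : Continuous fun v : OnePoint ℂ => ((), v))⟩
  have hp : H₂Map (f.comp p) μ = H₂Map f μ := by
    have h1 : (f.comp p).Homotopic (f.comp (ContinuousMap.id _)) :=
      (ContinuousMap.Homotopic.refl f).comp (sphereRadial_homotopic_id hQc hQ0 hQ1 p rfl)
    rw [H₂Map_eq_of_homotopic h1, ContinuousMap.comp_id]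
  have hφ : ∀ x, 1 / 2 ≤ x → 1 / 2 ≤ φ x := by
    intro x hx
    have hrx : 0 < 1 + r * x := by nlinarith
    have hrx' : r / (2 + r) ≤ r * x / (1 + r * x) := by
      rw [div_le_div_iff₀ (by linarith) hrx]
      nlinarith
    calc (1 / 2 : ℝ) ≤ (2 + r) / r * (r / (2 + r)) := by
          rw [div_mul_div_cancel₀ hr.ne', div_self (by linarith)]; norm_num
      _ ≤ κ * (r * x / (1 + r * x)) :=
          mul_le_mul hκ2 hrx' (by positivity) (by linarith)
  have hpτ : ∀ t, bubble (FiberSphere.ofMap f hf) q φ (trianglePolar t) = (f.comp p).comp τ t := by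
    intro t
    obtain ⟨hs, hc⟩ := hτ t
    have hchart : chartAt ℂ ((0 : ℂ) : OnePoint ℂ) = sphereChartZero := rfl
    rw [hchart] at hs hc
    obtain ⟨w, -, hw⟩ : ∃ w : ℂ, w ∈ univ ∧ (w : OnePoint ℂ) = τ t := by
      obtain ⟨w, hw, h⟩ := hs
      exact ⟨w, hw, h⟩
    have hx : 0 ≤ r * ((trianglePolar t).1 : ℝ) := mul_nonneg hr.le (trianglePolar t).1.2.1
    rw [← hw, sphereChartZero_coe, sphereChartZero_coe, zero_add] at hc
    have hw' : τ t = sphereParam (sphereRadius _ hx, (trianglePolar t).2) := by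
      rw [sphereParam_sphereRadius, ← hw]
      congr 1
      rw [hc]
      change _ * trianglePoint t = _
      rw [← polarPoint_trianglePolar, polarPoint]
      push_cast
      ring
    change f (sphereParam _) = f (sphereRadial Q (τ t))
    rw [hw', sphereRadial_sphereParam hQ0 hQ1]
    rfl
  have hconst : ∀ v ∉ U, f.comp p v = ContinuousMap.const _ (f OnePoint.infty) v := by
    intro v hv
    obtain ⟨⟨s, u⟩, rfl⟩ := surjective_sphereParam v
    have hs : 1 / 2 ≤ κ * s := by
      by_contra hlt
      rw [not_le] at hlt
      refine hv ?_
      have hsδ : (s : ℝ) * (1 + δ) < δ := by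
        have h1 : (1 + δ) / δ * s < 1 :=
          lt_of_le_of_lt (mul_le_mul_of_nonneg_right hκ1 s.2.1) (by linarith)
        rw [div_mul_eq_mul_div, div_lt_one hδ] at h1
        linarith
      have hs1 : 0 < 1 - (s : ℝ) := by nlinarith [s.2.1, s.2.2]
      rw [sphereParam_of_ne_one (fun h => by rw [h] at hs1; simp at hs1)]
      refine hδU ?_
      rw [mem_ball_zero_iff, norm_mul, Circle.norm_coe, mul_one, Complex.norm_real,
        Real.norm_of_nonneg (div_nonneg s.2.1 hs1.le), div_lt_iff₀ hs1]
      linarith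
    change f (sphereRadial Q _) = f OnePoint.infty
    rw [sphereRadial_sphereParam hQ0 hQ1]
    change f (sphereParam (q _, u)) = _
    rw [hq.one_of_projIcc hs, sphereParam_one]
  have hab : ∀ t : stdSimplex ℝ (Fin 3), (∃ i, t.1 i = 0) →
      (f.comp p).comp τ t = (ContinuousMap.const _ (f OnePoint.infty)).comp τ t := by
    intro t ht
    rw [← hpτ]
    exact bubble_top hq (hφ _ (half_le_trianglePolar ht))
  have hφc : Continuous fun x : I => φ x := by
    refine continuous_const.mul (Continuous.div (by fun_prop) (by fun_prop) fun x => ?_)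
    have := mul_nonneg hr.le x.2.1
    positivity
  refine ⟨φ, hφc, by simp [φ], hφ, _, _, hab, hpτ, fun t => rfl, ?_⟩
  rw [← hdiff X (f.comp p) (ContinuousMap.const _ (f OnePoint.infty)) hconst hab,
    H₂Map_const_apply, sub_zero, hp]

end GluingClass

/-! ### The class of a section after gluing. -/

section SphereClass

variable {B X : Type} [TopologicalSpace B] [ChartedSpace ℂ B] [TopologicalSpace X]
  {π : X → B} {b₀ : B} {T : DiscTrivialization π b₀} {h : FiberSphere π b₀}

/-- The parametrized disc of `T` is the disc of radius `ρ` around `b₀` in the preferred chart. -/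
def DiscTrivialization.IsChartDisc (T : DiscTrivialization π b₀) (ρ : ℝ) : Prop :=
  0 < ρ ∧ ∀ w ∈ Metric.closedBall (0 : ℂ) 1, T.disc w ∈ (chartAt ℂ b₀).source ∧
    chartAt ℂ b₀ (T.disc w) = chartAt ℂ b₀ b₀ + ρ * w

/-- A modification along small profiles is homotopic to the gluing. -/
theorem DiscTrivialization.homotopic_small [T2Space B] (hT : IsOpen (T.disc '' Metric.ball 0 1)) {q : I → I}
    (hq : IsGlueProfile q) {ε : ℝ} (hε0 : 0 < ε) (hε1 : ε ≤ 1) {s s' g : C(B, X)}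
    (hs : ∀ b, π (s b) = b) (hs₀ : s b₀ = h.top) (hss' : ⇑s' = T.modify h glueScale q s)
    (hg : ⇑g = T.modify h (smallScale ε) (smallProfile q ε) s) : s'.Homotopic g := by
  let e : I → ℝ := fun t => (1 - t) * 1 + t * ε
  have he : Continuous e := by fun_prop
  have he0 : ∀ t, 0 < e t := fun t => by
    have := t.2.1; have := t.2.2
    simp only [e]; nlinarith
  have he1 : ∀ t, e t ≤ 1 := fun t => by
    have := t.2.1; have := t.2.2
    simp only [e]; nlinarith
  refine T.modify_homotopic hT (a := fun t => smallScale (e t))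
    (q := fun t => smallProfile q (e t))
    (continuous_smallScale (he.comp continuous_fst) continuous_snd)
    (continuous_smallProfile hq.continuous (he.comp continuous_fst) (fun p => (he0 p.1).ne')
      continuous_snd) (fun t => hq.isProfile_small h (he0 t) (he1 t)) hs hs₀ (fun b => ?_)
    fun b => ?_
  · have e0 : e 0 = 1 := by simp [e]
    have e1 : smallScale 1 = glueScale := funext smallScale_at_one
    have e2 : smallProfile q 1 = q := funext (smallProfile_at_one q)
    rw [e0, e1, e2, hss']
  · have e0 : e 1 = ε := by simp [e]
    rw [e0, hg]

/-- With `q` equal to `1` no sphere is inserted: the section is only rescaled radially, and the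
scaling deforms linearly to the identity. -/
theorem DiscTrivialization.homotopic_smallScale [T2Space B] (hT : IsOpen (T.disc '' Metric.ball 0 1))
    {ε : ℝ} (hε0 : 0 < ε) (hε1 : ε ≤ 1) {s g : C(B, X)}
    (hs : ∀ b, π (s b) = b) (hs₀ : s b₀ = h.top)
    (hg : ⇑g = T.modify h (smallScale ε) (fun _ => 1) s) : g.Homotopic s := by
  refine T.modify_homotopic hT (a := fun t r => mixI t (smallScale ε r) r)
    (q := fun _ _ => 1) (continuous_mixI continuous_fst
      (continuous_smallScale continuous_const continuous_snd) continuous_snd) continuous_const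
    (fun t => h.isProfile_one (by rw [smallScale_zero hε0, mixI_self])
      (by rw [smallScale_one hε1, mixI_self])) hs hs₀ (fun b => ?_) fun b => ?_
  · simp only [mixI_zero, hg]
  · simp only [mixI_one]
    rw [(T.modify_id hs hs₀).2]

/-- The modified section over the disc of radius `m`, contracted towards the centre by `k`. -/
noncomputable def DiscTrivialization.contractFiber (T : DiscTrivialization π b₀)
    (h : FiberSphere π b₀) (a q : I → I) (s : B → X) (m k : I) (p : I × Circle) : X :=
  T.lift (polarPoint (k * (m * p.1), p.2)) (T.modifyFiber h (fun x => k * a x) q s (m * p.1, p.2))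

theorem DiscTrivialization.continuous_contractFiber {a q : I → I} (ha : Continuous a)
    (hq : Continuous q) (haq : ∀ x, a x = 0 ∨ q x = 1) {s : C(B, X)} (hs : ∀ b, π (s b) = b)
    (hs₀ : s b₀ = h.top) (m : I) :
    Continuous fun p : I × (I × Circle) => T.contractFiber h a q s m (σ p.1) p.2 := by
  have h1 := T.continuous_modifyFiber (h := h) (K := I) (a := fun k x => σ k * a x)
    (q := fun _ => q) (F := fun _ => s)
    ((continuous_symm.comp continuous_fst).mul (ha.comp continuous_snd))
    (hq.comp continuous_snd) (fun k x => (haq x).imp_left fun h0 => by rw [h0, mul_zero])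
    (s.continuous.comp continuous_snd) (fun _ => hs) (fun _ => hs₀)
  have h2 := h1.comp
    (by fun_prop : Continuous fun p : I × (I × Circle) => (p.1, (m * p.2.1, p.2.2)))
  exact T.lift_continuousOn.comp_continuous (Continuous.prodMk (continuous_polarPoint.comp
    (by fun_prop)) h2) fun p => ⟨polarPoint_mem _,
      T.modifyFiber_mem (a := fun x => σ p.1 * a x) (q := q) hs (m * p.2.1, p.2.2)⟩

theorem DiscTrivialization.contractFiber_center {a : I → I} (ha : a 0 = 0) (q : I → I) (s : B → X)
    (m k : I) (u : Circle) : T.contractFiber h a q s m k (0, u) = h.map (q 0, u) := by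
  rw [contractFiber]
  simp only [mul_zero]
  rw [polarPoint_zero, modifyFiber, if_pos (by rw [ha, mul_zero]), T.lift_zero _ (h.map_mem _)]

/-- At the end of the contraction the scaling is zero everywhere and the base point is `b₀`, so the
section has disappeared and only `h` remains. -/
theorem DiscTrivialization.contractFiber_zero (a q : I → I) (s : B → X) (m : I) (p : I × Circle) :
    T.contractFiber h a q s m 0 p = h.map (q (m * p.1), p.2) := by
  rw [contractFiber, modifyFiber]
  simp only [zero_mul, if_true]
  rw [polarPoint_zero, T.lift_zero _ (h.map_mem _)]

theorem DiscTrivialization.contractFiber_one {a q : I → I} (haq : h.IsProfile a q) (s : B → X)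
    (m : I) (p : I × Circle) :
    T.contractFiber h a q s m 1 p = T.modify h a q s (T.disc (polarPoint (m * p.1, p.2))) := by
  rw [T.modify_disc haq, contractFiber]
  simp only [one_mul]

/-- A section modified along small profiles, restricted to a triangle in the disc, can be contracted
to a bubble. -/
theorem exists_bubble_of_small {q : I → I} (hq : IsGlueProfile q) {ε : ℝ} (hε0 : 0 < ε) {m : I}
    (hεm : ε ≤ m) {s : C(B, X)} (hs : ∀ b, π (s b) = b) (hs₀ : s b₀ = h.top)
    {a₀ b₁ : C(stdSimplex ℝ (Fin 3), X)}
    (ha₀ : ∀ t, T.contractFiber h (smallScale ε) (smallProfile q ε) s m 1 (trianglePolar t) = a₀ t)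
    (hb₁ : ∀ t, T.contractFiber h (smallScale ε) (fun _ => 1) s m 1 (trianglePolar t) = b₁ t)
    (hab₀ : ∀ t : stdSimplex ℝ (Fin 3), (∃ i, t.1 i = 0) → a₀ t = b₁ t) :
    ∃ φ : ℝ → ℝ, (Continuous fun x : I => φ x) ∧ φ 0 = 0 ∧ (∀ x, 1 / 2 ≤ x → 1 / 2 ≤ φ x) ∧
    ∃ (a b : C(stdSimplex ℝ (Fin 3), X))
      (hab : ∀ t : stdSimplex ℝ (Fin 3), (∃ i, t.1 i = 0) → a t = b t),
      (∀ t, bubble h q φ (trianglePolar t) = a t) ∧ (∀ t, b t = h.top) ∧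
      (DoubleTriangle.glue a₀ b₁ hab₀).Homotopic (DoubleTriangle.glue a b hab) := by
  have hm0 : 0 < (m : ℝ) := lt_of_lt_of_le hε0 hεm
  -- At the end of the contraction, radius `x` in the triangle shows `h` at the small profile of `m
  -- * x`, which is `q` at `m * x / ε`.
  obtain ⟨φ, hφm⟩ : ∃ φ : ℝ → ℝ, φ = fun x => m * x / ε := ⟨_, rfl⟩
  have hφ0 : φ 0 = 0 := by simp [hφm]
  have hφ : ∀ x, 1 / 2 ≤ x → 1 / 2 ≤ φ x := by
    intro x hx
    rw [hφm]
    refine hx.trans ((le_div_iff₀ hε0).2 ?_)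
    rw [mul_comm]
    exact mul_le_mul_of_nonneg_right hεm (by linarith)
  have hφc : Continuous φ := by rw [hφm]; fun_prop
  have hbc := continuous_bubble_trianglePolar (h := h) hq hφc hφ0
  obtain ⟨a, ha⟩ : ∃ a : C(stdSimplex ℝ (Fin 3), X), ∀ t, bubble h q φ (trianglePolar t) = a t :=
    ⟨⟨fun t => bubble h q φ (trianglePolar t), hbc⟩, fun t => rfl⟩
  obtain ⟨b, hb⟩ : ∃ b : C(stdSimplex ℝ (Fin 3), X), ∀ t, b t = h.top :=
    ⟨ContinuousMap.const _ h.top, fun t => rfl⟩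
  have hab : ∀ t : stdSimplex ℝ (Fin 3), (∃ i, t.1 i = 0) → a t = b t := fun t ht => by
    rw [← ha, hb]
    exact bubble_top hq (hφ _ (half_le_trianglePolar ht))
  refine ⟨φ, hφc.comp continuous_subtype_val, hφ0, hφ, a, b, hab, ha, hb, ?_⟩
  have hac : Continuous (smallScale ε) := continuous_smallScale continuous_const continuous_id
  have hqc : Continuous (smallProfile q ε) :=
    continuous_smallProfile hq.continuous continuous_const (fun _ => hε0.ne') continuous_id
  refine DoubleTriangle.glue_homotopic_polar
    (E := fun k => T.contractFiber h (smallScale ε) (smallProfile q ε) s m (σ k))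
    (E' := fun k => T.contractFiber h (smallScale ε) (fun _ => 1) s m (σ k))
    (DiscTrivialization.continuous_contractFiber hac hqc (smallScale_zero_or_one hq hε0) hs hs₀ m)
    (DiscTrivialization.continuous_contractFiber hac continuous_const (fun _ => Or.inr rfl) hs
      hs₀ m)
    (fun k u u' => ?_) (fun k u u' => ?_) (fun k p hp => ?_) hab₀ hab
    (fun t => ?_) (fun t => ?_) (fun t => ?_) (fun t => ?_)
  · rw [DiscTrivialization.contractFiber_center (smallScale_zero hε0),
      DiscTrivialization.contractFiber_center (smallScale_zero hε0), smallProfile_zero hq,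
      h.map_zero, h.map_zero]
  · rw [DiscTrivialization.contractFiber_center (smallScale_zero hε0),
      DiscTrivialization.contractFiber_center (smallScale_zero hε0), h.map_one, h.map_one]
  · have hmp : ε / 2 ≤ ((m * p.1 : I) : ℝ) := by
      rw [Icc.coe_mul]
      nlinarith
    simp only [DiscTrivialization.contractFiber, DiscTrivialization.modifyFiber,
      smallProfile_eq_one hq hε0 hmp]
  · rw [symm_zero, ha₀]
  · rw [symm_zero, hb₁]
  · rw [symm_one, DiscTrivialization.contractFiber_zero, ← ha, bubble, smallProfile, Icc.coe_mul,
      hφm]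
  · rw [symm_one, DiscTrivialization.contractFiber_zero, h.map_one, hb]

/-- Gluing a sphere changes the class of a section by the class of a bubble. -/
theorem exists_bubble_of_modify [T2Space B] (hT : IsOpen (T.disc '' Metric.ball 0 1)) {ρ : ℝ}
    (hρ : T.IsChartDisc ρ) {q : I → I} (hq : IsGlueProfile q) {s s' : C(B, X)}
    (hs : ∀ b, π (s b) = b) (hs₀ : s b₀ = h.top) (hss' : ⇑s' = T.modify h glueScale q s)
    {μ : H₂ B} (hμ : IsFundamentalClass μ) :
    ∃ φ : ℝ → ℝ, (Continuous fun x : I => φ x) ∧ φ 0 = 0 ∧ (∀ x, 1 / 2 ≤ x → 1 / 2 ≤ φ x) ∧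
    ∃ (a b : C(stdSimplex ℝ (Fin 3), X))
      (hab : ∀ t : stdSimplex ℝ (Fin 3), (∃ i, t.1 i = 0) → a t = b t),
      (∀ t, bubble h q φ (trianglePolar t) = a t) ∧ (∀ t, b t = h.top) ∧
      H₂Map s' μ - H₂Map s μ = H₂Map (DoubleTriangle.glue a b hab) DoubleTriangle.fundClass := by
  obtain ⟨r, τ, hr, hτ, U, hU, hdiff⟩ := hμ.exists_triangle b₀
  obtain ⟨hρ0, hdisc⟩ := hρ
  obtain ⟨δ, hδ, hδU⟩ : ∃ δ > 0, ∀ w : ℂ, ‖w‖ < δ → T.disc w ∈ U := by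
    have hc : ContinuousAt T.disc 0 := (T.disc_holomorphic 0 (by simp)).continuousAt
    have : T.disc ⁻¹' U ∈ 𝓝 (0 : ℂ) := hc (by rwa [T.disc_zero])
    obtain ⟨δ, hδ, h⟩ := Metric.mem_nhds_iff.1 this
    exact ⟨δ, hδ, fun w hw => h (by simpa using hw)⟩
  -- The triangle of size `r` need not fit into the disc of radius `ρ`. It is shrunk by the factor
  -- `l` so that it does, and `m` is the resulting size in the parameter of the disc.
  obtain ⟨l, m, hm0, hml⟩ : ∃ l m : I, 0 < (m : ℝ) ∧ (m : ℝ) = r / ρ * l := by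
    have hl : r / ρ * min 1 (ρ / r) ≤ 1 :=
      calc r / ρ * min 1 (ρ / r) ≤ r / ρ * (ρ / r) :=
            mul_le_mul_of_nonneg_left (min_le_right _ _) (by positivity)
        _ = 1 := by field_simp
    have hl0 : 0 < r / ρ * min 1 (ρ / r) := by positivity
    exact ⟨⟨min 1 (ρ / r), by positivity, min_le_left _ _⟩, ⟨_, hl0.le, hl⟩, hl0, rfl⟩
  -- The bound by `m` keeps the difference of the two modifications inside the shrunken triangle,
  -- and the bound by `δ` keeps it inside `U`.
  obtain ⟨ε, hε0, hεm, hεδ⟩ : ∃ ε : ℝ, 0 < ε ∧ ε ≤ m ∧ ε ≤ δ :=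
    ⟨min m δ, lt_min hm0 hδ, min_le_left _ _, min_le_right _ _⟩
  have hε1 : ε ≤ 1 := hεm.trans m.2.2
  have haq₁ := hq.isProfile_small h hε0 hε1
  have haq₂ := h.isProfile_one (smallScale_zero hε0) (smallScale_one hε1)
  -- The maps `g₁` and `g₂` use the same scaling, with and without the sphere. They can differ only
  -- at radius less than `ε / 2`, and they are homotopic to `s'` and `s` respectively.
  obtain ⟨g₁, hg₁⟩ : ∃ g : C(B, X), ⇑g = T.modify h (smallScale ε) (smallProfile q ε) s :=
    ⟨T.modifyMap hT (continuous_smallScale continuous_const continuous_id)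
      (continuous_smallProfile hq.continuous continuous_const (fun _ => hε0.ne') continuous_id)
      haq₁ s hs hs₀, rfl⟩
  obtain ⟨g₂, hg₂⟩ : ∃ g : C(B, X), ⇑g = T.modify h (smallScale ε) (fun _ => 1) s :=
    ⟨T.modifyMap hT (continuous_smallScale continuous_const continuous_id) continuous_const
      haq₂ s hs hs₀, rfl⟩
  have hagree : ∀ b, (∀ w ∈ Metric.closedBall (0 : ℂ) 1, T.disc w = b → ε / 2 ≤ ‖w‖) →
      g₁ b = g₂ b := by
    intro b hb
    rw [hg₁, hg₂]
    by_cases hbd : b ∈ T.disc '' Metric.closedBall 0 1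
    · obtain ⟨w, hw, rfl⟩ := hbd
      have hw' := hb w hw rfl
      obtain ⟨p, rfl⟩ := exists_polarPoint hw
      rw [norm_polarPoint] at hw'
      rw [T.modify_disc haq₁, T.modify_disc haq₂, DiscTrivialization.modifyFiber,
        DiscTrivialization.modifyFiber, smallProfile_eq_one hq hε0 hw']
    · rw [T.modify_of_notMem s hbd, T.modify_of_notMem s hbd]
  have hoff : ∀ b ∉ U, g₁ b = g₂ b := by
    intro b hb
    refine hagree b fun w _ hwb => ?_
    by_contra hlt
    exact hb (hwb ▸ hδU w (by linarith))
  have hτc : ∀ (c : I) (t : stdSimplex ℝ (Fin 3)), τ (triangleShrink c t) ∈ (chartAt ℂ b₀).source ∧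
      chartAt ℂ b₀ (τ (triangleShrink c t)) =
        chartAt ℂ b₀ b₀ + r * ((c : ℝ) * trianglePoint t) := by
    intro c t
    rw [← trianglePoint_shrink]
    exact hτ _
  -- Down to the factor `l` the edges stay at radius at least `m / 2` in the disc, or outside the
  -- disc where the condition is empty; so the triangle can be shrunk without its edges meeting the
  -- region where the maps differ.
  have hshrink : ∀ c : I, l ≤ c → ∀ t : stdSimplex ℝ (Fin 3), (∃ i, t.1 i = 0) →
      g₁ (τ (triangleShrink c t)) = g₂ (τ (triangleShrink c t)) := by
    intro c hc t ht
    refine hagree _ fun w hw hwt => ?_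
    have h1 := (hτc c t).2
    rw [← hwt, (hdisc w hw).2] at h1
    have h2 := congrArg norm (add_left_cancel h1)
    rw [norm_mul, norm_mul, norm_mul, Complex.norm_real, Complex.norm_real, Complex.norm_real,
      Real.norm_of_nonneg hρ0.le, Real.norm_of_nonneg hr.le, Real.norm_of_nonneg c.2.1] at h2
    have h3 : ‖w‖ = r / ρ * c * ‖trianglePoint t‖ := by
      field_simp
      linarith
    have h4 : (m : ℝ) ≤ r / ρ * c := by
      rw [hml]
      exact mul_le_mul_of_nonneg_left hc (by positivity)
    rw [h3]
    nlinarith [half_le_norm_trianglePoint ht]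
  have hshrunk : ∀ t, τ (triangleShrink l t) =
      T.disc (polarPoint (m * (trianglePolar t).1, (trianglePolar t).2)) := by
    intro t
    have hmem := polarPoint_mem (m * (trianglePolar t).1, (trianglePolar t).2)
    refine (chartAt ℂ b₀).injOn (hτc l t).1 (hdisc _ hmem).1 ?_
    rw [(hτc l t).2, (hdisc _ hmem).2, ← polarPoint_trianglePolar, polarPoint, polarPoint]
    congr 1
    have hρ' : (ρ : ℂ) ≠ 0 := by exact_mod_cast hρ0.ne'
    simp only [Icc.coe_mul, hml]
    push_cast
    field_simp
  have hcl : Continuous (triangleShrink l) :=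
    continuous_triangleShrink.comp (by fun_prop : Continuous fun t => (l, t))
  obtain ⟨τ', hτ'⟩ : ∃ τ' : C(stdSimplex ℝ (Fin 3), B), ∀ t, τ' t = τ (triangleShrink l t) :=
    ⟨τ.comp ⟨triangleShrink l, hcl⟩, fun t => rfl⟩
  have hab₁ : ∀ t : stdSimplex ℝ (Fin 3), (∃ i, t.1 i = 0) → g₁.comp τ t = g₂.comp τ t := by
    intro t ht
    have := hshrink 1 l.2.2 t ht
    rwa [triangleShrink_one] at this
  have hab₂ : ∀ t : stdSimplex ℝ (Fin 3), (∃ i, t.1 i = 0) → g₁.comp τ' t = g₂.comp τ' t := by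
    intro t ht
    rw [ContinuousMap.comp_apply, ContinuousMap.comp_apply, hτ']
    exact hshrink l le_rfl t ht
  have hH : (DoubleTriangle.glue (g₁.comp τ) (g₂.comp τ) hab₁).Homotopic
      (DoubleTriangle.glue (g₁.comp τ') (g₂.comp τ') hab₂) := by
    have hc : Continuous fun p : I × stdSimplex ℝ (Fin 3) =>
        τ (triangleShrink (mixI p.1 1 l) p.2) :=
      τ.continuous.comp (continuous_triangleShrink.comp
        ((continuous_mixI continuous_fst continuous_const continuous_const).prodMk continuous_snd))
    refine DoubleTriangle.glue_homotopic (a := fun k t => g₁ (τ (triangleShrink (mixI k 1 l) t)))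
      (b := fun k t => g₂ (τ (triangleShrink (mixI k 1 l) t))) (g₁.continuous.comp hc)
      (g₂.continuous.comp hc) (fun k t ht => hshrink _ ?_ t ht) hab₁ hab₂ (fun t => ?_)
      (fun t => ?_) (fun t => ?_) fun t => ?_
    · change (l : ℝ) ≤ (1 - k) * (1 : ℝ) + k * l
      have := k.2.2; have := l.2.2
      nlinarith
    · simp only [mixI_zero, triangleShrink_one, ContinuousMap.comp_apply]
    · simp only [mixI_zero, triangleShrink_one, ContinuousMap.comp_apply]
    · simp only [mixI_one, ContinuousMap.comp_apply, hτ']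
    · simp only [mixI_one, ContinuousMap.comp_apply, hτ']
  obtain ⟨φ, hφc, hφ0, hφ, a, b, hab, ha, hb, hH'⟩ := exists_bubble_of_small (T := T) hq hε0 hεm hs
    hs₀ (a₀ := g₁.comp τ') (b₁ := g₂.comp τ')
    (fun t => by
      rw [DiscTrivialization.contractFiber_one haq₁, ContinuousMap.comp_apply, hτ', hshrunk, hg₁])
    (fun t => by
      rw [DiscTrivialization.contractFiber_one haq₂, ContinuousMap.comp_apply, hτ', hshrunk, hg₂])
    hab₂
  refine ⟨φ, hφc, hφ0, hφ, a, b, hab, ha, hb, ?_⟩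
  rw [H₂Map_eq_of_homotopic (T.homotopic_small hT hq hε0 hε1 hs hs₀ hss' hg₁),
    ← H₂Map_eq_of_homotopic (T.homotopic_smallScale hT hε0 hε1 hs hs₀ hg₂),
    hdiff X g₁ g₂ hoff hab₁, H₂Map_eq_of_homotopic (hH.trans hH')]

/-- Gluing the sphere `f` adds the class of `f` to the class of a section. -/
theorem H₂Map_modify_sphere [T2Space B] (hT : IsOpen (T.disc '' Metric.ball 0 1)) {ρ : ℝ}
    (hρ : T.IsChartDisc ρ) {q : I → I} (hq : IsGlueProfile q) (f : C(OnePoint ℂ, X))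
    (hf : ∀ p, π (f p) = b₀) {s s' : C(B, X)} (hs : ∀ b, π (s b) = b)
    (hs₀ : s b₀ = (FiberSphere.ofMap f hf).top)
    (hss' : ⇑s' = T.modify (FiberSphere.ofMap f hf) glueScale q s)
    {μ : H₂ B} (hμ : IsFundamentalClass μ) {ν : H₂ (OnePoint ℂ)} (hν : IsFundamentalClass ν) :
    H₂Map s' μ = H₂Map s μ + H₂Map f ν := by
  obtain ⟨φ₀, hc₀, hz₀, ht₀, a₀, b, hab₀, ha₀, hb, h₀⟩ :=
    exists_bubble_of_modify hT hρ hq hs hs₀ hss' hμ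
  obtain ⟨φ₁, hc₁, hz₁, ht₁, a₁, b', hab₁, ha₁, hb', h₁⟩ :=
    exists_bubble_of_sphere f hf hν hq
  obtain rfl : b = b' := ContinuousMap.ext fun t => (hb t).trans (hb' t).symm
  rw [← sub_eq_iff_eq_add', h₀, h₁, H₂Map_eq_of_homotopic
    (glue_bubble_homotopic hq hc₀ hc₁ hz₀ hz₁ ht₀ ht₁ hab₀ hab₁ ha₀ ha₁ hb)]

end SphereClass

/-! ## Trivializations over a disc -/

section RestrictScalars

variable {E E' M M' : Type*} [NormedAddCommGroup E] [NormedSpace ℂ E]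
  [NormedAddCommGroup E'] [NormedSpace ℂ E']
  [TopologicalSpace M] [ChartedSpace E M] [TopologicalSpace M'] [ChartedSpace E' M']

/-- A complex manifold is a real manifold. -/
theorem isManifold_real_of_complex [NormedSpace ℝ E] [IsScalarTower ℝ ℂ E] {k : ℕ∞ω}
    [IsManifold 𝓘(ℂ, E) k M] : IsManifold 𝓘(ℝ, E) k M := by
  refine isManifold_of_contDiffOn _ _ _ fun e e' he he' => ?_
  have h := StructureGroupoid.compatible (contDiffGroupoid k 𝓘(ℂ, E)) he he'
  rw [contDiffGroupoid, mem_groupoid_of_pregroupoid] at h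
  exact ContDiffOn.restrict_scalars ℝ h.1

/-- A map of class `C^k` in the complex sense is of class `C^k` in the real sense. -/
theorem ContMDiffAt.real_of_complex [NormedSpace ℝ E] [IsScalarTower ℝ ℂ E] [NormedSpace ℝ E']
    [IsScalarTower ℝ ℂ E'] {k : ℕ∞ω} {f : M → M'} {x : M}
    (hf : ContMDiffAt 𝓘(ℂ, E) 𝓘(ℂ, E') k f x) : ContMDiffAt 𝓘(ℝ, E) 𝓘(ℝ, E') k f x := by
  rw [contMDiffAt_iff] at hf ⊢
  refine ⟨hf.1, ?_⟩
  have h := hf.2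
  simp only [mfld_simps] at h ⊢
  exact h.restrict_scalars ℝ

end RestrictScalars

/-- Straightening of a submersion between normed spaces. -/
theorem exists_straightening {E : Type*} [NormedAddCommGroup E] [NormedSpace ℂ E]
    [FiniteDimensional ℂ E] {φ : E → ℂ} {a : E} (hφ : ContDiffAt ℂ 1 φ a)
    (hs : Function.Surjective (fderiv ℂ φ a)) :
    ∃ (G : Submodule ℂ E) (e : OpenPartialHomeomorph E (ℂ × G)), a ∈ e.source ∧
      (∀ p, (e p).1 = φ p) ∧ ContDiffAt ℂ 1 e a ∧ ContDiffAt ℂ 1 e.symm (e a) := by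
  have : CompleteSpace E := FiniteDimensional.complete ℂ E
  set f' := fderiv ℂ φ a
  -- A projection onto the kernel of the derivative supplies the remaining coordinates: the
  -- derivative of `(φ, P)` is then bijective and the inverse function theorem applies.
  obtain ⟨P, hP⟩ := f'.ker_closedComplemented_of_finiteDimensional_range
  set L : E →L[ℂ] ℂ × f'.ker := f'.prod P
  have hker : L.ker = ⊥ := by
    rw [LinearMap.ker_eq_bot']
    intro v hv
    have h1 : f' v = 0 := congrArg Prod.fst hv
    have h2 : P v = 0 := congrArg Prod.snd hv
    have h3 := hP ⟨v, h1⟩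
    rw [h2] at h3
    exact (congrArg Subtype.val h3).symm
  have hrange : L.range = ⊤ := by
    rw [LinearMap.range_eq_top]
    rintro ⟨c, k⟩
    obtain ⟨v, hv⟩ := hs c
    refine ⟨v + ((k - P v : f'.ker) : E), ?_⟩
    refine Prod.ext ?_ ?_
    · have : f' ((k - P v : f'.ker) : E) = 0 := (k - P v).2
      change f' (v + ((k - P v : f'.ker) : E)) = c
      rw [map_add, this, hv, add_zero]
    · change P (v + ((k - P v : f'.ker) : E)) = k
      rw [map_add, hP, add_sub_cancel]
  set L' := ContinuousLinearEquiv.ofBijective L hker hrange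
  have hL' : (L' : E →L[ℂ] ℂ × f'.ker) = L := ContinuousLinearMap.ext fun _ => rfl
  have hF : ContDiffAt ℂ 1 (fun p => (φ p, P p)) a := hφ.prodMk P.contDiff.contDiffAt
  have hF' : HasFDerivAt (fun p => (φ p, P p)) (L' : E →L[ℂ] ℂ × f'.ker) a := by
    rw [hL']
    exact ((hφ.differentiableAt one_ne_zero).hasFDerivAt).prodMk P.hasFDerivAt
  exact ⟨_, hF.toOpenPartialHomeomorph _ hF' one_ne_zero,
    hF.mem_toOpenPartialHomeomorph_source hF' one_ne_zero, fun _ => rfl, hF,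
    hF.to_localInverse hF' one_ne_zero⟩

/-- Near `y`, the map `r` is a retraction of class `C¹` of `X` onto the fibre of `π` over `b₀`. -/
structure IsFiberRetractionAt {B X : Type*} [TopologicalSpace X] (E : Type*)
    [NormedAddCommGroup E] [NormedSpace ℝ E]
    [ChartedSpace E X] (π : X → B) (b₀ : B) (r : X → X) (y : X) : Prop where
  contMDiffAt : ContMDiffAt 𝓘(ℝ, E) 𝓘(ℝ, E) 1 r y
  eventually_mem : ∀ᶠ y' in 𝓝 y, π (r y') = b₀
  eventually_eq : ∀ᶠ y' in 𝓝 y, π y' = b₀ → r y' = y'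

theorem IsFiberRetractionAt.congr {E : Type*} [NormedAddCommGroup E] [NormedSpace ℝ E]
    {B X : Type*} [TopologicalSpace X] [ChartedSpace E X] {π : X → B} {b₀ : B} {r r' : X → X} {y : X} (h : IsFiberRetractionAt E π b₀ r y)
    (hr : r' =ᶠ[𝓝 y] r) : IsFiberRetractionAt E π b₀ r' y where
  contMDiffAt := h.contMDiffAt.congr_of_eventuallyEq hr
  eventually_mem := by filter_upwards [h.eventually_mem, hr] with z h1 h2; rwa [h2]
  eventually_eq := by filter_upwards [h.eventually_eq, hr] with z h1 h2; rwa [h2]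

/-! ### Submersion charts and local retractions onto a fibre. -/

section Submersion

variable {E : Type*} [NormedAddCommGroup E] [NormedSpace ℝ E]
  {B X : Type*} [TopologicalSpace B] [ChartedSpace ℂ B]
  [TopologicalSpace X] [ChartedSpace E X]

/-- Coordinates on an open subset of `X`, of class `C¹` together with their inverse, in which `π` is
the first projection. -/
structure IsSubmersionChart {G : Type*} [NormedAddCommGroup G] [NormedSpace ℝ G] (π : X → B) (b₀ : B)
    (e : OpenPartialHomeomorph X (ℂ × G)) : Prop where
  mem : ∀ y ∈ e.source, π y ∈ (chartAt ℂ b₀).source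
  fst : ∀ y ∈ e.source, (e y).1 = chartAt ℂ b₀ (π y)
  contMDiffAt : ∀ y ∈ e.source, ContMDiffAt 𝓘(ℝ, E) 𝓘(ℝ, ℂ × G) 1 e y
  contMDiffAt_symm : ∀ y ∈ e.source, ContMDiffAt 𝓘(ℝ, ℂ × G) 𝓘(ℝ, E) 1 e.symm (e y)

variable {π : X → B} {b₀ : B}

variable {G : Type*} [NormedAddCommGroup G] [NormedSpace ℝ G]
  {e : OpenPartialHomeomorph X (ℂ × G)}

theorem IsSubmersionChart.contMDiffAt_snd (he : IsSubmersionChart (E := E) π b₀ e) {y : X}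
    (hy : y ∈ e.source) : ContMDiffAt 𝓘(ℝ, E) 𝓘(ℝ, G) 1 (fun z => (e z).2) y :=
  ((ContinuousLinearMap.snd ℝ ℂ G).contMDiff.contMDiffAt).comp y (he.contMDiffAt y hy)

theorem IsSubmersionChart.fst_eq (he : IsSubmersionChart (E := E) π b₀ e) {y : X}
    (hy : y ∈ e.source) (hy₀ : π y = b₀) : (e y).1 = chartAt ℂ b₀ b₀ := by
  rw [he.fst y hy, hy₀]

theorem IsSubmersionChart.proj_symm (he : IsSubmersionChart (E := E) π b₀ e) {p : ℂ × G} {b : B}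
    (hp : p ∈ e.target) (hb : b ∈ (chartAt ℂ b₀).source) (hpb : p.1 = chartAt ℂ b₀ b) :
    π (e.symm p) = b := by
  refine (chartAt ℂ b₀).injOn (he.mem _ (e.map_target hp)) hb ?_
  rw [← he.fst _ (e.map_target hp), e.right_inv hp, hpb]

/-- A retraction onto the fibre prescribed by its fibre coordinate in a submersion chart. -/
theorem IsSubmersionChart.isFiberRetractionAt (he : IsSubmersionChart (E := E) π b₀ e) {y : X}
    (hy : y ∈ e.source) (hy₀ : π y = b₀) {g : X → G} (hg : ContMDiffAt 𝓘(ℝ, E) 𝓘(ℝ, G) 1 g y)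
    (hge : ∀ᶠ y' in 𝓝 y, π y' = b₀ → g y' = (e y').2) :
    IsFiberRetractionAt E π b₀ (fun y' => e.symm (chartAt ℂ b₀ b₀, g y')) y := by
  have hey : (chartAt ℂ b₀ b₀, g y) = e y :=
    Prod.ext (he.fst_eq hy hy₀).symm (hge.self_of_nhds hy₀)
  have hpair : ContMDiffAt 𝓘(ℝ, E) 𝓘(ℝ, ℂ × G) 1 (fun y' => (chartAt ℂ b₀ b₀, g y')) y :=
    contMDiffAt_const.prodMk_space hg
  refine ⟨?_, ?_, ?_⟩
  · have h1 := he.contMDiffAt_symm y hy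
    rw [← hey] at h1
    exact h1.comp y hpair
  · have h1 : ∀ᶠ y' in 𝓝 y, (chartAt ℂ b₀ b₀, g y') ∈ e.target := by
      refine hpair.continuousAt.eventually (e.open_target.mem_nhds ?_)
      change (chartAt ℂ b₀ b₀, g y) ∈ _
      rw [hey]
      exact e.map_source hy
    filter_upwards [h1] with y' hy'
    exact he.proj_symm hy' (mem_chart_source ℂ b₀) rfl
  · filter_upwards [hge, e.open_source.mem_nhds hy] with y' h1 h2 h3
    rw [h1 h3, ← he.fst_eq h2 h3]
    exact e.left_inv h2

/-- Near every point of the fibre, local retractions can be modified so as to become a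
retraction there, without spoiling them elsewhere. -/
theorem IsSubmersionChart.exists_patch [FiniteDimensional ℝ E] [T2Space X]
    [IsManifold 𝓘(ℝ, E) ∞ X] (he : IsSubmersionChart (E := E) π b₀ e) {x : X}
    (hx : x ∈ e.source) :
    ∃ N ∈ 𝓝 x, ∀ r : X → X, ∃ r' : X → X,
      (∀ y ∈ N, π y = b₀ → IsFiberRetractionAt E π b₀ r' y) ∧
      ∀ y, π y = b₀ → IsFiberRetractionAt E π b₀ r y → IsFiberRetractionAt E π b₀ r' y := by
  have hbasis : (𝓝 x).HasBasis (fun _ : SmoothBumpFunction 𝓘(ℝ, E) x => True)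
    fun f => tsupport f := SmoothBumpFunction.nhds_basis_tsupport x
  obtain ⟨χ, -, hχ⟩ := hbasis.mem_iff.1 (e.open_source.mem_nhds hx)
  have hχd : ∀ y, ContMDiffAt 𝓘(ℝ, E) 𝓘(ℝ) 1 χ y := fun y =>
    χ.contMDiffAt.of_le (by exact_mod_cast le_top)
  refine ⟨{y | ∀ᶠ y' in 𝓝 y, χ y' = 1}, χ.eventuallyEq_one.eventually_nhds, fun r => ?_⟩
  classical
  -- In the chart the fibre coordinates lie in a vector space, so those of `r y` and of `y` can be
  -- interpolated. On the fibre they coincide wherever `r` is the identity.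
  set g : X → G := fun y => (1 - χ y) • (e (r y)).2 + χ y • (e y).2
  set r' : X → X := fun y =>
    if y ∈ tsupport χ then e.symm (chartAt ℂ b₀ b₀, g y) else r y
  refine ⟨r', fun y hy hy₀ => ?_, fun y hy₀ hr => ?_⟩
  · have hys : ∀ᶠ y' in 𝓝 y, y' ∈ tsupport χ := by
      filter_upwards [hy] with y' hy'
      exact subset_tsupport _ (by simp [hy'])
    have hgy : g =ᶠ[𝓝 y] fun y' => (e y').2 := by
      filter_upwards [hy] with y' hy'
      simp [g, hy']
    have hmem := hχ hys.self_of_nhds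
    refine (he.isFiberRetractionAt hmem hy₀
      ((he.contMDiffAt_snd hmem).congr_of_eventuallyEq hgy)
      (hgy.mono fun y' h _ => h)).congr ?_
    filter_upwards [hys] with y' hy'
    simp [r', hy']
  · by_cases hys : y ∈ tsupport χ
    · have hmem := hχ hys
      have hry : r y = y := hr.eventually_eq.self_of_nhds hy₀
      have hrs : ∀ᶠ y' in 𝓝 y, r y' ∈ e.source := by
        refine hr.contMDiffAt.continuousAt.eventually (e.open_source.mem_nhds ?_)
        rwa [hry]
      have hd : ContMDiffAt 𝓘(ℝ, E) 𝓘(ℝ, G) 1 (fun y' => (e (r y')).2) y := by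
        have h1 : ContMDiffAt 𝓘(ℝ, E) 𝓘(ℝ, G) 1 (fun z => (e z).2) (r y) := by
          rw [hry]
          exact he.contMDiffAt_snd hmem
        exact h1.comp y hr.contMDiffAt
      have hg : ContMDiffAt 𝓘(ℝ, E) 𝓘(ℝ, G) 1 g y :=
        ((contMDiffAt_const.sub (hχd y)).smul hd).add ((hχd y).smul (he.contMDiffAt_snd hmem))
      refine (he.isFiberRetractionAt hmem hy₀ hg ?_).congr ?_
      · filter_upwards [hr.eventually_eq] with y' h1 h2
        simp only [g, h1 h2]
        rw [← add_smul, sub_add_cancel, one_smul]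
      -- Off the support of `χ` the chart formula returns `r y'`, because `r y'` lies in the fibre.
      -- Both branches of `r'` are thus given near `y` by the same formula, which is of class `C¹`
      -- at `y`.
      · filter_upwards [hrs, hr.eventually_mem] with y' h1 h2
        by_cases hy' : y' ∈ tsupport χ
        · simp [r', hy']
        · have h3 : χ y' = 0 := image_eq_zero_of_notMem_tsupport hy'
          simp only [r', hy', if_false, g, h3, sub_zero, one_smul, zero_smul, add_zero]
          rw [← he.fst_eq h1 h2]
          exact (e.left_inv h1).symm
    · refine hr.congr ?_
      filter_upwards [(isClosed_tsupport χ).isOpen_compl.mem_nhds hys] with y' hy'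
      exact if_neg hy'

/-- In a submersion chart, `(π, r)` is a local homeomorphism along the fibre. -/
theorem IsFiberRetractionAt.exists_localEquiv [FiniteDimensional ℝ G]
    (he : IsSubmersionChart (E := E) π b₀ e)
    {r : X → X} {y : X} (hy : y ∈ e.source) (hy₀ : π y = b₀)
    (hr : IsFiberRetractionAt E π b₀ r y) :
    ∃ H : OpenPartialHomeomorph (ℂ × G) (ℂ × G), e y ∈ H.source ∧ H (e y) = e y ∧
      ∀ p, H p = (p.1, (e (r (e.symm p))).2) := by
  have hry : r y = y := hr.eventually_eq.self_of_nhds hy₀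
  set h : ℂ × G → G := fun p => (e (r (e.symm p))).2
  have hys : e.symm (e y) = y := e.left_inv hy
  have hh : ContDiffAt ℝ 1 h (e y) := by
    rw [← contMDiffAt_iff_contDiffAt]
    have h1 : ContMDiffAt 𝓘(ℝ, E) 𝓘(ℝ, G) 1 (fun z => (e z).2) (r (e.symm (e y))) := by
      rw [hys, hry]
      exact he.contMDiffAt_snd hy
    have h2 : ContMDiffAt 𝓘(ℝ, E) 𝓘(ℝ, E) 1 r (e.symm (e y)) := by
      rw [hys]
      exact hr.contMDiffAt
    exact (h1.comp (e.symm (e y)) h2).comp (e y) (he.contMDiffAt_symm y hy)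
  have hhy : h (e y) = (e y).2 := by simp only [h, hys, hry]
  set D := fderiv ℝ h (e y)
  have hD : HasFDerivAt h D (e y) := (hh.differentiableAt one_ne_zero).hasFDerivAt
  -- The retraction fixes the fibre, so along the fibre through `e y` the function `h` is the second
  -- coordinate, and its derivative in these directions is the identity.
  have hDinr : ∀ v, D (0, v) = v := by
    have h1 : HasFDerivAt (fun g : G => h ((e y).1, g))
        (D.comp (ContinuousLinearMap.inr ℝ ℂ G)) (e y).2 :=
      HasFDerivAt.comp (e y).2 (f := fun g : G => ((e y).1, g)) hD
        (hasFDerivAt_prodMk_right (e y).1 (e y).2)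
    have hc : ContinuousAt (fun g : G => ((e y).1, g)) (e y).2 := by fun_prop
    have h2 : (fun g : G => h ((e y).1, g)) =ᶠ[𝓝 (e y).2] id := by
      have h3 : ∀ᶠ p in 𝓝 (e y), p ∈ e.target ∧
          (π (e.symm p) = b₀ → r (e.symm p) = e.symm p) := by
        refine Eventually.and (e.open_target.mem_nhds (e.map_source hy)) ?_
        have := (e.continuousAt_symm (e.map_source hy)).tendsto
        rw [hys] at this
        exact this.eventually hr.eventually_eq
      filter_upwards [hc.eventually h3] with g hg
      have h4 : π (e.symm ((e y).1, g)) = b₀ :=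
        he.proj_symm hg.1 (mem_chart_source ℂ b₀) (he.fst_eq hy hy₀)
      simp only [h, hg.2 h4, e.right_inv hg.1, id]
    have h5 := (h1.congr_of_eventuallyEq h2.symm).unique (hasFDerivAt_id (e y).2)
    intro v
    simpa using congrArg (fun T : G →L[ℝ] G => T v) h5
  -- The derivative of `(π, r)` in the chart is triangular with identities on the diagonal, hence
  -- invertible.
  set L := (ContinuousLinearEquiv.refl ℝ ℂ).skewProd (ContinuousLinearEquiv.refl ℝ G)
    (D.comp (ContinuousLinearMap.inl ℝ ℂ G))
  have hL : HasFDerivAt (fun p : ℂ × G => (p.1, h p)) (L : ℂ × G →L[ℝ] ℂ × G) (e y) := by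
    have h1 : HasFDerivAt (fun p : ℂ × G => (p.1, h p))
      ((ContinuousLinearMap.fst ℝ ℂ G).prod D) (e y) := hasFDerivAt_fst.prodMk hD
    convert h1 using 1
    refine ContinuousLinearMap.ext fun v => ?_
    refine Prod.ext rfl ?_
    have h2 : D v = D (v.1, 0) + D (0, v.2) := by
      rw [← map_add]
      simp
    change v.2 + D (v.1, 0) = D v
    rw [h2, hDinr, add_comm]
  have : CompleteSpace G := FiniteDimensional.complete ℝ G
  have hC : ContDiffAt ℝ 1 (fun p : ℂ × G => (p.1, h p)) (e y) := contDiffAt_fst.prodMk hh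
  exact ⟨hC.toOpenPartialHomeomorph _ hL one_ne_zero,
    hC.mem_toOpenPartialHomeomorph_source hL one_ne_zero,
    Prod.ext rfl hhy, fun _ => rfl⟩

theorem IsFiberRetractionAt.exists_injOn [FiniteDimensional ℝ G]
    (he : IsSubmersionChart (E := E) π b₀ e)
    {r : X → X} {y : X} (hy : y ∈ e.source) (hy₀ : π y = b₀)
    (hr : IsFiberRetractionAt E π b₀ r y) :
    ∃ u ∈ 𝓝 y, InjOn (fun y' => (π y', r y')) u := by
  obtain ⟨H, hH, -, hHe⟩ := hr.exists_localEquiv he hy hy₀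
  refine ⟨e.source ∩ e ⁻¹' H.source, (e.isOpen_inter_preimage H.open_source).mem_nhds ⟨hy, hH⟩, ?_⟩
  rintro y₁ ⟨h₁, h₁'⟩ y₂ ⟨h₂, h₂'⟩ h
  refine e.injOn h₁ h₂ (H.injOn h₁' h₂' ?_)
  rw [hHe, hHe, e.left_inv h₁, e.left_inv h₂, he.fst _ h₁, he.fst _ h₂]
  rw [Prod.mk.injEq] at h
  rw [h.1, h.2]

/-- The local inverse of `(π, r)` solves the equations near `(b₀, y)`, jointly in both variables;
over the compact fibre this later yields a single neighbourhood of `b₀`. -/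
theorem IsFiberRetractionAt.eventually_exists [FiniteDimensional ℝ G]
    (he : IsSubmersionChart (E := E) π b₀ e)
    {r : X → X} {y : X} (hy : y ∈ e.source) (hy₀ : π y = b₀)
    (hr : IsFiberRetractionAt E π b₀ r y) :
    ∀ᶠ z : B × X in 𝓝 (b₀, y), π z.2 = b₀ → ∃ x, π x = z.1 ∧ r x = z.2 := by
  obtain ⟨H, hH, hHy, hHe⟩ := hr.exists_localEquiv he hy hy₀
  have hry : r y = y := hr.eventually_eq.self_of_nhds hy₀
  have hys : e.symm (e y) = y := e.left_inv hy
  have hHy' : H.symm (e y) = e y := by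
    have := H.left_inv hH
    rwa [hHy] at this
  have hHt : e y ∈ H.target := by
    have := H.map_source hH
    rwa [hHy] at this
  have hey : (chartAt ℂ b₀ b₀, (e y).2) = e y := Prod.ext (he.fst_eq hy hy₀).symm rfl
  have hpt : Tendsto (fun z : B × X => (chartAt ℂ b₀ z.1, (e z.2).2)) (𝓝 (b₀, y)) (𝓝 (e y)) := by
    have h1 : ContinuousAt (chartAt ℂ b₀) b₀ :=
      (chartAt ℂ b₀).continuousAt (mem_chart_source ℂ b₀)
    have h2 : ContinuousAt (fun z => (e z).2) y := (he.contMDiffAt_snd hy).continuousAt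
    have h3 : ContinuousAt (fun z : B × X => (chartAt ℂ b₀ z.1, (e z.2).2)) (b₀, y) :=
      (ContinuousAt.comp (x := (b₀, y)) h1 continuousAt_fst).prodMk
        (ContinuousAt.comp (x := (b₀, y)) (g := fun z => (e z).2) h2 continuousAt_snd)
    have h4 := h3.tendsto
    rwa [hey] at h4
  have hsymm : Tendsto H.symm (𝓝 (e y)) (𝓝 (e y)) := by
    have := (H.continuousAt_symm hHt).tendsto
    rwa [hHy'] at this
  have hesymm : Tendsto e.symm (𝓝 (e y)) (𝓝 y) := by
    have := (e.continuousAt_symm (e.map_source hy)).tendsto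
    rwa [hys] at this
  have hrt : ∀ᶠ x in 𝓝 y, r x ∈ e.source ∧ π (r x) = b₀ := by
    refine Eventually.and ?_ hr.eventually_mem
    refine hr.contMDiffAt.continuousAt.eventually (e.open_source.mem_nhds ?_)
    rwa [hry]
  have hb : ∀ᶠ z : B × X in 𝓝 (b₀, y), z.1 ∈ (chartAt ℂ b₀).source :=
    continuousAt_fst.eventually
      ((chartAt ℂ b₀).open_source.mem_nhds (mem_chart_source ℂ b₀))
  have hy' : ∀ᶠ z : B × X in 𝓝 (b₀, y), z.2 ∈ e.source :=
    continuousAt_snd.eventually (e.open_source.mem_nhds hy)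
  filter_upwards [hb, hy', hpt.eventually (H.open_target.mem_nhds hHt),
    (hsymm.comp hpt).eventually (e.open_target.mem_nhds (e.map_source hy)),
    (hesymm.comp (hsymm.comp hpt)).eventually hrt] with z h1 h2 h3 h4 h5 h6
  set p := H.symm (chartAt ℂ b₀ z.1, (e z.2).2)
  have hHp : H p = (chartAt ℂ b₀ z.1, (e z.2).2) := H.right_inv h3
  rw [hHe, Prod.mk.injEq] at hHp
  refine ⟨e.symm p, he.proj_symm h4 h1 hHp.1, e.injOn h5.1 h2 (Prod.ext ?_ hHp.2)⟩
  rw [he.fst_eq h2 h6]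
  exact he.fst_eq h5.1 h5.2

/-- Around a point where `π` is a submersion there is a submersion chart. -/
theorem exists_isSubmersionChart [NormedSpace ℂ E] [FiniteDimensional ℂ E] [IsManifold 𝓘(ℂ) ω B]
    [IsManifold 𝓘(ℂ, E) ω X] [IsScalarTower ℝ ℂ E] {π : X → B}
    (hπ : ContMDiff 𝓘(ℂ, E) 𝓘(ℂ) ω π) {b₀ : B} {x : X} (hx : π x = b₀)
    (hs : Function.Surjective (mfderiv 𝓘(ℂ, E) 𝓘(ℂ) π x)) :
    ∃ (G : Submodule ℂ E) (e : OpenPartialHomeomorph X (ℂ × G)), x ∈ e.source ∧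
      IsSubmersionChart (E := E) (G := G) π b₀ e := by
  subst hx
  have hX : IsManifold 𝓘(ℂ, E) 1 X := IsManifold.of_le (n := ω) le_top
  have hX' : IsManifold 𝓘(ℝ, E) 1 X := isManifold_real_of_complex
  have hdiff := (hπ x).of_le (m := 1) le_top
  set c := chartAt E x
  set φ : E → ℂ := fun p => chartAt ℂ (π x) (π (c.symm p))
  have hφ : ContDiffAt ℂ 1 φ (c x) := by
    have h := (contMDiffAt_iff.1 hdiff).2
    simp only [mfld_simps] at h
    exact h.contDiffAt univ_mem
  have hφ' : Function.Surjective (fderiv ℂ φ (c x)) := by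
    have h := (hdiff.mdifferentiableAt one_ne_zero).hasMFDerivAt.2
    simp only [mfld_simps] at h
    obtain ⟨D, hD, hDs⟩ : ∃ D : E →L[ℂ] ℂ, HasFDerivWithinAt φ D univ (c x) ∧
      Function.Surjective D := ⟨mfderiv 𝓘(ℂ, E) 𝓘(ℂ) π x, h, hs⟩
    rwa [(hD.hasFDerivAt univ_mem).fderiv]
  obtain ⟨G, e₀, ha, he₀, hd, hd'⟩ := exists_straightening hφ hφ'
  set e := c.trans e₀
  have hx : x ∈ e.source := by
    rw [OpenPartialHomeomorph.trans_source]
    exact ⟨mem_chart_source E x, ha⟩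
  have hcx : ContMDiffAt 𝓘(ℂ, E) 𝓘(ℂ, ℂ × G) 1 e x := by
    have h1 : ContMDiffAt 𝓘(ℂ, E) 𝓘(ℂ, E) 1 c x :=
      contMDiffAt_of_mem_maximalAtlas (IsManifold.chart_mem_maximalAtlas x) (mem_chart_source E x)
    exact hd.contMDiffAt.comp x h1
  have hcs : ContMDiffAt 𝓘(ℂ, ℂ × G) 𝓘(ℂ, E) 1 e.symm (e x) := by
    have hcc : e₀.symm (e x) = c x := e₀.left_inv ha
    have h1 : ContMDiffAt 𝓘(ℂ, E) 𝓘(ℂ, E) 1 c.symm (e₀.symm (e x)) := by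
      rw [hcc]
      exact contMDiffAt_symm_of_mem_maximalAtlas (IsManifold.chart_mem_maximalAtlas x)
        (c.map_source (mem_chart_source E x))
    exact h1.comp (e x) hd'.contMDiffAt
  -- Being of class `C¹` at one point implies it nearby, so the chart only has to be restricted.
  have hev : ∀ᶠ y in 𝓝 x, π y ∈ (chartAt ℂ (π x)).source ∧
      ContMDiffAt 𝓘(ℝ, E) 𝓘(ℝ, ℂ × G) 1 e y ∧
      ContMDiffAt 𝓘(ℝ, ℂ × G) 𝓘(ℝ, E) 1 e.symm (e y) := by
    refine (hdiff.continuousAt.eventually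
      ((chartAt ℂ (π x)).open_source.mem_nhds (mem_chart_source ℂ (π x)))).and
      (((contMDiffAt_iff_contMDiffAt_nhds (by simp)).1 hcx.real_of_complex).and ?_)
    exact (e.continuousAt hx).eventually
      ((contMDiffAt_iff_contMDiffAt_nhds (by simp)).1 hcs.real_of_complex)
  obtain ⟨U, hU, hUo, hxU⟩ := eventually_nhds_iff.1 hev
  have hsub : ∀ y ∈ (e.restr U).source, y ∈ U := fun y hy => by
    rw [OpenPartialHomeomorph.restr_source, hUo.interior_eq] at hy
    exact hy.2
  refine ⟨G, e.restr U, ⟨hx, by rwa [hUo.interior_eq]⟩, fun y hy => (hU y (hsub y hy)).1,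
    fun y hy => ?_, fun y hy => (hU y (hsub y hy)).2.1, fun y hy => (hU y (hsub y hy)).2.2⟩
  change (e₀ (c y)).1 = _
  rw [he₀]
  change chartAt ℂ (π x) (π (c.symm (c y))) = _
  rw [c.left_inv hy.1.1]

end Submersion

/-! ### Triviality of the family over a small disc. -/

section Trivialization

variable {n : ℕ} {B X : Type} [TopologicalSpace B] [ChartedSpace ℂ B] [IsManifold 𝓘(ℂ) ω B]
  [T2Space B] [TopologicalSpace X] [ChartedSpace (EuclideanSpace ℂ (Fin (n + 1))) X]
  [IsManifold 𝓘(ℂ, EuclideanSpace ℂ (Fin (n + 1))) ω X] [T2Space X] [CompactSpace X]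
  {π : X → B} {b₀ : B}

/-- If `π` is a submersion along the fibre over `b₀`, then this fibre is a `C¹` retract of one of its
neighbourhoods. -/
theorem exists_isFiberRetractionAt
    (hπ : ContMDiff 𝓘(ℂ, EuclideanSpace ℂ (Fin (n + 1))) 𝓘(ℂ) ω π)
    (hs : ∀ x, π x = b₀ →
      Function.Surjective (mfderiv 𝓘(ℂ, EuclideanSpace ℂ (Fin (n + 1))) 𝓘(ℂ) π x)) :
    ∃ r : X → X, ∀ y, π y = b₀ →
      IsFiberRetractionAt (EuclideanSpace ℂ (Fin (n + 1))) π b₀ r y := by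
  have : IsManifold 𝓘(ℂ, EuclideanSpace ℂ (Fin (n + 1))) ∞ X := IsManifold.of_le (n := ω) le_top
  have : IsManifold 𝓘(ℝ, EuclideanSpace ℂ (Fin (n + 1))) ∞ X := isManifold_real_of_complex
  have : FiniteDimensional ℝ (EuclideanSpace ℂ (Fin (n + 1))) := FiniteDimensional.trans ℝ ℂ _
  have hF : IsCompact (π ⁻¹' {b₀}) := (isClosed_singleton.preimage hπ.continuous).isCompact
  have hpatch : ∀ x, π x = b₀ → ∃ N ∈ 𝓝 x, ∀ r : X → X, ∃ r' : X → X,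
      (∀ y ∈ N, π y = b₀ →
        IsFiberRetractionAt (EuclideanSpace ℂ (Fin (n + 1))) π b₀ r' y) ∧
      ∀ y, π y = b₀ → IsFiberRetractionAt (EuclideanSpace ℂ (Fin (n + 1))) π b₀ r y →
        IsFiberRetractionAt (EuclideanSpace ℂ (Fin (n + 1))) π b₀ r' y := by
    intro x hx
    obtain ⟨G, e, hxe, he⟩ := exists_isSubmersionChart hπ hx (hs x hx)
    exact he.exists_patch hxe
  choose N hN hp using hpatch
  obtain ⟨t, ht⟩ := hF.elim_nhds_subcover' (fun x hx => N x hx) fun x hx => hN x hx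
  -- Starting from the identity map, the finitely many neighbourhoods covering the fibre are treated
  -- one at a time; each patch keeps what has been achieved before.
  have key : ∀ t : Finset (π ⁻¹' {b₀}), ∃ r : X → X, ∀ x ∈ t, ∀ y ∈ N x x.2, π y = b₀ →
      IsFiberRetractionAt (EuclideanSpace ℂ (Fin (n + 1))) π b₀ r y := by
    classical
    intro t
    induction t using Finset.induction_on with
    | empty => exact ⟨id, by simp⟩
    | insert a t _ ih =>
      obtain ⟨r, hr⟩ := ih
      obtain ⟨r', h1, h2⟩ := hp a a.2 r
      refine ⟨r', fun x hx y hy hy₀ => ?_⟩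
      rcases Finset.mem_insert.1 hx with rfl | hx
      · exact h1 y hy hy₀
      · exact h2 y hy₀ (hr x hx y hy hy₀)
  obtain ⟨r, hr⟩ := key t
  refine ⟨r, fun y hy => ?_⟩
  obtain ⟨x, hx, hyx⟩ := mem_iUnion₂.1 (ht hy)
  exact hr x hx y hyx hy

/-- Over a neighbourhood of `b₀`, the pair `(π, r)` is a bijection onto the product with the fibre. -/
theorem exists_proper_retraction
    (hπ : ContMDiff 𝓘(ℂ, EuclideanSpace ℂ (Fin (n + 1))) 𝓘(ℂ) ω π)
    (hs : ∀ x, π x = b₀ →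
      Function.Surjective (mfderiv 𝓘(ℂ, EuclideanSpace ℂ (Fin (n + 1))) 𝓘(ℂ) π x)) :
    ∃ r : X → X, (∀ y, π y = b₀ → r y = y) ∧ ∀ᶠ b in 𝓝 b₀,
      (∀ x, π x = b → ContinuousAt r x ∧ π (r x) = b₀) ∧
      (∀ x y, π x = b → π y = b → r x = r y → x = y) ∧
      ∀ y, π y = b₀ → ∃ x, π x = b ∧ r x = y := by
  obtain ⟨r, hr⟩ := exists_isFiberRetractionAt hπ hs
  have : IsManifold 𝓘(ℂ, EuclideanSpace ℂ (Fin (n + 1))) 1 X := IsManifold.of_le (n := ω) le_top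
  have : IsManifold 𝓘(ℝ, EuclideanSpace ℂ (Fin (n + 1))) 1 X := isManifold_real_of_complex
  have : FiniteDimensional ℝ (EuclideanSpace ℂ (Fin (n + 1))) := FiniteDimensional.trans ℝ ℂ _
  have hF : IsCompact (π ⁻¹' {b₀}) := (isClosed_singleton.preimage hπ.continuous).isCompact
  have hfix : ∀ y, π y = b₀ → r y = y := fun y hy => (hr y hy).eventually_eq.self_of_nhds hy
  -- The pair `(π, r)` is injective on the compact fibre and locally injective along it, hence
  -- injective on a neighbourhood of it.
  obtain ⟨t, ht, hinj⟩ : ∃ t ∈ 𝓝ˢ (π ⁻¹' {b₀}), InjOn (fun y => (π y, r y)) t := by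
    refine InjOn.exists_mem_nhdsSet ?_ hF ?_ ?_
    · intro x hx y hy h
      rw [← hfix x hx, ← hfix y hy]
      exact congrArg Prod.snd h
    · exact fun x hx => hπ.continuous.continuousAt.prodMk (hr x hx).contMDiffAt.continuousAt
    · intro x hx
      obtain ⟨G, e, hxe, he⟩ := exists_isSubmersionChart hπ hx (hs x hx)
      have : FiniteDimensional ℝ G := FiniteDimensional.trans ℝ ℂ _
      exact (hr x hx).exists_injOn he hxe hx
  -- As `π` is a closed map, nearby fibres lie in any given neighbourhood of the fibre over `b₀`.
  have hfiber : ∀ᶠ b in 𝓝 b₀, ∀ x ∈ π ⁻¹' {b}, (ContinuousAt r x ∧ π (r x) = b₀) ∧ x ∈ t := by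
    refine hπ.continuous.isClosedMap.eventually_nhds_fiber b₀ fun x hx => ?_
    refine Eventually.and (Eventually.and ?_ (hr x hx).eventually_mem) ?_
    · exact ((contMDiffAt_iff_contMDiffAt_nhds (by simp)).1 (hr x hx).contMDiffAt).mono
        fun y hy => hy.continuousAt
    · exact mem_nhdsSet_iff_forall.1 ht x hx
  have hsurj : ∀ᶠ b in 𝓝 b₀, ∀ y ∈ π ⁻¹' {b₀}, π y = b₀ → ∃ x, π x = b ∧ r x = y := by
    refine hF.eventually_forall_of_forall_eventually
      (P := fun b y => π y = b₀ → ∃ x, π x = b ∧ r x = y) fun y hy => ?_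
    obtain ⟨G, e, hye, he⟩ := exists_isSubmersionChart hπ hy (hs y hy)
    have : FiniteDimensional ℝ G := FiniteDimensional.trans ℝ ℂ _
    exact (hr y hy).eventually_exists he hye hy
  refine ⟨r, hfix, ?_⟩
  filter_upwards [hfiber, hsurj] with b h1 h2
  refine ⟨fun x hx => (h1 x hx).1, fun x y hx hy hxy => ?_, fun y hy => h2 y hy hy⟩
  exact hinj (h1 x hx).2 (h1 y hy).2 (Prod.ext (hx.trans hy.symm) hxy)

/-- A proper holomorphic map which is a submersion along the fibre over `b₀` is trivial over every
small round disc around `b₀` in the preferred chart. -/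
theorem exists_discTrivialization
    (hπ : ContMDiff 𝓘(ℂ, EuclideanSpace ℂ (Fin (n + 1))) 𝓘(ℂ) ω π)
    (hs : ∀ x, π x = b₀ →
      Function.Surjective (mfderiv 𝓘(ℂ, EuclideanSpace ℂ (Fin (n + 1))) 𝓘(ℂ) π x))
    {V : Set B} (hV : V ∈ 𝓝 b₀) :
    ∃ (T : DiscTrivialization π b₀) (ρ : ℝ), T.IsChartDisc ρ ∧
      IsOpen (T.disc '' Metric.ball 0 1) ∧ T.disc '' Metric.closedBall 0 1 ⊆ V := by
  obtain ⟨r, hfix, hev⟩ := exists_proper_retraction hπ hs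
  set c := chartAt ℂ b₀
  have hc₀ : c b₀ ∈ c.target := c.map_source (mem_chart_source ℂ b₀)
  have hcs : c.symm (c b₀) = b₀ := c.left_inv (mem_chart_source ℂ b₀)
  have hev' := hev.and hV
  have htend : Tendsto c.symm (𝓝 (c b₀)) (𝓝 b₀) := by
    have := (c.continuousAt_symm hc₀).tendsto
    rwa [hcs] at this
  obtain ⟨ρ, hρ, hball⟩ := Metric.nhds_basis_closedBall.mem_iff.1
    (inter_mem (c.open_target.mem_nhds hc₀) (htend.eventually hev'))
  have hρ' : (ρ : ℂ) ≠ 0 := by exact_mod_cast hρ.ne'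
  set d : ℂ → B := fun w => c.symm (c b₀ + ρ * w) with hd
  have hmem : ∀ w ∈ Metric.closedBall (0 : ℂ) 1, c b₀ + ρ * w ∈ Metric.closedBall (c b₀) ρ := by
    intro w hw
    rw [mem_closedBall_zero_iff] at hw
    rw [mem_closedBall_iff_norm, add_sub_cancel_left, norm_mul, Complex.norm_real,
      Real.norm_of_nonneg hρ.le]
    exact mul_le_of_le_one_right hρ.le hw
  have htgt : ∀ w ∈ Metric.closedBall (0 : ℂ) 1, c b₀ + ρ * w ∈ c.target := fun w hw =>
    (hball (hmem w hw)).1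
  have hcd : ∀ w ∈ Metric.closedBall (0 : ℂ) 1, c (d w) = c b₀ + ρ * w := fun w hw =>
    c.right_inv (htgt w hw)
  have hgood := fun w hw => (hball (hmem w hw)).2
  -- The implication inside the existential allows a total choice of `l`; outside the relevant range
  -- the value is irrelevant.
  have hlift : ∀ (w : ℂ) (y : X), ∃ x, w ∈ Metric.closedBall (0 : ℂ) 1 → π y = b₀ →
      π x = d w ∧ r x = y := by
    intro w y
    by_cases h : w ∈ Metric.closedBall (0 : ℂ) 1 ∧ π y = b₀
    · obtain ⟨x, hx⟩ := (hgood w h.1).1.2.2 y h.2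
      exact ⟨x, fun _ _ => hx⟩
    · exact ⟨y, fun h1 h2 => (h ⟨h1, h2⟩).elim⟩
  choose l hl using hlift
  have hd₀ : d 0 = b₀ := by simp [hd, hcs]
  have hinj : InjOn d (Metric.closedBall 0 1) := by
    intro w hw w' hw' h
    have h1 := congrArg c h
    rw [hcd w hw, hcd w' hw'] at h1
    exact mul_left_cancel₀ hρ' (add_left_cancel h1)
  have hdc : ContinuousOn d (Metric.closedBall 0 1) := by
    refine c.continuousOn_symm.comp (by fun_prop) fun w hw => htgt w hw
  have hretr : ∀ x, π x ∈ d '' Metric.closedBall 0 1 → ContinuousAt r x ∧ π (r x) = b₀ := by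
    rintro x ⟨w, hw, hx⟩
    exact (hgood w hw).1.1 x hx.symm
  have hlr : ∀ w ∈ Metric.closedBall (0 : ℂ) 1, ∀ x, π x = d w → l w (r x) = x := by
    intro w hw x hx
    have h1 := hl w (r x) hw ((hgood w hw).1.1 x hx).2
    exact (hgood w hw).1.2.1 _ _ h1.1 hx h1.2
  have hlc : ContinuousOn (fun q : ℂ × X => l q.1 q.2)
      (Metric.closedBall 0 1 ×ˢ (π ⁻¹' {b₀})) := by
    -- Continuity of the inverse comes from compactness: `(π, r)` is a continuous bijection from a
    -- compact space, the part of `X` over the disc, to a Hausdorff space.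
    have hK : IsCompact (π ⁻¹' (d '' Metric.closedBall 0 1)) :=
      ((((isCompact_closedBall (0 : ℂ) 1).image_of_continuousOn hdc).isClosed).preimage
        hπ.continuous).isCompact
    have : CompactSpace (π ⁻¹' (d '' Metric.closedBall 0 1)) := isCompact_iff_compactSpace.1 hK
    have hcoord : ∀ w ∈ Metric.closedBall (0 : ℂ) 1, (c (d w) - c b₀) / ρ = w := by
      intro w hw
      rw [hcd w hw]
      field_simp
      ring
    let E : π ⁻¹' (d '' Metric.closedBall 0 1) ≃
        ((Metric.closedBall 0 1 ×ˢ (π ⁻¹' {b₀}) : Set (ℂ × X))) :=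
      { toFun := fun x => ⟨((c (π x) - c b₀) / ρ, r x), by
          obtain ⟨x, w, hw, hx⟩ := x
          refine ⟨?_, (hretr x ⟨w, hw, hx⟩).2⟩
          change (c (π x) - c b₀) / ρ ∈ _
          rwa [← hx, hcoord w hw]⟩
        invFun := fun p => ⟨l p.1.1 p.1.2, p.1.1, p.2.1, (hl _ _ p.2.1 p.2.2).1.symm⟩
        left_inv := by
          rintro ⟨x, w, hw, hx⟩
          refine Subtype.ext ?_
          change l ((c (π x) - c b₀) / ρ) (r x) = x
          rw [← hx, hcoord w hw]
          exact hlr w hw x hx.symm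
        right_inv := by
          rintro ⟨⟨w, y⟩, hw, hy⟩
          refine Subtype.ext (Prod.ext ?_ ?_)
          · change (c (π (l w y)) - c b₀) / ρ = w
            rw [(hl w y hw hy).1, hcoord w hw]
          · exact (hl w y hw hy).2 }
    have hE : Continuous E := by
      refine Continuous.subtype_mk (Continuous.prodMk ?_ ?_) _
      · refine Continuous.div_const (Continuous.sub ?_ continuous_const) _
        refine c.continuousOn.comp_continuous (hπ.continuous.comp continuous_subtype_val) ?_
        rintro ⟨x, w, hw, hx⟩
        change π x ∈ c.source
        rw [← hx]
        exact c.map_target (htgt w hw)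
      · rw [continuous_iff_continuousAt]
        intro x
        exact ContinuousAt.comp (hretr x x.2).1 continuousAt_subtype_val
    rw [continuousOn_iff_continuous_domRestrict]
    exact continuous_subtype_val.comp (hE.homeoOfEquivCompactToT2 (f := E)).symm.continuous
  let T : DiscTrivialization π b₀ :=
    { disc := d
      disc_zero := hd₀
      disc_holomorphic := fun w hw => by
        have h1 : ContMDiffAt 𝓘(ℂ) 𝓘(ℂ) ω c.symm (c b₀ + ρ * w) :=
          contMDiffAt_symm_of_mem_maximalAtlas (IsManifold.chart_mem_maximalAtlas b₀) (htgt w hw)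
        have h2 : ContMDiffAt 𝓘(ℂ) 𝓘(ℂ) ω (fun w : ℂ => c b₀ + ρ * w) w :=
          (contDiffAt_const.add (contDiffAt_const.mul contDiffAt_id)).contMDiffAt
        exact h1.comp w h2
      disc_injOn := hinj
      retr := r
      lift := l
      retr_continuousOn := fun x hx => (hretr x hx).1.continuousWithinAt
      lift_continuousOn := hlc
      retr_mem := fun x hx => (hretr x hx).2
      lift_mem := fun w hw y hy => (hl w y hw hy).1
      retr_lift := fun w hw y hy => (hl w y hw hy).2
      lift_retr := hlr
      lift_zero := fun y hy => by
        have h0 := hlr 0 (by simp) y (hy.trans hd₀.symm)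
        rwa [hfix y hy] at h0 }
  refine ⟨T, ρ, ⟨hρ, fun w hw => ⟨c.map_target (htgt w hw), hcd w hw⟩⟩, ?_, ?_⟩
  · have himage : T.disc '' Metric.ball 0 1 =
        c.symm '' ((fun w : ℂ => (w - c b₀) / ρ) ⁻¹' Metric.ball 0 1) := by
      have : (fun w : ℂ => (w - c b₀) / ρ) ⁻¹' Metric.ball 0 1 =
          (fun w : ℂ => c b₀ + ρ * w) '' Metric.ball 0 1 := by
        refine (congrFun (image_eq_preimage_of_inverse (fun w => ?_) fun w => ?_) _).symm
        · field_simp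
          ring
        · field_simp
          ring
      rw [this, image_image]
    rw [himage]
    refine c.symm.isOpen_image_of_subset_source
      (Metric.isOpen_ball.preimage (by fun_prop)) fun w hw => ?_
    have h1 := htgt _ (Metric.ball_subset_closedBall hw)
    rwa [mul_div_cancel₀ _ hρ', add_sub_cancel] at h1
  · rintro _ ⟨w, hw, rfl⟩
    exact (hgood w hw).2

end Trivialization

/-! ## The gluing equivalences -/

section Gluing

variable {B X : Type} [TopologicalSpace X] {π : X → B} {b₀ : B} [TopologicalSpace B]
  [ChartedSpace ℂ B] {T : DiscTrivialization π b₀} {h : FiberSphere π b₀} {q : I → I}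

/-- On the annulus the point `((2|w| - 1) / |w|) w` has the angle of `w` and radius `2|w| - 1`,
which is `glueScale` of the radius. -/
theorem DiscTrivialization.isGluing_modify (hq : IsGlueProfile q) {g : ℂ → X}
    (hg : ∀ p : I × Circle, (p.1 : ℝ) < 1 / 2 → g (polarPoint p) = h.map (q p.1, p.2))
    {s s' : B → X} (hs : ∀ b, π (s b) = b) (hs₀ : s b₀ = h.top)
    (hs' : s' = T.modify h glueScale q s) : T.IsGluing g s s' := by
  subst hs'
  refine ⟨fun b hb => T.modify_of_notMem s hb, fun w hw hw1 => ?_, fun w hw => ?_⟩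
  · obtain ⟨⟨r, u⟩, rfl⟩ := exists_polarPoint (mem_closedBall_zero_iff.2 hw1)
    rw [norm_polarPoint] at hw ⊢
    have hr : (r : ℂ) ≠ 0 := by
      rw [Complex.ofReal_ne_zero]
      have : 1 / 2 ≤ (r : ℝ) := hw
      linarith
    have hscale : polarPoint (glueScale r, u) =
        ((((2 * (r : ℝ) - 1) / r : ℝ) : ℂ)) * polarPoint (r, u) := by
      simp only [polarPoint, coe_glueScale hw]
      push_cast
      field_simp
    rw [T.modify_disc (hq.isProfile h), T.modifyFiber_of_eq_one hs hs₀ (hq.one r hw), hscale]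
  · have hw1 : w ∈ Metric.closedBall (0 : ℂ) 1 := mem_closedBall_zero_iff.2 (by linarith)
    obtain ⟨⟨r, u⟩, rfl⟩ := exists_polarPoint hw1
    rw [norm_polarPoint] at hw
    rw [T.modify_disc (hq.isProfile h), modifyFiber, if_pos (glueScale_eq_zero hw.le), hg _ hw]

/-- Gluing a family of constant loops does not change the homotopy class of a section. -/
theorem DiscTrivialization.homotopic_of_modify_path [T2Space B]
    (hT : IsOpen (T.disc '' Metric.ball 0 1)) (hq : IsGlueProfile q)
    (hh : ∀ x u u', h.map (x, u) = h.map (x, u')) {s s' : C(B, X)} (hs : ∀ b, π (s b) = b)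
    (hs₀ : s b₀ = h.top) (hs' : ⇑s' = T.modify h glueScale q s) : s'.Homotopic s := by
  have hc := continuous_glueScale
  have hqc := hq.continuous
  -- As the loops are constant, the condition at the centre holds for every profile, so the profile
  -- may be raised to `1` at the centre too; the scaling is undone in the second half. The value
  -- over `b₀` moves, which is harmless for the class.
  refine T.modify_homotopic hT (a := fun t r => mixI (glueScale t) (glueScale r) r)
    (q := fun t r => max (q r) (σ (glueScale (σ t))))
    (continuous_mixI (by fun_prop) (by fun_prop) (by fun_prop)) (by fun_prop)
    (fun t => ⟨?_, ?_, fun r => ?_, fun u u' => hh _ u u'⟩) hs hs₀ (fun b => ?_) fun b => ?_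
  · simp only [glueScale_zero, mixI_self]
  · simp only [glueScale_one, mixI_self]
  · by_cases ht : glueScale t = 0
    · rcases (hq.isProfile h).zero_or_one r with hr | hr
      · exact Or.inl (by rw [ht, mixI_zero, hr])
      · exact Or.inr (by rw [hr]; exact max_eq_left le_one')
    · right
      have h1 : glueScale (σ t) = 0 := by
        refine glueScale_eq_zero ?_
        rw [coe_symm_eq]
        linarith [half_lt_of_glueScale_ne_zero ht]
      rw [h1, symm_zero]
      exact max_eq_right le_one'
  · rw [hs']
    congr 1
    · funext r
      rw [glueScale_zero, mixI_zero]
    · funext r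
      rw [symm_zero, glueScale_one, symm_one]
      exact (max_eq_left nonneg').symm
  · have h1 : (fun r => mixI (glueScale 1) (glueScale r) r) = fun r => r := by
      funext r
      rw [glueScale_one, mixI_one]
    have h2 : (fun r => max (q r) (σ (glueScale (σ 1)))) = fun _ => 1 := by
      funext r
      rw [symm_one, glueScale_zero, symm_zero]
      exact max_eq_right le_one'
    rw [h1, h2, (T.modify_id hs hs₀).2]

/-- The family of constant loops along a meridian of the sphere `f`. -/
noncomputable def FiberSphere.meridian (f : C(OnePoint ℂ, X)) (hf : ∀ p, π (f p) = b₀) :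
    FiberSphere π b₀ where
  map := f.comp (sphereParam.comp ⟨fun p => (p.1, 1), by fun_prop⟩)
  bot := f ((0 : ℂ) : OnePoint ℂ)
  top := f OnePoint.infty
  map_mem p := hf _
  map_zero u := congrArg f (sphereParam_zero 1)
  map_one u := congrArg f (sphereParam_one 1)

end Gluing

/-! ### The radial profile of the explicit gluing formula. -/

section TanProfile

/-- The denominator of the radial profile is positive. -/
theorem cos_add_mul_sin_pos {x : ℝ} (h0 : 0 ≤ x) (h1 : x ≤ 1 / 2) :
    0 < Real.cos (Real.pi * x) + x * Real.sin (Real.pi * x) := by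
  have hπ := Real.pi_pos
  rcases h1.lt_or_eq with h1 | rfl
  · refine add_pos_of_pos_of_nonneg (Real.cos_pos_of_mem_Ioo ⟨?_, ?_⟩)
      (mul_nonneg h0 (Real.sin_nonneg_of_nonneg_of_le_pi ?_ ?_)) <;> nlinarith
  · rw [mul_one_div, Real.cos_pi_div_two, Real.sin_pi_div_two]
    norm_num

theorem mul_sin_nonneg {x : ℝ} (h0 : 0 ≤ x) (h1 : x ≤ 1 / 2) :
    0 ≤ x * Real.sin (Real.pi * x) :=
  mul_nonneg h0 (Real.sin_nonneg_of_nonneg_of_le_pi (by positivity)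
    (by nlinarith [Real.pi_pos]))

theorem cos_pi_mul_nonneg {x : ℝ} (h0 : 0 ≤ x) (h1 : x ≤ 1 / 2) : 0 ≤ Real.cos (Real.pi * x) :=
  Real.cos_nonneg_of_mem_Icc ⟨by nlinarith [Real.pi_pos], by nlinarith [Real.pi_pos]⟩

/-- The radial profile of `w ↦ [tan(π|w|) w : 1]`, with value `1` for `|w| ≥ 1/2`. -/
noncomputable def tanProfile (r : I) : I :=
  have h0 : 0 ≤ min (r : ℝ) (1 / 2) := le_min r.2.1 (by norm_num)
  have h1 : min (r : ℝ) (1 / 2) ≤ 1 / 2 := min_le_right _ _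
  ⟨min (r : ℝ) (1 / 2) * Real.sin (Real.pi * min (r : ℝ) (1 / 2)) /
    (Real.cos (Real.pi * min (r : ℝ) (1 / 2)) +
      min (r : ℝ) (1 / 2) * Real.sin (Real.pi * min (r : ℝ) (1 / 2))),
    div_nonneg (mul_sin_nonneg h0 h1) (cos_add_mul_sin_pos h0 h1).le,
    (div_le_one (cos_add_mul_sin_pos h0 h1)).2
      (le_add_of_nonneg_left (cos_pi_mul_nonneg h0 h1))⟩

theorem coe_tanProfile {r : I} (hr : (r : ℝ) ≤ 1 / 2) : (tanProfile r : ℝ) =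
    r * Real.sin (Real.pi * r) / (Real.cos (Real.pi * r) + r * Real.sin (Real.pi * r)) := by
  simp only [tanProfile, min_eq_left hr]

theorem isGlueProfile_tanProfile : IsGlueProfile tanProfile where
  continuous := by
    refine Continuous.subtype_mk (Continuous.div (by fun_prop) (by fun_prop) fun r => ?_) _
    exact (cos_add_mul_sin_pos (le_min r.2.1 (by norm_num)) (min_le_right _ _)).ne'
  zero := by
    refine Subtype.ext ?_
    rw [coe_tanProfile (by norm_num)]
    simp
  one r hr := by
    refine Subtype.ext ?_
    simp only [tanProfile, min_eq_right hr]
    rw [mul_one_div, Real.cos_pi_div_two, Real.sin_pi_div_two]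
    norm_num

/-- The profile solves `s / (1 - s) = r tan (π r)` for `s`, the left side being the norm of the
affine coordinate at radial coordinate `s`. Clearing the cosine gives a formula that remains regular
at `r = 1/2`. -/
theorem one_sub_tanProfile {r : I} (hr : (r : ℝ) < 1 / 2) : 0 < 1 - (tanProfile r : ℝ) ∧
    (tanProfile r : ℝ) / (1 - tanProfile r) = r * Real.tan (Real.pi * r) := by
  have hpos := cos_add_mul_sin_pos r.2.1 hr.le
  have hcos : 0 < Real.cos (Real.pi * r) :=
    Real.cos_pos_of_mem_Ioo ⟨by nlinarith [Real.pi_pos, r.2.1], by nlinarith [Real.pi_pos]⟩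
  have h1 : 1 - (tanProfile r : ℝ) =
      Real.cos (Real.pi * r) / (Real.cos (Real.pi * r) + r * Real.sin (Real.pi * r)) := by
    rw [coe_tanProfile hr.le, eq_div_iff hpos.ne', sub_mul, div_mul_cancel₀ _ hpos.ne']
    ring
  refine ⟨by rw [h1]; positivity, ?_⟩
  rw [h1, coe_tanProfile hr.le, div_div_div_cancel_right₀ hpos.ne', Real.tan_eq_sin_div_cos,
    mul_div_assoc]

theorem sphereDisc_polarPoint {X : Type} (f : OnePoint ℂ → X) {p : I × Circle}
    (hp : (p.1 : ℝ) < 1 / 2) : sphereDisc f (polarPoint p) = f (sphereParam (tanProfile p.1, p.2)) := by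
  obtain ⟨h1, h2⟩ := one_sub_tanProfile hp
  rw [sphereDisc, norm_polarPoint, sphereParam_of_ne_one (fun h => by rw [h] at h1; simp at h1), h2,
    polarPoint]
  congr 2
  push_cast
  ring

theorem sphereDiscOpp_polarPoint {X : Type} (f : OnePoint ℂ → X) {p : I × Circle}
    (hp : (p.1 : ℝ) < 1 / 2) :
    sphereDiscOpp f (polarPoint p) = f (sphereParam (σ (tanProfile p.1), p.2)) := by
  obtain ⟨h1, h2⟩ := one_sub_tanProfile hp
  have h3 : σ (tanProfile p.1) ≠ 0 := fun h => by
    have := congrArg Subtype.val h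
    rw [coe_symm_eq] at this
    exact h1.ne' this
  have h4 : sphereParam (σ (tanProfile p.1), p.2) = _ :=
    sphereParamFun_eq_inv (p := (σ (tanProfile p.1), p.2)) h3
  rw [sphereDiscOpp, norm_polarPoint, h4]
  simp only [coe_symm_eq, sub_sub_cancel]
  rw [h2, polarPoint, ← Circle.coe_inv, Circle.coe_inv_eq_conj, map_mul, Complex.conj_ofReal]
  congr 3
  push_cast
  ring

end TanProfile

end UnitInterval

theorem mainTheorem7 {n : ℕ} {B X : Type}
    [TopologicalSpace B] [ChartedSpace ℂ B] [IsManifold 𝓘(ℂ) ω B]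
    [T2Space B] [CompactSpace B] [ConnectedSpace B]
    [TopologicalSpace X] [ChartedSpace (EuclideanSpace ℂ (Fin (n + 1))) X]
    [IsManifold 𝓘(ℂ, EuclideanSpace ℂ (Fin (n + 1))) ω X]
    [T2Space X] [CompactSpace X] [ConnectedSpace X]
    (π : X → B)
    (hπ : ContMDiff 𝓘(ℂ, EuclideanSpace ℂ (Fin (n + 1))) 𝓘(ℂ) ω π)
    (hπ_surj : Function.Surjective π)
    (b₀ : B)
    (h_smooth : ∀ x, π x = b₀ →
      Function.Surjective (mfderiv 𝓘(ℂ, EuclideanSpace ℂ (Fin (n + 1))) 𝓘(ℂ) π x))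
    (S₀ : Set (AdmissibleJet n π)) (hS₀_fin : S₀.Finite)
    (hS₀_inj : InjOn AdmissibleJet.base S₀) (hS₀_ne : ∀ j ∈ S₀, j.base ≠ b₀)
    (j₀ j₀' : AdmissibleJet n π)
    (hj₀_base : j₀.base = b₀) (hj₀_order : j₀.order = 0)
    (hj₀'_base : j₀'.base = b₀) (hj₀'_order : j₀'.order = 0)
    (h_disjoint : j₀.support ≠ j₀'.support)
    (α β : H₂ X)
    (f : C(OnePoint ℂ, X))
    (hf : ContMDiff 𝓘(ℂ) 𝓘(ℂ, EuclideanSpace ℂ (Fin (n + 1))) ω f)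
    (hf_fiber : ∀ p, π (f p) = b₀)
    (hf_infty : f OnePoint.infty = j₀.support)
    (hf_zero : f ((0 : ℂ) : OnePoint ℂ) = j₀'.support)
    (hf_class : HasClass f β) :
    Nonempty (SectStop π α (insert j₀ S₀) ≃ₕ SectStop π (α + β) (insert j₀ S₀)) ∧
    ∃ (T : DiscTrivialization π b₀)
      (Φ : SectStop π α (insert j₀ S₀) ≃ₕ SectStop π (α + β) (insert j₀' S₀)),
      (∀ j ∈ S₀, j.base ∉ T.disc '' Metric.closedBall 0 1) ∧
      (∀ σ, T.IsGluing (sphereDisc f) σ.1 (Φ.toFun σ).1) ∧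
      (∀ τ, T.IsGluing (sphereDiscOpp f) τ.1 (Φ.invFun τ).1) := by

  -- The disc is chosen inside the complement of the finitely many base points of the jets in `S₀`.
  obtain ⟨T, ρ, hρ, hT, hTV⟩ := exists_discTrivialization hπ h_smooth
    (V := (AdmissibleJet.base '' S₀)ᶜ) ((hS₀_fin.image _).isClosed.isOpen_compl.mem_nhds (by
      rintro ⟨j, hj, hjb⟩
      exact hS₀_ne j hj hjb))
  have hS₀ : ∀ j ∈ S₀, j.base ∉ T.disc '' Metric.closedBall 0 1 := fun j hj hb =>
    hTV hb ⟨j, hj, rfl⟩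
  obtain ⟨ν, hν, rfl⟩ := hf_class
  have hq := isGlueProfile_tanProfile
  have hsect : ∀ {γ : H₂ X} {j : AdmissibleJet n π} (s : SectStop π γ (insert j S₀)),
      j.base = b₀ → s.1 b₀ = j.support := fun {γ j} s hj => by
    rw [← hj]
    exact (s.2.2.2 j (mem_insert _ _)).1 ()
  obtain ⟨Φ, hΦ, hΨ⟩ := exists_glue_equiv (h := FiberSphere.ofMap f hf_fiber) hT hq hS₀
    hj₀_base hj₀_order hf_infty.symm hj₀'_base hj₀'_order hf_zero.symm (rfl : α + H₂Map f ν = _)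
    fun s s' hs hs₀ hss' μ hμ => H₂Map_modify_sphere hT hρ hq f hf_fiber hs hs₀ hss' hμ hν
  -- Gluing the meridian instead of the sphere changes the support from `x₀` to `x₀'` and adds the
  -- class `0`.
  obtain ⟨Θ, -, -⟩ := exists_glue_equiv (h := FiberSphere.meridian f hf_fiber) hT hq hS₀
    hj₀_base hj₀_order hf_infty.symm hj₀'_base hj₀'_order hf_zero.symm
    (add_zero (α + H₂Map f ν)).symm fun s s' hs hs₀ hss' μ _ => by
      rw [add_zero, H₂Map_eq_of_homotopic
        (DiscTrivialization.homotopic_of_modify_path hT hq (fun _ _ _ => rfl) hs hs₀ hss')]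
  refine ⟨⟨Φ.trans Θ.symm⟩, T, Φ, hS₀, fun s => ?_, fun s => ?_⟩
  · exact DiscTrivialization.isGluing_modify (h := FiberSphere.ofMap f hf_fiber) hq
      (fun p hp => sphereDisc_polarPoint f hp) s.2.1
      ((hsect s hj₀_base).trans hf_infty.symm) (hΦ s)
  · exact DiscTrivialization.isGluing_modify (h := (FiberSphere.ofMap f hf_fiber).reverse) hq
      (fun p hp => sphereDiscOpp_polarPoint f hp) s.2.1
      ((hsect s hj₀'_base).trans hf_zero.symm) (hΨ s)
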